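/- **Setting.** Let $\lambda$ be the security parameter. A non-uniform p.p.t. adversary is a family of probabilistic, possibly interactive, polynomial-size Boolean circuits. Let $\mathcal G(1^\lambda)$ generate (descriptions of) bilinear groups $(\mathbb G_1,\mathbb G_2,\mathbb G_T,g_1,g_2,g_T,\mu)$ of prime order $q=q(\lambda)$ with efficiently computable generators, group operations and pairing $\mu$ with $\mu(g_1,g_2)=g_T$; write $[\![a]\!]_x=g_x^a$ for $a\in\mathbb Z_q$ (componentwise for vectors) and $[\![a]\!]_{1,2}=([\![a]\!]_1,[\![a]\!]_2)$. Let $\mathtt{PRF}$ be a function family mapping a key and a period $t\in\{0,1\}^\lambda$ to $\mathbb Z_q$. Let $1\le m\le n$, $n\ge 2$, where $m,n,Q$ are polynomially bounded in $\lambda$: there are $n$ senders, of which $1,\dots,m$ are honest, and $Q$ queries. **XDLin.** For an adversary $\mathcal D$, $\mathrm{Adv}^{\mathrm{XDLin}}_{\mathcal D}(\lambda)$ is the maximum over $x\in\{1,2\}$ of $|\Pr[1\leftarrow\mathcal D(P_0)]-\Pr[1\leftarrow\mathcal D(P_1)]|$, where $a,b,c,d,e$ are uniform in $\mathbb Z_q$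 and $P_0$, $P_1$ consist of the public parameters, $[\![a]\!]_{1,2},[\![b]\!]_{1,2},[\![ac]\!]_{1,2},[\![bd]\!]_{1,2}$ and $[\![c+d]\!]_x$, respectively $[\![e]\!]_x$. XDLin holds if this is negligible for every non-uniform p.p.t. $\mathcal D$. **CPRF.** With independent uniform keys $k_{ij}=k_{ji}$ $(i<j)$ put $K_i(t)=\sum_{j\ne i}(-1)^{[j<i]}\mathtt{PRF}(k_{ij},t)$, so that $\sum_{i=1}^n K_i(t)=0$. In the CPRF game an adversary $\mathcal B$ chooses $\mathcal K\subseteq[n]$ with $|\mathcal K|\le n-2$, receives all $k_{ij}$ with $i$ or $j$ in $\mathcal K$, and adaptively submits periods $t$. It is answered with $(K_j(t))_{j\notin\mathcal K}$ in $\mathbf{CPRF.Exp}^{(0)}$, and in $\mathbf{CPRF.Exp}^{(1)}$ with $(d_j)_{j\notin\mathcal K}$ drawn uniformly, independently for distinct $t$, subject to $\sum_{j\notin\mathcal K}d_j=-\sum_{i\in\mathcal K}K_i(t)$. $\mathrm{Adv}^{\mathrm{CPRF}}_{\mathcal B}(\lambda)$ is the absolute difference of the probabilities that $\mathcal B$ outputs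 $1$. **Experiments.** In $\mathbf{Exp}^{(b)}$, $b\in\{0,1\}$, the adversary $\mathcal A$ first outputs $\pi\in S_m$, extended to $S_n$ by $\pi(j)=j$ for $j>m$. The challenger draws the public parameters, the CPRF keys, and uniform $\theta_i\in\mathbb Z_q^\times$, $R_i\in GL_8(\mathbb Z_q)$, $\rho_j,\beta_{i,j},\gamma_{i,j},\alpha_{i,t},\alpha'_{i,t}\in\mathbb Z_q$; it puts $C_i=R_i^{-1}$ and, for $i,j\in[n]$, with $\sigma=\pi$ if $b=0$ and $\sigma=\mathrm{id}$ if $b=1$, $$tk_i^j=[\![(\rho_j,0,0,\beta_{i,j},\gamma_{i,j},0,\theta_i\delta_{j,\sigma(i)},0)R_i]\!]_2,\qquad ct_{i,0}=[\![C_i(K_i(0),\alpha_{i,0},\alpha'_{i,0},0,0,0,1,0)^\top]\!]_1 .$$ $\mathcal A$ receives the public parameters, the public $[\![\rho_j]\!]_2$, all tokens $tk_i^j$, and $\langle tk,ct(0)\rangle$, whose $j$-th entry is $\prod_{i=1}^n\prod_{s=1}^8\mu\big((ct_{i,0})_s,(tk_i^j)_s\big)$. Then, for $t=1,\dots,Q$,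 $\mathcal A$ adaptively chooses $(x_{i,t})_{i\le m}\in\mathbb Z_q^m$ and receives, for $i\le m$, $$ct_{i,t}=[\![C_i(K_i(t),\alpha_{i,t},\alpha'_{i,t},0,0,0,y_{i,t},0)^\top]\!]_1,\qquad y_{i,t}=\begin{cases}x_{i,t},&b=0,\\ x_{\pi^{-1}(i),t},&b=1.\end{cases}$$ Finally $\mathcal A$ outputs a bit. **Theorem 1 (Indistinguishability Security).** Suppose that $\mathtt{PRF}$ is a secure pseudorandom function family and that XDLin holds for $\mathcal G$. Then for every non-uniform p.p.t. adversary $\mathcal A$ there are non-uniform p.p.t. adversaries $\mathcal B$ (against the CPRF) and $\mathcal D$ (against XDLin) such that, for every $\lambda$ with $Q<2^\lambda$ (so that the periods $0,\dots,Q$ are distinct $\lambda$-bit strings), $$\left|\Pr[1\leftarrow\mathcal A(\mathbf{Exp}^{(0)})]-\Pr[1\leftarrow\mathcal A(\mathbf{Exp}^{(1)})]\right|\le 2\left[\frac{m(m+1)+Qm}{q}+\mathrm{Adv}^{\mathrm{CPRF}}_{\mathcal B}(\lambda)+\big[Q(m^2+m-2)+m^2\big]\,\mathrm{Adv}^{\mathrm{XDLin}}_{\mathcal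 D}(\lambda)\right].$$ -/

import Mathlib

open scoped BigOperators Matrix

noncomputable section

namespace AnonRouter

/-! ### Boolean circuits and asymptotics -/

/-- `Straight s S`: some straight-line program with `s` NAND gates over the input wires `ι`
has `S` as its set of available wires, each wire being identified with the Boolean function that it
computes. Inputs and the two constants are free, fan-out is unbounded. -/
inductive Straight {ι : Type} : ℕ → Set ((ι → Bool) → Bool) → Prop
  | start : Straight 0 {f | (∃ i, f = fun x => x i) ∨ ∃ b, f = fun _ => b}
  | gate {s : ℕ} {S : Set ((ι → Bool) → Bool)} {f g : (ι → Bool) → Bool} :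
      Straight s S → f ∈ S → g ∈ S → Straight (s + 1) (insert (fun x => !(f x && g x)) S)

/-- `f` is computed by a Boolean circuit with at most `s` gates. -/
def HasCircuit {ι κ : Type} (s : ℕ) (f : (ι → Bool) → κ → Bool) : Prop :=
  ∃ s' ≤ s, ∃ S, Straight s' S ∧ ∀ o, (fun x => f x o) ∈ S

/-- `f` is bounded by a polynomial. -/
def PolyBounded (f : ℕ → ℕ) : Prop := ∃ p : Polynomial ℕ, ∀ k, f k ≤ p.eval k

/-- `f` is negligible: `k ^ c * f k → 0` for every `c`. -/
def Negligible (f : ℕ → ℝ) : Prop :=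
  Asymptotics.SuperpolynomialDecay Filter.atTop (fun k : ℕ => (k : ℝ)) f

/-- `Pr[1 ← experiment]`. -/
def prOne (p : PMF Bool) : ℝ := (p true).toReal

/-- The answers collected in an interaction of `N` rounds: in round `t` the query is computed from
the answers of the earlier rounds (answers not yet given read as `blank`). -/
def interact {N : ℕ} {X Y : Type} (blank : Y) (query : Fin N → (Fin N → Y) → X)
    (answer : Fin N → X → Y) : Fin N → Y :=
  (List.finRange N).foldl (fun r t => Function.update r t (answer t (query t r))) (fun _ => blank)

/-- The binary digits of the canonical representative of `a` in `{0, …, q - 1}`. -/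
def bitsOf {q : ℕ} (a : ZMod q) : Fin q.size → Bool := fun l => a.val.testBit l

/-- The residue class denoted by a string of binary digits. -/
def ofBits {q : ℕ} (b : Fin q.size → Bool) : ZMod q := ((Nat.ofBits b : ℕ) : ZMod q)

/-- The period `t` written with `k` binary digits. -/
def period (k t : ℕ) : Fin k → Bool := fun l => t.testBit l

/-! ### Bilinear groups and the external decisional linear assumption -/

/-- A bilinear group of order `q` with group elements represented by `L`-bit strings. -/
structure BilinearGroup (q L : ℕ) where
  G₁ : Type
  G₂ : Type
  GT : Type
  [grp₁ : CommGroup G₁]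
  [grp₂ : CommGroup G₂]
  [grpT : CommGroup GT]
  g₁ : G₁
  g₂ : G₂
  gT : GT
  order₁ : orderOf g₁ = q
  order₂ : orderOf g₂ = q
  orderT : orderOf gT = q
  gen₁ : ∀ x : G₁, x ∈ Subgroup.zpowers g₁
  gen₂ : ∀ x : G₂, x ∈ Subgroup.zpowers g₂
  genT : ∀ x : GT, x ∈ Subgroup.zpowers gT
  pair : G₁ →* G₂ →* GT
  pair_gen : pair g₁ g₂ = gT
  enc₁ : G₁ → Fin L → Bool
  enc₂ : G₂ → Fin L → Bool
  encT : GT → Fin L → Bool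
  enc₁_inj : Function.Injective enc₁
  enc₂_inj : Function.Injective enc₂
  encT_inj : Function.Injective encT

attribute [instance] BilinearGroup.grp₁ BilinearGroup.grp₂ BilinearGroup.grpT

namespace BilinearGroup

variable {q L : ℕ} (G : BilinearGroup q L)

/-- `⟦a⟧₁ = g₁ ^ a`. -/
def in₁ (a : ZMod q) : G.G₁ := G.g₁ ^ a.val

/-- `⟦a⟧₂ = g₂ ^ a`. -/
def in₂ (a : ZMod q) : G.G₂ := G.g₂ ^ a.val

end BilinearGroup

/-- A bilinear group generator. On security parameter `k` it outputs a random bit string (the public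
parameters) that describes a bilinear group of prime order `q k`; from that string the generators,
the group operations and the pairing can be computed in polynomial time. -/
structure GroupGenerator where
  q : ℕ → ℕ
  prime : ∀ k, (q k).Prime
  len : ℕ → ℕ
  len_poly : PolyBounded len
  gen : ∀ k, PMF (Fin (len k) → Bool)
  group : ∀ k, (Fin (len k) → Bool) → BilinearGroup (q k) (len k)
  efficient : ∃ p : Polynomial ℕ, ∀ k,
    (∃ f : (Fin (len k) → Bool) → Fin (len k) → Bool, HasCircuit (p.eval k) f ∧
      ∀ pp ∈ (gen k).support, f pp = (group k pp).enc₁ (group k pp).g₁) ∧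
    (∃ f : (Fin (len k) → Bool) → Fin (len k) → Bool, HasCircuit (p.eval k) f ∧
      ∀ pp ∈ (gen k).support, f pp = (group k pp).enc₂ (group k pp).g₂) ∧
    (∃ f : (Fin 3 × Fin (len k) → Bool) → Fin (len k) → Bool, HasCircuit (p.eval k) f ∧
      ∀ pp ∈ (gen k).support, ∀ x y : (group k pp).G₁,
        f (fun w => ![pp, (group k pp).enc₁ x, (group k pp).enc₁ y] w.1 w.2) =
          (group k pp).enc₁ (x * y)) ∧
    (∃ f : (Fin 3 × Fin (len k) → Bool) → Fin (len k) → Bool, HasCircuit (p.eval k) f ∧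
      ∀ pp ∈ (gen k).support, ∀ x y : (group k pp).G₂,
        f (fun w => ![pp, (group k pp).enc₂ x, (group k pp).enc₂ y] w.1 w.2) =
          (group k pp).enc₂ (x * y)) ∧
    (∃ f : (Fin 3 × Fin (len k) → Bool) → Fin (len k) → Bool, HasCircuit (p.eval k) f ∧
      ∀ pp ∈ (gen k).support, ∀ x y : (group k pp).GT,
        f (fun w => ![pp, (group k pp).encT x, (group k pp).encT y] w.1 w.2) =
          (group k pp).encT (x * y)) ∧
    (∃ f : (Fin 3 × Fin (len k) → Bool) → Fin (len k) → Bool, HasCircuit (p.eval k) f ∧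
      ∀ pp ∈ (gen k).support, ∀ (x : (group k pp).G₁) (y : (group k pp).G₂),
        f (fun w => ![pp, (group k pp).enc₁ x, (group k pp).enc₂ y] w.1 w.2) =
          (group k pp).encT ((group k pp).pair x y))

instance primeFact (𝒢 : GroupGenerator) (k : ℕ) : Fact (𝒢.q k).Prime := ⟨𝒢.prime k⟩

/-- The two source groups. -/
inductive Side
  | one
  | two

namespace BilinearGroup

/-- The bit string that represents `⟦a⟧ₓ`. -/
def bits {q L : ℕ} (G : BilinearGroup q L) : Side → ZMod q → Fin L → Bool
  | Side.one, a => G.enc₁ (G.in₁ a)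
  | Side.two, a => G.enc₂ (G.in₂ a)

end BilinearGroup

/-- Input bits of an XDLin adversary: its coins, the public parameters, the elements
`⟦a⟧, ⟦b⟧, ⟦ac⟧, ⟦bd⟧` in both source groups, and the challenge element. -/
inductive XDLinWire (c L : ℕ) : Type
  | coin (l : Fin c)
  | pp (l : Fin L)
  | elt (y : Side) (i : Fin 4) (l : Fin L)
  | target (l : Fin L)

/-- An XDLin adversary for one security parameter (it knows in which source group the challenge
element lies). -/
structure XDLinAdversary (L : ℕ) where
  coins : ℕ
  guess : Side → (XDLinWire coins L → Bool) → Bool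

/-- Coins and circuits are bounded by `s`. -/
def XDLinAdversary.SizeLE {L : ℕ} (D : XDLinAdversary L) (s : ℕ) : Prop :=
  D.coins ≤ s ∧ ∀ x, HasCircuit s (fun w (_ : Unit) => D.guess x w)

/-- What the XDLin adversary sees. -/
def xdlinView {q L c : ℕ} (G : BilinearGroup q L) (pp : Fin L → Bool) (r : Fin c → Bool)
    (v : Fin 4 → ZMod q) (x : Side) (z : ZMod q) : XDLinWire c L → Bool
  | .coin l => r l
  | .pp l => pp l
  | .elt y i l => G.bits y (v i) l
  | .target l => G.bits x z l

/-- The adversary run on `P₀` (`β = false`, challenge `c + d`) or on `P₁` (`β = true`, challenge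
`e`), the challenge being given in the source group `x`. -/
def xdlinExp (𝒢 : GroupGenerator) (k : ℕ) (D : XDLinAdversary (𝒢.len k)) (x : Side) (β : Bool) :
    PMF Bool := do
  let pp ← 𝒢.gen k
  let r ← PMF.uniformOfFintype (Fin D.coins → Bool)
  let a ← PMF.uniformOfFintype (ZMod (𝒢.q k))
  let b ← PMF.uniformOfFintype (ZMod (𝒢.q k))
  let c ← PMF.uniformOfFintype (ZMod (𝒢.q k))
  let d ← PMF.uniformOfFintype (ZMod (𝒢.q k))
  let e ← PMF.uniformOfFintype (ZMod (𝒢.q k))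
  pure (D.guess x (xdlinView (𝒢.group k pp) pp r ![a, b, a * c, b * d] x
    (if β then e else c + d)))

/-- The XDLin advantage (the larger one of the two choices of the source group). -/
def xdlinAdv (𝒢 : GroupGenerator) (k : ℕ) (D : XDLinAdversary (𝒢.len k)) : ℝ :=
  max |prOne (xdlinExp 𝒢 k D .one false) - prOne (xdlinExp 𝒢 k D .one true)|
    |prOne (xdlinExp 𝒢 k D .two false) - prOne (xdlinExp 𝒢 k D .two true)|

/-- A non-uniform p.p.t. XDLin adversary. -/
def XDLinPPT (𝒢 : GroupGenerator) (D : ∀ k, XDLinAdversary (𝒢.len k)) : Prop :=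
  ∃ p : Polynomial ℕ, ∀ k, (D k).SizeLE (p.eval k)

/-- The external decisional linear assumption. -/
def XDLinHolds (𝒢 : GroupGenerator) : Prop :=
  ∀ D : ∀ k, XDLinAdversary (𝒢.len k), XDLinPPT 𝒢 D → Negligible (fun k => xdlinAdv 𝒢 k (D k))

/-! ### Pseudorandom functions -/

/-- A function family `{0,1}^(keyLen k) × {0,1}^k → ℤ_q`. -/
structure FunFamily (q : ℕ → ℕ) where
  keyLen : ℕ → ℕ
  eval : ∀ k, (Fin (keyLen k) → Bool) → (Fin k → Bool) → ZMod (q k)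

/-- Input bits of a PRF adversary: its coins and the oracle answers. -/
inductive PRFWire (c N w : ℕ) : Type
  | coin (l : Fin c)
  | ans (t : Fin N) (l : Fin w)

/-- A PRF adversary for security parameter `k`: it makes `rounds` adaptive oracle queries. -/
structure PRFAdversary (q k : ℕ) where
  coins : ℕ
  rounds : ℕ
  query : Fin rounds → (PRFWire coins rounds q.size → Bool) → Fin k → Bool
  guess : (PRFWire coins rounds q.size → Bool) → Bool

/-- Coins, number of rounds and circuits are bounded by `s`. -/
def PRFAdversary.SizeLE {q k : ℕ} (A : PRFAdversary q k) (s : ℕ) : Prop :=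
  A.coins ≤ s ∧ A.rounds ≤ s ∧ (∀ t, HasCircuit s (A.query t)) ∧
    HasCircuit s (fun w (_ : Unit) => A.guess w)

/-- What the PRF adversary sees. -/
def prfView {c N w : ℕ} (r : Fin c → Bool) (z : Fin N → Fin w → Bool) : PRFWire c N w → Bool
  | .coin l => r l
  | .ans t l => z t l

/-- The output of the adversary with oracle `O`. -/
def PRFAdversary.play {q k : ℕ} (A : PRFAdversary q k) (r : Fin A.coins → Bool)
    (O : (Fin k → Bool) → ZMod q) : Bool :=
  A.guess (prfView r (interact (fun _ => false) (fun t z => A.query t (prfView r z))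
    (fun _ s => bitsOf (O s))))

/-- The oracle is the family with a random key (`β = false`) or a random function (`β = true`). -/
def prfExp {q : ℕ → ℕ} (F : FunFamily q) (k : ℕ) [Fact (q k).Prime] (A : PRFAdversary (q k) k)
    (β : Bool) : PMF Bool := do
  let r ← PMF.uniformOfFintype (Fin A.coins → Bool)
  let key ← PMF.uniformOfFintype (Fin (F.keyLen k) → Bool)
  let f ← PMF.uniformOfFintype ((Fin k → Bool) → ZMod (q k))
  pure (A.play r (if β then f else F.eval k key))

/-- No non-uniform p.p.t. adversary tells the family from a random function. -/
def PRFSecure (𝒢 : GroupGenerator) (F : FunFamily 𝒢.q) : Prop :=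
  ∀ A : ∀ k, PRFAdversary (𝒢.q k) k, (∃ p : Polynomial ℕ, ∀ k, (A k).SizeLE (p.eval k)) →
    Negligible (fun k => |prOne (prfExp F k (A k) false) - prOne (prfExp F k (A k) true)|)

/-! ### Correlated pseudorandom functions -/

section CPRF

variable {q n κ k : ℕ} (f : (Fin κ → Bool) → (Fin k → Bool) → ZMod q)

/-- `K_i(t) = ∑_{j ≠ i} (-1)^[j < i] PRF(k_{ij}, t)`; the key shared by `i` and `j` is
`key (min i j) (max i j)`. -/
def cprf (key : Fin n → Fin n → Fin κ → Bool) (i : Fin n) (t : Fin k → Bool) : ZMod q :=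
  ∑ j ∈ Finset.univ.erase i, (if j < i then -1 else 1) * f (key (min i j) (max i j)) t

theorem sum_cprf (key : Fin n → Fin n → Fin κ → Bool) (t : Fin k → Bool) :
    ∑ i, cprf f key i t = 0 := by
  have h : ∀ i, cprf f key i t =
      ∑ j, (if j < i then -f (key j i) t else if i < j then f (key i j) t else 0) := by
    intro i
    unfold cprf
    rw [← Finset.sum_erase_add _ _ (Finset.mem_univ i)]
    simp only [lt_irrefl, if_false, add_zero]
    refine Finset.sum_congr rfl fun j hj => ?_
    rcases lt_trichotomy j i with h | h | h
    · simp [h, min_eq_right h.le, max_eq_left h.le]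
    · exact absurd h (Finset.ne_of_mem_erase hj)
    · simp [h, h.not_gt, min_eq_left h.le, max_eq_right h.le]
  simp only [h]
  have split : ∀ i j : Fin n,
      (if j < i then -f (key j i) t else if i < j then f (key i j) t else 0) =
        (if i < j then f (key i j) t else 0) - (if j < i then f (key j i) t else 0) := by
    intro i j
    rcases lt_trichotomy j i with h | h | h
    · simp [h, h.not_gt]
    · simp [h]
    · simp [h, h.not_gt]
  simp only [split, Finset.sum_sub_distrib]
  rw [sub_eq_zero, Finset.sum_comm]

/-- The value tables that agree with the real one on `K` and whose values sum to zero in every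
period. -/
def Tables (K : Finset (Fin n)) (key : Fin n → Fin n → Fin κ → Bool) : Type :=
  {d : (Fin k → Bool) → Fin n → ZMod q //
    ∀ t, (∀ i ∈ K, d t i = cprf f key i t) ∧ ∑ i, d t i = 0}

instance (K : Finset (Fin n)) (key : Fin n → Fin n → Fin κ → Bool) : Nonempty (Tables f K key) :=
  ⟨⟨fun t i => cprf f key i t, fun t => ⟨fun _ _ => rfl, sum_cprf f key t⟩⟩⟩

instance [NeZero q] (K : Finset (Fin n)) (key : Fin n → Fin n → Fin κ → Bool) :
    Fintype (Tables f K key) := by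
  classical exact inferInstanceAs (Fintype {d : (Fin k → Bool) → Fin n → ZMod q //
    ∀ t, (∀ i ∈ K, d t i = cprf f key i t) ∧ ∑ i, d t i = 0})

end CPRF

/-- Input bits of a CPRF adversary: its coins, the keys of the corrupted senders, the answers. -/
inductive CPRFWire (c n κ N w : ℕ) : Type
  | coin (l : Fin c)
  | key (i j : Fin n) (l : Fin κ)
  | ans (t : Fin N) (i : Fin n) (l : Fin w)

/-- A CPRF adversary for security parameter `k`: it corrupts a set of senders that leaves at least
two senders honest, and makes `rounds` adaptive queries. -/
structure CPRFAdversary (q k n κ : ℕ) where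
  coins : ℕ
  rounds : ℕ
  corrupt : (Fin coins → Bool) → Finset (Fin n)
  corrupt_card : ∀ r, (corrupt r).card + 2 ≤ n
  query : Fin rounds → (CPRFWire coins n κ rounds q.size → Bool) → Fin k → Bool
  guess : (CPRFWire coins n κ rounds q.size → Bool) → Bool

/-- Coins, number of rounds and circuits are bounded by `s`. -/
def CPRFAdversary.SizeLE {q k n κ : ℕ} (B : CPRFAdversary q k n κ) (s : ℕ) : Prop :=
  B.coins ≤ s ∧ B.rounds ≤ s ∧ HasCircuit s (fun r i => decide (i ∈ B.corrupt r)) ∧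
    (∀ t, HasCircuit s (B.query t)) ∧ HasCircuit s (fun w (_ : Unit) => B.guess w)

/-- What the CPRF adversary sees: the keys `k_{ij}` (`i < j`) with `i` or `j` in `K`, and in every
round the values of the senders outside `K`. All other wires carry `false`. -/
def cprfView {c n κ N w : ℕ} (K : Finset (Fin n)) (r : Fin c → Bool)
    (key : Fin n → Fin n → Fin κ → Bool) (z : Fin N → Fin n → Fin w → Bool) :
    CPRFWire c n κ N w → Bool
  | .coin l => r l
  | .key i j l => decide (i < j ∧ (i ∈ K ∨ j ∈ K)) && key i j l
  | .ans t i l => decide (i ∉ K) && z t i l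

/-- The output of the adversary when period `s` has the value table `V s`. A repeated period gets
the same answer again, so that only distinct periods matter. -/
def CPRFAdversary.play {q k n κ : ℕ} (B : CPRFAdversary q k n κ) (r : Fin B.coins → Bool)
    (key : Fin n → Fin n → Fin κ → Bool) (V : (Fin k → Bool) → Fin n → ZMod q) : Bool :=
  B.guess (cprfView (B.corrupt r) r key (interact (fun _ _ => false)
    (fun t z => B.query t (cprfView (B.corrupt r) r key z)) (fun _ s i => bitsOf (V s i))))

/-- `CPRF.Exp⁽⁰⁾` (`β = false`: the values are `K_j(t)`) and `CPRF.Exp⁽¹⁾` (`β = true`: the values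
outside the corrupted set are uniformly random with the right sum, independently for every
period). -/
def cprfExp {q : ℕ → ℕ} (F : FunFamily q) (k n : ℕ) [Fact (q k).Prime]
    (B : CPRFAdversary (q k) k n (F.keyLen k)) (β : Bool) : PMF Bool := do
  let r ← PMF.uniformOfFintype (Fin B.coins → Bool)
  let key ← PMF.uniformOfFintype (Fin n → Fin n → Fin (F.keyLen k) → Bool)
  let d ← PMF.uniformOfFintype (Tables (F.eval k) (B.corrupt r) key)
  pure (B.play r key (if β then d.1 else fun t i => cprf (F.eval k) key i t))

/-- The CPRF advantage. -/
def cprfAdv {q : ℕ → ℕ} (F : FunFamily q) (k n : ℕ) [Fact (q k).Prime]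
    (B : CPRFAdversary (q k) k n (F.keyLen k)) : ℝ :=
  |prOne (cprfExp F k n B false) - prOne (cprfExp F k n B true)|

/-- A non-uniform p.p.t. CPRF adversary. -/
def CPRFPPT {q : ℕ → ℕ} (F : FunFamily q) (n : ℕ → ℕ)
    (B : ∀ k, CPRFAdversary (q k) k (n k) (F.keyLen k)) : Prop :=
  ∃ p : Polynomial ℕ, ∀ k, (B k).SizeLE (p.eval k)

/-! ### The protocol -/

section Protocol

variable {q L n : ℕ} (G : BilinearGroup q L)

/-- The token `tk_i^j = ⟦(ρ_j, 0, 0, β_{ij}, γ_{ij}, 0, θ_i δ_{j,σ(i)}, 0) R_i⟧₂`, `σ` being the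
routing permutation. -/
def token (R : Fin n → GL (Fin 8) (ZMod q)) (θ : Fin n → (ZMod q)ˣ) (ρ : Fin n → ZMod q)
    (β γ : Fin n → Fin n → ZMod q) (σ : Equiv.Perm (Fin n)) (i j : Fin n) : Fin 8 → G.G₂ :=
  fun s => G.in₂ ((![ρ j, 0, 0, β i j, γ i j, 0, if j = σ i then (θ i : ZMod q) else 0, 0] ᵥ*
    (R i : Matrix (Fin 8) (Fin 8) (ZMod q))) s)

/-- The ciphertext `⟦C (K, α, α', 0, 0, 0, x, 0)ᵀ⟧₁`. -/
def ciphertext (C : GL (Fin 8) (ZMod q)) (K α α' x : ZMod q) : Fin 8 → G.G₁ :=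
  fun s => G.in₁ (((C : Matrix (Fin 8) (Fin 8) (ZMod q)) *ᵥ ![K, α, α', 0, 0, 0, x, 0]) s)

/-- The `j`-th entry of `⟨tk, ct⟩`: the router pairs the components and multiplies everything. -/
def route (tk : Fin n → Fin n → Fin 8 → G.G₂) (ct : Fin n → Fin 8 → G.G₁) (j : Fin n) : G.GT :=
  ∏ i, ∏ s, G.pair (ct i s) (tk i j s)

end Protocol

/-- Input bits of an adversary against the protocol: its coins, the public parameters, the public
`⟦ρ_j⟧₂`, the routing token, `⟨tk, ct(0)⟩`, and the ciphertexts obtained from its queries. -/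
inductive ExpWire (c L n m Q : ℕ) : Type
  | coin (l : Fin c)
  | pp (l : Fin L)
  | rho (j : Fin n) (l : Fin L)
  | tk (i j : Fin n) (s : Fin 8) (l : Fin L)
  | init (j : Fin n) (l : Fin L)
  | ct (t : Fin Q) (i : Fin m) (s : Fin 8) (l : Fin L)

/-- An adversary against the protocol: it chooses a permutation of the `m` honest senders, then
adaptively `Q` times the messages of the honest senders (in binary), and finally a bit. -/
structure ExpAdversary (q L n m Q : ℕ) where
  coins : ℕ
  perm : (Fin coins → Bool) → Equiv.Perm (Fin m)
  query : Fin Q → (ExpWire coins L n m Q → Bool) → Fin m × Fin q.size → Bool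
  guess : (ExpWire coins L n m Q → Bool) → Bool

/-- Coins and circuits are bounded by `s`. -/
def ExpAdversary.SizeLE {q L n m Q : ℕ} (A : ExpAdversary q L n m Q) (s : ℕ) : Prop :=
  A.coins ≤ s ∧ HasCircuit s (fun r (p : Fin m × Fin m) => decide (A.perm r p.1 = p.2)) ∧
    (∀ t, HasCircuit s (A.query t)) ∧ HasCircuit s (fun w (_ : Unit) => A.guess w)

/-- What the adversary sees. -/
def expView {q L c n m Q : ℕ} (G : BilinearGroup q L) (r : Fin c → Bool) (pp : Fin L → Bool)
    (ρ : Fin n → ZMod q) (tk : Fin n → Fin n → Fin 8 → G.G₂) (init : Fin n → G.GT)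
    (z : Fin Q → Fin m → Fin 8 → Fin L → Bool) : ExpWire c L n m Q → Bool
  | .coin l => r l
  | .pp l => pp l
  | .rho j l => G.enc₂ (G.in₂ (ρ j)) l
  | .tk i j s l => G.enc₂ (tk i j s) l
  | .init j l => G.encT (init j) l
  | .ct t i s l => z t i s l

/-- The experiments `Exp⁽⁰⁾` (`b = false`: routing by `π`, the messages of the honest senders are
encrypted as they are) and `Exp⁽¹⁾` (`b = true`: routing by the identity, sender `i` encrypts the
message of `π⁻¹(i)`). The first `m` of the `n` senders are honest. The setup takes place in
period `0`, the `t`-th query (`t = 1, …, Q`) in period `t`. -/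
def protocolExp (𝒢 : GroupGenerator) (F : FunFamily 𝒢.q) (k : ℕ) {n m Q : ℕ} (hmn : m ≤ n)
    (A : ExpAdversary (𝒢.q k) (𝒢.len k) n m Q) (b : Bool) : PMF Bool := do
  let r ← PMF.uniformOfFintype (Fin A.coins → Bool)
  let π := A.perm r
  let pp ← 𝒢.gen k
  let G := 𝒢.group k pp
  let key ← PMF.uniformOfFintype (Fin n → Fin n → Fin (F.keyLen k) → Bool)
  let K := fun (i : Fin n) (t : ℕ) => cprf (F.eval k) key i (period k t)
  let θ ← PMF.uniformOfFintype (Fin n → (ZMod (𝒢.q k))ˣ)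
  let R ← PMF.uniformOfFintype (Fin n → GL (Fin 8) (ZMod (𝒢.q k)))
  let ρ ← PMF.uniformOfFintype (Fin n → ZMod (𝒢.q k))
  let β ← PMF.uniformOfFintype (Fin n → Fin n → ZMod (𝒢.q k))
  let γ ← PMF.uniformOfFintype (Fin n → Fin n → ZMod (𝒢.q k))
  let α ← PMF.uniformOfFintype (Fin n → Fin (Q + 1) → ZMod (𝒢.q k))
  let α' ← PMF.uniformOfFintype (Fin n → Fin (Q + 1) → ZMod (𝒢.q k))
  let σ := if b then 1 else π.viaFintypeEmbedding (Fin.castLEEmb hmn)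
  let tk := token G R θ ρ β γ σ
  let ct := fun (i : Fin n) (t : Fin (Q + 1)) (x : ZMod (𝒢.q k)) =>
    ciphertext G (R i)⁻¹ (K i t) (α i t) (α' i t) x
  let init := route G tk (fun i => ct i 0 1)
  let answer := fun (t : Fin Q) (x : Fin m → ZMod (𝒢.q k)) (i : Fin m) (s : Fin 8) =>
    G.enc₁ (ct (Fin.castLE hmn i) t.succ (if b then x (π⁻¹ i) else x i) s)
  let query := fun (t : Fin Q) (z : Fin Q → Fin m → Fin 8 → Fin (𝒢.len k) → Bool) (i : Fin m) =>
    (ofBits (fun l => A.query t (expView G r pp ρ tk init z) (i, l)) : ZMod (𝒢.q k))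
  let z := interact (fun _ _ _ => false) query answer
  pure (A.guess (expView G r pp ρ tk init z))

/-- A non-uniform p.p.t. adversary against the protocol. -/
def ExpPPT (𝒢 : GroupGenerator) {n m Q : ℕ → ℕ}
    (A : ∀ k, ExpAdversary (𝒢.q k) (𝒢.len k) (n k) (m k) (Q k)) : Prop :=
  ∃ p : Polynomial ℕ, ∀ k, (A k).SizeLE (p.eval k)

end AnonRouter

end

open scoped BigOperators Matrix

noncomputable section

namespace AnonRouter

/-! ### Finite averages and adaptive interactions. -/

section

/-! ### Averages -/

/-! The initial output carries no information about the routing. Each $R_i$ cancels against its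
inverse and the CPRF values of period 0 sum to zero, so entry $j$ is $g_T$ raised to
$\theta_{\sigma^{-1}(j)}$ (`route_eq`). Indexing these numbers by columns, as $\Theta_j$, gives a
uniform vector that no longer depends on $\sigma$. It remains to hide the rows in which the
$\Theta_j$ sit. The masks of the periods $1,\dots,Q$ are first replaced by uniform vectors with zero
sum, at the price of one CPRF advantage in each experiment (`cprf_bound`).

The rest is a dual-system argument in the eight slots, based on two exact identities. Since the
$R_i$ are uniform, token slots and ciphertext slots may undergo dual changes of basis
(`game_basis`). The fresh randomness of a query absorbs any permutation that depends on the messages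
of that query (`game_perm`, which rests on `expect_interact_perm`). The approximate steps all come
from `xdlin_bound`, applied to a simulator with challenge $c+d+\delta$ that plays one game for
$\delta=0$ and another for every $\delta\neq0$. There are three such hops: filling ciphertext slot 7
where the honest tokens vanish (`value_ciphertext_hop`), filling token slot 5 where the ciphertexts
vanish (`value_token_hop`), and giving a separated column its own masks (`value_mask_hop`). One
XDLin instance serves all queries and senders at once, so the number of hops does not grow with $Q$.

To pass from $\pi$ to the identity, put the permuted messages $x_{\pi^{-1}(i)}$ into slot 7 and
treat the columns one by one (`abs_stage_succ_le`). Column $l$ is moved to slot 5 and gets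
independent masks. Then $\Theta_l$ may move from slot 6 of row $\pi^{-1}(l)$ to slot 7 of row $l$:
both places meet the message $x_{\pi^{-1}(l)}$, so the change of the masks in slot 5 has zero sum
and is absorbed (`value_shift`). This divides by $\rho_l$, whence the restriction to nonzero
$\rho_j$ and a loss of $m/q$ on either side. Afterwards the column is merged back. When all honest
columns have been treated, slots 6 and 7 are exchanged (`value_swap`) and the old messages are
removed.

Both reductions exploit non-uniformity. Every simulator becomes a deterministic circuit once its
randomness is fixed, so $\mathcal D$ and $\mathcal B$ can be the best circuits of a suitable size
(`exists_best_xdlin`, `exists_best_cprf`). The sizes are polynomial because all exponents to be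
simulated are linear forms in the given exponents with coefficients affine in the messages
(`computes_linForm`, `computes_run`). At most $4m+2$ XDLin hops occur, and `protocolExp_bound`
compares their cost with the stated coefficient. -/

/-- The indicator of `b = true`. -/
def ind (b : Bool) : ℝ := if b then 1 else 0

theorem ind_nonneg (b : Bool) : 0 ≤ ind b := by unfold ind; split_ifs <;> norm_num

theorem ind_le_one (b : Bool) : ind b ≤ 1 := by unfold ind; split_ifs <;> norm_num

theorem prOne_pure (b : Bool) : prOne (pure b : PMF Bool) = ind b := by
  change prOne (PMF.pure b) = ind b
  cases b <;> simp [prOne, ind]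

theorem prOne_bind {α : Type} [Fintype α] (p : PMF α) (f : α → PMF Bool) :
    prOne (p >>= f) = ∑ a, (p a).toReal * prOne (f a) := by
  change ((p.bind f) true).toReal = _
  rw [PMF.bind_apply, tsum_fintype, ENNReal.toReal_sum]
  · simp [prOne, ENNReal.toReal_mul]
  · intro a _
    exact ENNReal.mul_ne_top (p.apply_ne_top a) ((f a).apply_ne_top _)

theorem prOne_uniform_bind {α : Type} [Fintype α] [Nonempty α] (f : α → PMF Bool) :
    prOne (PMF.uniformOfFintype α >>= f) = 𝔼 a, prOne (f a) := by
  rw [prOne_bind, Fintype.expect_eq_sum_div_card, Finset.sum_div]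
  refine Finset.sum_congr rfl fun a _ => ?_
  rw [PMF.uniformOfFintype_apply, ENNReal.toReal_inv, ENNReal.toReal_natCast]
  ring

theorem prOne_nonneg (p : PMF Bool) : 0 ≤ prOne p := ENNReal.toReal_nonneg

theorem prOne_le_one (p : PMF Bool) : prOne p ≤ 1 := by
  unfold prOne
  exact ENNReal.toReal_le_of_le_ofReal zero_le_one (by simpa using p.coe_le_one true)

theorem sum_weights {α : Type} [Fintype α] (p : PMF α) : ∑ a, (p a).toReal = 1 := by
  rw [← ENNReal.toReal_sum fun a _ => p.apply_ne_top a, ← tsum_fintype (L := .unconditional _),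
    p.tsum_coe]
  rfl

section expect

variable {α β : Type} [Fintype α] [Fintype β]

theorem expect_sub (f g : α → ℝ) : 𝔼 a, (f a - g a) = 𝔼 a, f a - 𝔼 a, g a :=
  Finset.expect_sub_distrib _ _ _

theorem expect_perm (e : Equiv.Perm α) (f : α → ℝ) : 𝔼 a, f (e a) = 𝔼 a, f a :=
  Fintype.expect_equiv e _ _ fun _ => rfl

theorem expect_prod (f : α × β → ℝ) : 𝔼 a, f a = 𝔼 a, 𝔼 b, f (a, b) :=
  Finset.expect_product _ _ f

theorem expect_mono [Nonempty α] {f g : α → ℝ} (h : ∀ a, f a ≤ g a) : 𝔼 a, f a ≤ 𝔼 a, g a :=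
  Finset.expect_le_expect fun a _ => h a

theorem expect_nonneg {f : α → ℝ} (h : ∀ a, 0 ≤ f a) : 0 ≤ 𝔼 a, f a :=
  Finset.expect_nonneg fun a _ => h a

theorem expect_le_const [Nonempty α] {f : α → ℝ} {c : ℝ} (h : ∀ a, f a ≤ c) : 𝔼 a, f a ≤ c :=
  (expect_mono h).trans_eq (Fintype.expect_const c)

theorem abs_expect_le [Nonempty α] {f : α → ℝ} {c : ℝ} (h : ∀ a, |f a| ≤ c) : |𝔼 a, f a| ≤ c :=
  (Finset.abs_expect_le _ _).trans (expect_le_const h)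

theorem abs_expect_sub_le [Nonempty α] {f g : α → ℝ} {c : ℝ} (h : ∀ a, |f a - g a| ≤ c) :
    |𝔼 a, f a - 𝔼 a, g a| ≤ c := by
  rw [← expect_sub]
  exact abs_expect_le h

theorem abs_weighted_le (p : PMF α) {f : α → ℝ} {c : ℝ}
    (h : ∀ a ∈ p.support, |f a| ≤ c) : |∑ a, (p a).toReal * f a| ≤ c := by
  calc |∑ a, (p a).toReal * f a| ≤ ∑ a, (p a).toReal * c := by
        refine (Finset.abs_sum_le_sum_abs _ _).trans (Finset.sum_le_sum fun a _ => ?_)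
        rw [abs_mul, abs_of_nonneg ENNReal.toReal_nonneg]
        by_cases ha : a ∈ p.support
        · exact mul_le_mul_of_nonneg_left (h a ha) ENNReal.toReal_nonneg
        · have : p a = 0 := by simpa [PMF.mem_support_iff] using ha
          simp [this]
    _ = c := by rw [← Finset.sum_mul, sum_weights, one_mul]

/-- A surjective homomorphism maps the uniform distribution to the uniform one. -/
theorem expect_comp_surjective {A B : Type} [AddGroup A] [AddGroup B] [Fintype A] [Fintype B]
    (φ : A →+ B) (hφ : Function.Surjective φ) (f : B → ℝ) : 𝔼 a, f (φ a) = 𝔼 b, f b := by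
  classical
  -- All fibres are translates of the kernel, hence equally large.
  have fiber : ∀ b, (Finset.univ.filter fun a => φ a = b).card =
      (Finset.univ.filter fun a => φ a = 0).card := by
    intro b
    obtain ⟨a₀, rfl⟩ := hφ b
    refine Finset.card_bij' (fun a _ => a - a₀) (fun a _ => a + a₀) ?_ ?_ ?_ ?_ <;>
      simp +contextual
  have hc : (Fintype.card A : ℝ) =
      Fintype.card B * (Finset.univ.filter fun a => φ a = 0).card := by
    rw [← Nat.cast_mul, Nat.cast_inj, ← Finset.card_univ,
      Finset.card_eq_sum_card_fiberwise (f := φ) (t := Finset.univ) (by simp)]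
    simp [fiber]
  have h0 : ((Finset.univ.filter fun a => φ a = 0).card : ℝ) ≠ 0 := by
    rw [Nat.cast_ne_zero, Finset.card_ne_zero]
    exact ⟨0, by simp⟩
  rw [Fintype.expect_eq_sum_div_card, Fintype.expect_eq_sum_div_card,
    ← Finset.sum_fiberwise Finset.univ φ]
  have : ∀ b, ∑ a with φ a = b, f (φ a) = (Finset.univ.filter fun a => φ a = 0).card * f b := by
    intro b
    rw [Finset.sum_congr rfl (g := fun _ => f b) (by simp +contextual), Finset.sum_const, fiber,
      nsmul_eq_mul]
  rw [Finset.sum_congr rfl fun b _ => this b, ← Finset.mul_sum, hc]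
  field_simp

end expect

/-! ### Interactions -/

section interact

variable {N : ℕ} {X Y : Type} (blank : Y) (query : Fin N → (Fin N → Y) → X)

/-- The answers of the rounds before `t`. -/
def before (t : Fin N) (z : Fin N → Y) : Fin N → Y := fun s => if s < t then z s else blank

/-- Each position is written only in its own round. After `c` rounds the state therefore already
holds the final answers below `c` and is still blank above. -/
theorem foldl_take_apply (answer : Fin N → X → Y) (c : ℕ) :
    let z := interact blank query answer
    ((List.finRange N).take c).foldl (fun r t => Function.update r t (answer t (query t r)))
      (fun _ => blank) = fun s => if s.val < c then z s else blank := by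
  set step : (Fin N → Y) → Fin N → Fin N → Y :=
    fun r t => Function.update r t (answer t (query t r))
  have hnot : ∀ (l : List (Fin N)) (r : Fin N → Y) (s : Fin N), s ∉ l → l.foldl step r s = r s := by
    intro l
    induction l with
    | nil => simp
    | cons a l ih =>
      intro r s hs
      rw [List.mem_cons, not_or] at hs
      rw [List.foldl_cons, ih _ _ hs.2]
      exact Function.update_of_ne hs.1 _ _
  intro z
  funext s
  have hsplit : z = ((List.finRange N).drop c).foldl step
      (((List.finRange N).take c).foldl step fun _ => blank) := by
    rw [← List.foldl_append, List.take_append_drop]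
    rfl
  by_cases h : s.val < c
  · rw [if_pos h, hsplit]
    refine (hnot _ _ s fun hmem => ?_).symm
    obtain ⟨i, hi, he⟩ := List.mem_iff_getElem.1 hmem
    rw [List.getElem_drop, List.getElem_finRange] at he
    subst he
    simp at h
  · rw [if_neg h, hnot]
    intro hmem
    obtain ⟨i, hi, he⟩ := List.mem_iff_getElem.1 hmem
    rw [List.getElem_take, List.getElem_finRange] at he
    subst he
    simp at hi h
    omega

theorem interact_apply (answer : Fin N → X → Y) (t : Fin N) :
    interact blank query answer t =
      answer t (query t (before blank t (interact blank query answer))) := by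
  have h := congrFun (foldl_take_apply blank query answer (t + 1)) t
  have h' := foldl_take_apply blank query answer t
  simp only [Nat.lt_succ_self, if_true] at h
  rw [List.take_add_one, List.foldl_append, h'] at h
  rw [List.getElem?_eq_getElem (by simp), List.getElem_finRange] at h
  simp only [Fin.cast_mk, Fin.eta, Option.toList_some, List.foldl_cons, List.foldl_nil,
    Function.update_self] at h
  exact h.symm

/-- The equation for round `t` involves only the answers of earlier rounds, so it has a single
solution by induction on `t`. An interaction may thus be identified without unfolding the fold. -/
theorem eq_interact {answer : Fin N → X → Y} {z : Fin N → Y}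
    (h : ∀ t, z t = answer t (query t (before blank t z))) : z = interact blank query answer := by
  funext t
  induction t using WellFoundedLT.induction with
  | ind t ih =>
    rw [h, interact_apply]
    congr 2
    funext s
    unfold before
    split_ifs with hs
    · exact ih s hs
    · rfl

theorem interact_const (answer : Fin N → X → Y) (x : Fin N → X) :
    interact blank (fun t _ => x t) answer = fun t => answer t (x t) :=
  (eq_interact blank _ fun _ => rfl).symm

/-- Fresh uniform randomness of every round absorbs a permutation that depends on the query of the
round. -/
theorem expect_interact_perm {𝒮 : Type} [Fintype 𝒮] (answer : Fin N → X → 𝒮 → Y)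
    (h : Fin N → X → Equiv.Perm 𝒮) (F : (Fin N → Y) → ℝ) :
    𝔼 S : Fin N → 𝒮, F (interact blank query fun t x => answer t x (h t x (S t))) =
      𝔼 S : Fin N → 𝒮, F (interact blank query fun t x => answer t x (S t)) := by
  set z : (Fin N → 𝒮) → Fin N → Y :=
    fun S => interact blank query fun t x => answer t x (h t x (S t)) with hz
  set e : (Fin N → 𝒮) → Fin N → 𝒮 := fun S t => h t (query t (before blank t (z S))) (S t) with he
  have key : ∀ S, z S = interact blank query fun t x => answer t x (e S t) :=
    fun S => eq_interact blank query fun t => interact_apply blank query _ t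
  -- The transcript `z S` can be recovered from `e S` by running the interaction without `h`. Equal
  -- images therefore have equal transcripts and equal queries, and each `h t x` is injective;
  -- finiteness gives bijectivity.
  have inj : Function.Injective e := by
    intro S S' hS
    have hzz : z S = z S' := by rw [key, key, hS]
    funext t
    have := congrFun hS t
    simp only [he, hzz] at this
    exact (h t _).injective this
  refine Fintype.expect_bijective e (Finite.injective_iff_bijective.1 inj) _ _ fun S => ?_
  exact congrArg F (key S)

end interact

end

/-! ### Boolean circuits: composition, bit strings, and group arithmetic. -/

section

/-! ### Composition of circuits -/

theorem Straight.input_mem {ι : Type} {s : ℕ} {S : Set ((ι → Bool) → Bool)} (h : Straight s S)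
    (i : ι) : (fun x => x i) ∈ S := by
  induction h with
  | start => exact Or.inl ⟨i, rfl⟩
  | gate _ _ _ ih => exact Or.inr ih

theorem Straight.const_mem {ι : Type} {s : ℕ} {S : Set ((ι → Bool) → Bool)} (h : Straight s S)
    (b : Bool) : (fun _ => b) ∈ S := by
  induction h with
  | start => exact Or.inr ⟨b, rfl⟩
  | gate _ _ _ ih => exact Or.inr ih

/-- The second program is rerun gate by gate on wires of the first one. Earlier wires stay
available, so shared intermediate results are paid for only once. -/
theorem Straight.append {ι κ : Type} {s t : ℕ} {S : Set ((ι → Bool) → Bool)}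
    {T : Set ((κ → Bool) → Bool)} (hS : Straight s S) (hT : Straight t T)
    (h : (ι → Bool) → κ → Bool) (hh : ∀ i, (fun x => h x i) ∈ S) :
    ∃ S', Straight (s + t) S' ∧ S ⊆ S' ∧ ∀ f ∈ T, (fun x => f (h x)) ∈ S' := by
  induction hT with
  | start =>
    refine ⟨S, hS, subset_rfl, ?_⟩
    rintro f (⟨i, rfl⟩ | ⟨b, rfl⟩)
    · exact hh i
    · exact hS.const_mem b
  | gate _ hf hg ih =>
    obtain ⟨S', h1, h2, h3⟩ := ih
    refine ⟨_, .gate h1 (h3 _ hf) (h3 _ hg), h2.trans (Set.subset_insert _ _), ?_⟩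
    rintro f (rfl | hf)
    · exact Or.inl rfl
    · exact Or.inr (h3 _ hf)

theorem HasCircuit.mono {ι κ : Type} {s t : ℕ} {f : (ι → Bool) → κ → Bool} (h : HasCircuit s f)
    (hst : s ≤ t) : HasCircuit t f := by
  obtain ⟨s', h1, h2⟩ := h
  exact ⟨s', h1.trans hst, h2⟩

/-- On the inputs `view p`, the function `F` is computed by a circuit with at most `s` gates. -/
def Computes {P ι κ : Type} (view : P → ι → Bool) (s : ℕ) (F : P → κ → Bool) : Prop :=
  ∃ f, HasCircuit s f ∧ ∀ p, f (view p) = F p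

namespace Computes

variable {P ι κ μ : Type} {view : P → ι → Bool} {s t : ℕ} {F : P → κ → Bool} {G : P → μ → Bool}

theorem mono (h : Computes view s F) (hst : s ≤ t) : Computes view t F := by
  obtain ⟨f, hf, h⟩ := h
  exact ⟨f, hf.mono hst, h⟩

theorem const (b : κ → Bool) : Computes view 0 fun _ => b :=
  ⟨fun _ => b, ⟨0, le_rfl, _, .start, fun o => Or.inr ⟨b o, rfl⟩⟩, fun _ => rfl⟩

theorem input (g : κ → ι) : Computes view 0 fun p o => view p (g o) :=
  ⟨fun x o => x (g o), ⟨0, le_rfl, _, .start, fun o => Or.inl ⟨g o, rfl⟩⟩, fun _ => rfl⟩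

theorem id : Computes view 0 view := input fun i => i

/-- Every output of `H` is an output of `F`, an output of `G`, or constant. -/
theorem merge {ξ : Type} {H : P → ξ → Bool} (hF : Computes view s F) (hG : Computes view t G)
    (h : ∀ o, (∃ o', ∀ p, H p o = F p o') ∨ (∃ o', ∀ p, H p o = G p o') ∨
      ∃ b, ∀ p, H p o = b) : Computes view (s + t) H := by
  classical
  obtain ⟨f, ⟨s', hs', S, hS, hfS⟩, hf⟩ := hF
  obtain ⟨g, ⟨t', ht', T, hT, hgT⟩, hg⟩ := hG
  obtain ⟨S', h1, h2, h3⟩ := hS.append hT (fun x => x) hS.input_mem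
  have : ∀ o, ∃ u ∈ S', ∀ p, u (view p) = H p o := by
    intro o
    rcases h o with ⟨o', ho⟩ | ⟨o', ho⟩ | ⟨b, ho⟩
    · exact ⟨_, h2 (hfS o'), fun p => by rw [ho, ← hf]⟩
    · exact ⟨_, h3 _ (hgT o'), fun p => by rw [ho, ← hg]⟩
    · exact ⟨_, h1.const_mem b, fun p => (ho p).symm⟩
  choose u hu hv using this
  exact ⟨fun x o => u o x, ⟨_, add_le_add hs' ht', S', h1, hu⟩, fun p => funext fun o => hv o p⟩

theorem sum (hF : Computes view s F) (hG : Computes view t G) :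
    Computes view (s + t) fun p => Sum.elim (F p) (G p) := by
  refine merge hF hG ?_
  rintro (o | o)
  · exact Or.inl ⟨o, fun _ => rfl⟩
  · exact Or.inr (Or.inl ⟨o, fun _ => rfl⟩)

theorem reindex (hF : Computes view s F) (g : μ → κ) : Computes view s fun p o => F p (g o) := by
  obtain ⟨f, ⟨s', hs', S, hS, hfS⟩, hf⟩ := hF
  exact ⟨fun x o => f x (g o), ⟨s', hs', S, hS, fun o => hfS (g o)⟩, fun p => by simp only [hf]⟩

/-- Composition. -/
theorem trans (hF : Computes view s F) (hG : Computes F t G) : Computes view (s + t) G := by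
  obtain ⟨f, ⟨s', hs', S, hS, hfS⟩, hf⟩ := hF
  obtain ⟨g, ⟨t', ht', T, hT, hgT⟩, hg⟩ := hG
  obtain ⟨S', h1, h2, h3⟩ := hS.append hT f hfS
  exact ⟨fun x => g (f x), ⟨_, add_le_add hs' ht', S', h1, fun o => h3 _ (hgT o)⟩,
    fun p => by simp only [hf, hg]⟩

theorem circuit (hF : Computes view s F) {g : (κ → Bool) → μ → Bool} (hg : HasCircuit t g) :
    Computes view (s + t) fun p => g (F p) :=
  hF.trans ⟨g, hg, fun _ => rfl⟩

theorem congr {F' : P → κ → Bool} (hF : Computes view s F) (h : ∀ p, F p = F' p) :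
    Computes view s F' := by
  rwa [← funext h]

/-- A finite family of functions. -/
theorem family {J : Type} [Fintype J] {H : P → J × κ → Bool} {c : ℕ}
    (h : ∀ j, Computes view c fun p o => H p (j, o)) : Computes view (Fintype.card J * c) H := by
  classical
  have aux : ∀ A : Finset J, Computes view (A.card * c)
      fun p (o : J × κ) => if o.1 ∈ A then H p o else false := by
    intro A
    induction A using Finset.induction_on with
    | empty => simpa using const fun _ => false
    | insert j A hj ih =>
      rw [Finset.card_insert_of_notMem hj, add_mul, one_mul]
      refine merge ih (h j) fun o => ?_
      by_cases h1 : o.1 = j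
      · refine Or.inr (Or.inl ⟨o.2, fun p => ?_⟩)
        rw [if_pos (by simp [h1]), ← h1]
      · refine Or.inl ⟨o, fun p => ?_⟩
        simp [Finset.mem_insert, h1]
  exact (aux Finset.univ).congr fun p => by simp

/-- A single NAND gate. -/
theorem nand {f g : P → Bool} (hf : Computes view s fun p (_ : Unit) => f p)
    (hg : Computes view t fun p (_ : Unit) => g p) :
    Computes view (s + t + 1) fun p (_ : Unit) => !(f p && g p) := by
  have h : HasCircuit 1 fun (x : Unit ⊕ Unit → Bool) (_ : Unit) =>
      !(x (Sum.inl ()) && x (Sum.inr ())) :=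
    ⟨1, le_rfl, _, .gate .start (Or.inl ⟨_, rfl⟩) (Or.inl ⟨_, rfl⟩), fun _ => Or.inl rfl⟩
  exact (hf.sum hg).circuit h

theorem not {f : P → Bool} (hf : Computes view s fun p (_ : Unit) => f p) :
    Computes view (s + 1) fun p (_ : Unit) => !(f p) :=
  (hf.nand (const fun _ => true)).congr fun p => by simp

theorem and {f g : P → Bool} (hf : Computes view s fun p (_ : Unit) => f p)
    (hg : Computes view t fun p (_ : Unit) => g p) :
    Computes view (s + t + 2) fun p (_ : Unit) => f p && g p :=
  (hf.nand hg).not.congr fun p => by simp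

theorem or {f g : P → Bool} (hf : Computes view s fun p (_ : Unit) => f p)
    (hg : Computes view t fun p (_ : Unit) => g p) :
    Computes view (s + t + 3) fun p (_ : Unit) => f p || g p :=
  ((hf.not.nand hg.not).mono (by omega)).congr fun p => by simp

/-- Selection between two bit strings. -/
theorem select [Fintype κ] {b : P → Bool} {u : ℕ} {F' : P → κ → Bool}
    (hb : Computes view u fun p (_ : Unit) => b p) (hF : Computes view s F)
    (hF' : Computes view t F') :
    Computes view (u + s + t + 8 * Fintype.card κ) fun p => if b p then F p else F' p := by
  refine (((hb.sum hF).sum hF').trans (t := Fintype.card κ * 8) ?_).mono (by omega)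
  suffices h : Computes (fun p => Sum.elim (Sum.elim (fun _ : Unit => b p) (F p)) (F' p))
      (Fintype.card κ * 8) fun p (o : κ × Unit) => if b p then F p o.1 else F' p o.1 from
    (h.reindex fun o => (o, ())).congr fun p => by funext o; split_ifs <;> rfl
  refine family fun o => ?_
  have hb' : Computes (fun p => Sum.elim (Sum.elim (fun _ : Unit => b p) (F p)) (F' p)) 0
      fun p (_ : Unit) => b p := input fun _ => Sum.inl (Sum.inl ())
  have h1 : Computes (fun p => Sum.elim (Sum.elim (fun _ : Unit => b p) (F p)) (F' p)) 0
      fun p (_ : Unit) => F p o := input fun _ => Sum.inl (Sum.inr o)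
  have h2 : Computes (fun p => Sum.elim (Sum.elim (fun _ : Unit => b p) (F p)) (F' p)) 0
      fun p (_ : Unit) => F' p o := input fun _ => Sum.inr o
  refine (((hb'.and h1).or (hb'.not.and h2)).mono (by omega)).congr fun p => ?_
  funext _
  cases b p <;> simp

/-- Comparison of two bit strings. -/
theorem ne {L : ℕ} {F F' : P → Fin L → Bool} (hF : Computes view s F) (hF' : Computes view t F') :
    Computes view (s + t + L * 20) fun p (_ : Unit) => decide (F p ≠ F' p) := by
  refine (hF.sum hF').trans ?_
  set v := fun p => Sum.elim (F p) (F' p)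
  have hx : ∀ l, Computes v 12 fun p (_ : Unit) => F p l != F' p l := by
    intro l
    have h1 : Computes v 0 fun p (_ : Unit) => F p l := input fun _ => Sum.inl l
    have h2 : Computes v 0 fun p (_ : Unit) => F' p l := input fun _ => Sum.inr l
    refine (((h1.and h2.not).or (h1.not.and h2)).mono (by omega)).congr fun p => ?_
    funext _
    cases F p l <;> cases F' p l <;> rfl
  have aux : ∀ l : List (Fin L), Computes v (l.length * 20)
      fun p (_ : Unit) => l.any fun i => F p i != F' p i := by
    intro l
    induction l with
    | nil => simpa using const fun _ => false
    | cons a l ih =>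
      refine (((hx a).or ih).mono (by simp; omega)).congr fun p => ?_
      simp
  have := aux (List.finRange L)
  rw [List.length_finRange] at this
  refine this.congr fun p => ?_
  funext _
  rw [Bool.eq_iff_iff]
  simp [Function.ne_iff]

end Computes

/-! ### Circuits for group operations -/

section Group

variable {P ι : Type} {L : ℕ} (H : P → Type) [∀ p, CommGroup (H p)]
  (enc : ∀ p, H p → Fin L → Bool) (pp : P → Fin L → Bool)

/-- The multiplication of encoded group elements, given the public parameters, has circuits of size
`M`. -/
def MulCircuit (M : ℕ) : Prop :=
  ∃ f : (Fin 3 × Fin L → Bool) → Fin L → Bool, HasCircuit M f ∧ ∀ p (x y : H p),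
    f (fun w => ![pp p, enc p x, enc p y] w.1 w.2) = enc p (x * y)

/-- The encoding of the group element `e p` is computed with `s` gates. -/
abbrev ComputesElt {ι : Type} (view : P → ι → Bool) (s : ℕ) (e : ∀ p, H p) : Prop :=
  Computes view s fun p => enc p (e p)

variable {H enc pp} {M : ℕ}

theorem MulCircuit.mul (hM : MulCircuit H enc pp M) {view : P → ι → Bool}
    (hpp : Computes view 0 pp) {s t : ℕ} {e e' : ∀ p, H p}
    (he : ComputesElt H enc view s e) (he' : ComputesElt H enc view t e') :
    ComputesElt H enc view (s + t + M) fun p => e p * e' p := by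
  obtain ⟨f, hf, h⟩ := hM
  have h3 : Computes view (s + t) fun p (w : Fin 3 × Fin L) =>
      ![pp p, enc p (e p), enc p (e' p)] w.1 w.2 := by
    rw [← zero_add (s + t)]
    refine Computes.merge hpp (he.sum he') ?_
    rintro ⟨i, l⟩
    fin_cases i
    · exact Or.inl ⟨l, fun _ => rfl⟩
    · exact Or.inr (Or.inl ⟨Sum.inl l, fun _ => rfl⟩)
    · exact Or.inr (Or.inl ⟨Sum.inr l, fun _ => rfl⟩)
  exact (h3.circuit hf).congr fun p => h p _ _

theorem MulCircuit.sq (hM : MulCircuit H enc pp M) {view : P → ι → Bool}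
    (hpp : Computes view 0 pp) {s : ℕ} {e : ∀ p, H p}
    (he : ComputesElt H enc view s e) : ComputesElt H enc view (s + M) fun p => e p * e p := by
  obtain ⟨f, hf, h⟩ := hM
  have h3 : Computes view s fun p (w : Fin 3 × Fin L) =>
      ![pp p, enc p (e p), enc p (e p)] w.1 w.2 := by
    rw [← zero_add s]
    refine Computes.merge hpp he ?_
    rintro ⟨i, l⟩
    fin_cases i
    · exact Or.inl ⟨l, fun _ => rfl⟩
    · exact Or.inr (Or.inl ⟨l, fun _ => rfl⟩)
    · exact Or.inr (Or.inl ⟨l, fun _ => rfl⟩)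
  exact (h3.circuit hf).congr fun p => h p _ _

/-- Square and multiply, with at most two multiplications per binary digit. The exponent must be
nonzero because no circuit for the neutral element is available yet. -/
theorem MulCircuit.pow (hM : MulCircuit H enc pp M) {view : P → ι → Bool}
    (hpp : Computes view 0 pp) {s : ℕ} {e : ∀ p, H p}
    (he : ComputesElt H enc view s e) {N : ℕ} (hN : N ≠ 0) {w : ℕ} (hw : N < 2 ^ w) :
    ComputesElt H enc view (s + 2 * M * w) fun p => e p ^ N := by
  suffices h : ∀ w N : ℕ, N ≠ 0 → N < 2 ^ w → ComputesElt H enc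
      (fun p => Sum.elim (pp p) (enc p (e p))) (2 * M * w) fun p => e p ^ N by
    have := (hpp.sum he).trans (h w N hN hw)
    rwa [zero_add] at this
  have hpp' : Computes (fun p => Sum.elim (pp p) (enc p (e p))) 0 pp := Computes.input Sum.inl
  have he' : ComputesElt H enc (fun p => Sum.elim (pp p) (enc p (e p))) 0 e :=
    Computes.input Sum.inr
  intro w
  induction w with
  | zero => intro N hN h; simp at h; exact absurd h hN
  | succ w ih =>
    intro N hN h
    rcases Nat.even_or_odd' N with ⟨K, rfl | rfl⟩
    · refine ((hM.sq hpp' (ih K (by omega) (by rw [pow_succ] at h; omega))).mono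
        (by rw [mul_add]; omega)).congr fun p => ?_
      simp only [two_mul, pow_add]
    · rcases Nat.eq_zero_or_pos K with rfl | hK
      · exact (he'.mono (Nat.zero_le _)).congr fun p => by simp
      · refine ((hM.mul hpp' (hM.sq hpp' (ih K (by omega) (by rw [pow_succ] at h; omega)))
          he').mono (by rw [mul_add]; omega)).congr fun p => ?_
        simp only [pow_succ, two_mul, pow_add]

theorem MulCircuit.prod (hM : MulCircuit H enc pp M) {view : P → ι → Bool}
    (hpp : Computes view 0 pp) {c c₁ : ℕ}
    (h1 : ComputesElt H enc view c₁ fun _ => 1) {J : Type} (A : Finset J) {e : J → ∀ p, H p}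
    (he : ∀ j ∈ A, ComputesElt H enc view c (e j)) :
    ComputesElt H enc view (c₁ + A.card * (c + M)) fun p => ∏ j ∈ A, e j p := by
  classical
  induction A using Finset.induction_on with
  | empty => simpa using h1
  | insert j A hj ih =>
    refine ((hM.mul hpp (he j (Finset.mem_insert_self _ _))
      (ih fun i hi => he i (Finset.mem_insert_of_mem hi))).mono ?_).congr fun p => ?_
    · rw [Finset.card_insert_of_notMem hj, add_mul, one_mul]; omega
    · simp only [Finset.prod_insert hj]

end Group

end

/-! ### Arithmetic in the exponent and its circuits. -/

section

/-! ### Exponents -/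

theorem ofBits_eq_sum {q : ℕ} (b : Fin q.size → Bool) :
    (ofBits b : ZMod q) = ∑ l, if b l then (2 : ZMod q) ^ l.val else 0 := by
  have h : ∀ (w : ℕ) (b : Fin w → Bool),
      ((Nat.ofBits b : ℕ) : ZMod q) = ∑ l, if b l then (2 : ZMod q) ^ l.val else 0 := by
    intro w
    induction w with
    | zero => intro b; simp
    | succ w ih =>
      intro b
      rw [Nat.ofBits_succ, Fin.sum_univ_succ, Nat.cast_add, Nat.cast_mul, ih, Finset.mul_sum,
        add_comm]
      congr 1
      · cases b 0 <;> simp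
      · refine Finset.sum_congr rfl fun l _ => ?_
        simp only [Function.comp_apply, Fin.val_succ, pow_succ]
        split_ifs
        · push_cast; ring
        · simp
  exact h _ b

theorem ofBits_bitsOf {q : ℕ} [NeZero q] (a : ZMod q) : ofBits (bitsOf a) = a := by
  unfold ofBits bitsOf
  rw [Nat.ofBits_testBit, Nat.mod_eq_of_lt ((ZMod.val_lt a).trans (Nat.lt_size_self q)),
    ZMod.natCast_zmod_val]

namespace BilinearGroup

variable {q L : ℕ} (G : BilinearGroup q L)

theorem gT_pow_mod (N : ℕ) : G.gT ^ (N % q) = G.gT ^ N := by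
  have := pow_mod_orderOf G.gT N
  rwa [G.orderT] at this

theorem in₁_natCast (N : ℕ) : G.in₁ (N : ZMod q) = G.g₁ ^ N := by
  unfold in₁
  rw [ZMod.val_natCast]
  conv_rhs => rw [← pow_mod_orderOf, G.order₁]

theorem in₂_natCast (N : ℕ) : G.in₂ (N : ZMod q) = G.g₂ ^ N := by
  unfold in₂
  rw [ZMod.val_natCast]
  conv_rhs => rw [← pow_mod_orderOf, G.order₂]

theorem pair_in (a b : ZMod q) : G.pair (G.in₁ a) (G.in₂ b) = G.gT ^ (a * b).val := by
  unfold in₁ in₂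
  rw [map_pow, map_pow, MonoidHom.pow_apply, G.pair_gen, ← pow_mul, ZMod.val_mul, gT_pow_mod]

/-- An injective encoding by `L` bits gives $q\le 2^L$. The additional bit makes the inequality
strict, so that exponents up to and including $q$ have at most $L+1$ digits. -/
theorem lt_two_pow (G : BilinearGroup q L) : q < 2 ^ (L + 1) := by
  have h1 : Nat.card G.G₁ = q := by
    rw [← orderOf_eq_card_of_forall_mem_zpowers G.gen₁]
    exact G.order₁
  have h2 := Nat.card_le_card_of_injective _ G.enc₁_inj
  have h3 : Nat.card (Fin L → Bool) = 2 ^ L := by simp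
  rw [h1, h3] at h2
  rw [pow_succ]
  have := Nat.two_pow_pos L
  omega

variable [NeZero q]

theorem in₁_add (a b : ZMod q) : G.in₁ (a + b) = G.in₁ a * G.in₁ b := by
  rw [← ZMod.natCast_zmod_val a, ← ZMod.natCast_zmod_val b, ← Nat.cast_add]
  simp only [in₁_natCast, pow_add]

theorem in₂_add (a b : ZMod q) : G.in₂ (a + b) = G.in₂ a * G.in₂ b := by
  rw [← ZMod.natCast_zmod_val a, ← ZMod.natCast_zmod_val b, ← Nat.cast_add]
  simp only [in₂_natCast, pow_add]

theorem in₁_eq_one_iff (a : ZMod q) : G.in₁ a = 1 ↔ a = 0 := by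
  unfold in₁
  rw [← orderOf_dvd_iff_pow_eq_one, G.order₁]
  constructor
  · intro h
    exact (ZMod.val_eq_zero a).1 (Nat.eq_zero_of_dvd_of_lt h (ZMod.val_lt a))
  · rintro rfl
    simp

theorem gT_pow_add (a b : ZMod q) : G.gT ^ (a + b).val = G.gT ^ a.val * G.gT ^ b.val := by
  rw [ZMod.val_add, ← pow_add, gT_pow_mod]

theorem prod_gT_pow {J : Type} (A : Finset J) (a : J → ZMod q) :
    ∏ j ∈ A, G.gT ^ (a j).val = G.gT ^ (∑ j ∈ A, a j).val := by
  classical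
  induction A using Finset.induction_on with
  | empty => simp
  | insert j A hj ih => rw [Finset.prod_insert hj, Finset.sum_insert hj, ih, gT_pow_add]

end BilinearGroup

/-! ### Affine functions and linear forms -/

section LinForm

variable {q : ℕ} {J : Type} [Fintype J]

/-- `f` is an affine function of the vector `x`. -/
def IsAffine (f : (J → ZMod q) → ZMod q) : Prop :=
  ∃ (c : ZMod q) (l : J → ZMod q), ∀ x, f x = c + ∑ j, l j * x j

theorem IsAffine.const (c : ZMod q) : IsAffine fun _ : J → ZMod q => c := ⟨c, 0, by simp⟩

theorem IsAffine.coord (j : J) : IsAffine fun x : J → ZMod q => x j := by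
  classical
  exact ⟨0, Pi.single j 1, fun x => by simp [Pi.single_apply]⟩

theorem IsAffine.add {f g : (J → ZMod q) → ZMod q} (hf : IsAffine f) (hg : IsAffine g) :
    IsAffine fun x => f x + g x := by
  obtain ⟨c, l, hf⟩ := hf
  obtain ⟨d, l', hg⟩ := hg
  refine ⟨c + d, l + l', fun x => ?_⟩
  simp only [hf, hg, Pi.add_apply, add_mul, Finset.sum_add_distrib]
  ring

theorem IsAffine.mul_const {f : (J → ZMod q) → ZMod q} (hf : IsAffine f) (a : ZMod q) :
    IsAffine fun x => f x * a := by
  obtain ⟨c, l, hf⟩ := hf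
  refine ⟨c * a, fun j => l j * a, fun x => ?_⟩
  simp only [hf, add_mul, Finset.sum_mul]
  congr 1
  exact Finset.sum_congr rfl fun j _ => by ring

variable {P I : Type} [Fintype I] {ν : P → I → ZMod q}

/-- `c` is a linear form in `ν` whose coefficients are affine functions of `x`. -/
def LinForm (ν : P → I → ZMod q) (c : P → (J → ZMod q) → ZMod q) : Prop :=
  ∃ f : I → (J → ZMod q) → ZMod q, (∀ h, IsAffine (f h)) ∧ ∀ p x, c p x = ∑ h, ν p h * f h x

theorem LinForm.zero : LinForm ν fun _ (_ : J → ZMod q) => 0 :=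
  ⟨fun _ _ => 0, fun _ => .const 0, fun p x => by simp⟩

theorem LinForm.coord (h : I) {f : (J → ZMod q) → ZMod q} (hf : IsAffine f) :
    LinForm ν fun p x => ν p h * f x := by
  classical
  refine ⟨fun i => if i = h then f else fun _ => 0, fun i => ?_, fun p x => ?_⟩
  · dsimp only
    split_ifs
    · exact hf
    · exact .const 0
  · rw [Finset.sum_eq_single h]
    · simp
    · intro i _ hi
      simp [hi]
    · simp

theorem LinForm.add {c c' : P → (J → ZMod q) → ZMod q} (hc : LinForm ν c) (hc' : LinForm ν c') :
    LinForm ν fun p x => c p x + c' p x := by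
  obtain ⟨f, hf, h⟩ := hc
  obtain ⟨g, hg, h'⟩ := hc'
  exact ⟨fun i x => f i x + g i x, fun i => (hf i).add (hg i), fun p x => by
    simp only [h, h', mul_add, Finset.sum_add_distrib]⟩

theorem LinForm.mul_const {c : P → (J → ZMod q) → ZMod q} (hc : LinForm ν c) (a : ZMod q) :
    LinForm ν fun p x => c p x * a := by
  obtain ⟨f, hf, h⟩ := hc
  exact ⟨fun i x => f i x * a, fun i => (hf i).mul_const a, fun p x => by
    simp only [h, Finset.sum_mul, mul_assoc]⟩

theorem LinForm.sum {K : Type} (A : Finset K) {c : K → P → (J → ZMod q) → ZMod q}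
    (hc : ∀ j ∈ A, LinForm ν (c j)) : LinForm ν fun p x => ∑ j ∈ A, c j p x := by
  classical
  induction A using Finset.induction_on with
  | empty => simpa using LinForm.zero
  | insert j A hj ih =>
    simp only [Finset.sum_insert hj]
    exact (hc j (Finset.mem_insert_self _ _)).add
      (ih fun i hi => hc i (Finset.mem_insert_of_mem hi))

theorem LinForm.vecMul {v : P → (J → ZMod q) → Fin 8 → ZMod q}
    (hv : ∀ s, LinForm ν fun p x => v p x s) (U : Matrix (Fin 8) (Fin 8) (ZMod q)) (s : Fin 8) :
    LinForm ν fun p x => (v p x ᵥ* U) s :=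
  LinForm.sum Finset.univ fun s' _ => (hv s').mul_const (U s' s)

theorem LinForm.mulVec {v : P → (J → ZMod q) → Fin 8 → ZMod q}
    (hv : ∀ s, LinForm ν fun p x => v p x s) (U : Matrix (Fin 8) (Fin 8) (ZMod q)) (s : Fin 8) :
    LinForm ν fun p x => (U *ᵥ v p x) s := by
  have h := LinForm.sum Finset.univ fun s' _ => (hv s').mul_const (U s s')
  simp only [mul_comm _ (U s _)] at h
  exact h

end LinForm

/-! ### Circuits for linear forms in the exponent -/

section ExpCircuit

/-- Gates for the neutral element. -/
def costOne (M L : ℕ) : ℕ := M + 2 * M * (L + 1)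

/-- Gates for a fixed power of an element with cost `s`. -/
def costPow (M L s : ℕ) : ℕ := s + 2 * M * (L + 1)

/-- Gates for a base raised to an affine function of `N` numbers given in binary. -/
def costAffine (M L N s : ℕ) : ℕ :=
  costPow M L s + (costOne M L + N * (L + 1) *
    (costPow M L s + costOne M L + 8 * L + M)) + M

/-- Gates for a linear form in `I` bases. -/
def costForm (M L N I s : ℕ) : ℕ := costOne M L + I * (costAffine M L N s + M)

variable {P ι : Type} {q L M : ℕ} [NeZero q] {H : P → Type} [∀ p, CommGroup (H p)]
  {enc : ∀ p, H p → Fin L → Bool} {pp : P → Fin L → Bool} {view : P → ι → Bool}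
  {φ : ∀ p, ZMod q → H p}

/-- Multiplication by a fixed scalar is a fixed power. For the scalar 0 the exponent is $q$ instead
of 0, which keeps it admissible for square and multiply. -/
theorem exists_pow_eq_mul (hφ0 : ∀ p, φ p 0 = 1) (hφ : ∀ p a b, φ p (a + b) = φ p a * φ p b)
    (e : ZMod q) : ∃ N, N ≠ 0 ∧ N ≤ q ∧ ∀ p a, φ p (a * e) = φ p a ^ N := by
  have h : ∀ (N : ℕ) p a, φ p (a * (N : ZMod q)) = φ p a ^ N := by
    intro N p a
    induction N with
    | zero => simp [hφ0]
    | succ N ih => rw [Nat.cast_succ, mul_add, mul_one, hφ, ih, pow_succ]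
  by_cases he : e = 0
  · refine ⟨q, NeZero.ne q, le_rfl, fun p a => ?_⟩
    rw [← h, ZMod.natCast_self, he]
  · refine ⟨e.val, fun h0 => he ((ZMod.val_eq_zero e).1 h0), (ZMod.val_lt e).le, fun p a => ?_⟩
    rw [← h, ZMod.natCast_zmod_val]

theorem computes_pow (hM : MulCircuit H enc pp M) (hpp : Computes view 0 pp)
    (hq : q < 2 ^ (L + 1)) (hφ0 : ∀ p, φ p 0 = 1) (hφ : ∀ p a b, φ p (a + b) = φ p a * φ p b)
    {s : ℕ} {a : P → ZMod q} (ha : ComputesElt H enc view s fun p => φ p (a p)) (e : ZMod q) :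
    ComputesElt H enc view (costPow M L s) fun p => φ p (a p * e) := by
  obtain ⟨N, h0, hN, h⟩ := exists_pow_eq_mul hφ0 hφ e
  exact (hM.pow hpp ha h0 (hN.trans_lt hq)).congr fun p => by simp only [h]

/-- Expanding the binary numbers turns each coefficient into a constant plus a sum of fixed
multiples of single bits. Every summand is then a fixed power of a given element, selected or
replaced by 1 according to its bit. No discrete logarithm of a base is needed. -/
theorem computes_linForm (hM : MulCircuit H enc pp M) (hpp : Computes view 0 pp)
    (hq : q < 2 ^ (L + 1)) (hφ0 : ∀ p, φ p 0 = 1) (hφ : ∀ p a b, φ p (a + b) = φ p a * φ p b)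
    (h1 : ComputesElt H enc view (costOne M L) fun _ => 1)
    {I J : Type} [Fintype I] [Fintype J] {ν : P → I → ZMod q} {s : ℕ}
    (hν : ∀ h, ComputesElt H enc view s fun p => φ p (ν p h))
    {c : P → (J → ZMod q) → ZMod q} (hc : LinForm ν c)
    {b : P → J × Fin q.size → Bool} (hb : Computes view 0 b) :
    ComputesElt H enc view (costForm M L (Fintype.card J) (Fintype.card I) s)
      fun p => φ p (c p fun j => ofBits fun l => b p (j, l)) := by
  obtain ⟨f, hf, hc⟩ := hc
  have hsum : ∀ {K : Type} (A : Finset K) p (a : K → ZMod q),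
      φ p (∑ j ∈ A, a j) = ∏ j ∈ A, φ p (a j) := by
    classical
    intro K A p a
    induction A using Finset.induction_on with
    | empty => simp [hφ0]
    | insert j A hj ih => rw [Finset.sum_insert hj, Finset.prod_insert hj, hφ, ih]
  have hsize : q.size ≤ L + 1 := Nat.size_le.2 hq
  have term : ∀ h, ComputesElt H enc view (costAffine M L (Fintype.card J) s)
      fun p => φ p (ν p h * f h fun j => ofBits fun l => b p (j, l)) := by
    intro h
    obtain ⟨c₀, l, hl⟩ := hf h
    have hbit : ∀ o : J × Fin q.size, ComputesElt H enc view
        (costPow M L s + costOne M L + 8 * L)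
        fun p => if b p o then φ p (ν p h * (l o.1 * 2 ^ o.2.val)) else 1 := by
      intro o
      have hbo : Computes view 0 fun p (_ : Unit) => b p o := hb.reindex fun _ => o
      refine ((hbo.select (computes_pow hM hpp hq hφ0 hφ (hν h) (l o.1 * 2 ^ o.2.val)) h1).mono
        (by simp)).congr fun p => ?_
      dsimp only
      split_ifs <;> rfl
    refine ((hM.mul hpp (computes_pow hM hpp hq hφ0 hφ (hν h) c₀)
      (hM.prod hpp h1 Finset.univ fun o _ => hbit o)).mono ?_).congr fun p => ?_
    · unfold costAffine
      rw [Finset.card_univ, Fintype.card_prod, Fintype.card_fin]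
      gcongr
    · dsimp only
      congr 1
      rw [hl, mul_add, hφ, Finset.mul_sum, hsum, Fintype.prod_prod_type]
      congr 1
      refine Finset.prod_congr rfl fun j _ => ?_
      rw [ofBits_eq_sum, Finset.mul_sum, Finset.mul_sum, hsum]
      refine Finset.prod_congr rfl fun i _ => ?_
      dsimp only
      split_ifs <;> simp [hφ0]
  refine ((hM.prod hpp h1 Finset.univ fun h _ => term h).mono ?_).congr fun p => ?_
  · unfold costForm
    rw [Finset.card_univ]
  · simp only [hc, hsum]

end ExpCircuit

end

/-! ### Circuits that run the adversary inside a simulated protocol. -/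

section

/-! ### The protocol with given exponents -/

section Run

variable {q L n m Q : ℕ}

/-- What the adversary sees when the tokens, the initial output and the answers have the given
exponents. -/
def runView {c : ℕ} (G : BilinearGroup q L) (r : Fin c → Bool) (pp : Fin L → Bool)
    (ρ : Fin n → ZMod q) (T : Fin n → Fin n → Fin 8 → ZMod q) (Θ : Fin n → ZMod q)
    (z : Fin Q → Fin m → Fin 8 → Fin L → Bool) : ExpWire c L n m Q → Bool :=
  expView G r pp ρ (fun i j s => G.in₂ (T i j s)) (fun j => G.gT ^ (Θ j).val) z

/-- The messages of query `t`. -/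
def runQuery (A : ExpAdversary q L n m Q) (G : BilinearGroup q L) (r : Fin A.coins → Bool)
    (pp : Fin L → Bool) (ρ : Fin n → ZMod q) (T : Fin n → Fin n → Fin 8 → ZMod q)
    (Θ : Fin n → ZMod q) (t : Fin Q) (z : Fin Q → Fin m → Fin 8 → Fin L → Bool) :
    Fin m → ZMod q :=
  fun i => ofBits fun l => A.query t (runView G r pp ρ T Θ z) (i, l)

/-- The output of the adversary when `ρ`, the tokens, the initial output and the ciphertexts of the
queries have the given exponents. -/
def run (A : ExpAdversary q L n m Q) (G : BilinearGroup q L) (r : Fin A.coins → Bool)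
    (pp : Fin L → Bool) (ρ : Fin n → ZMod q) (T : Fin n → Fin n → Fin 8 → ZMod q)
    (Θ : Fin n → ZMod q) (c : Fin Q → (Fin m → ZMod q) → Fin m → Fin 8 → ZMod q) : Bool :=
  A.guess (runView G r pp ρ T Θ (interact (fun _ _ _ => false) (runQuery A G r pp ρ T Θ)
    fun t x i s => G.enc₁ (G.in₁ (c t x i s))))

/-- Fresh randomness of every query absorbs a permutation that depends on the messages. -/
theorem expect_run_perm (A : ExpAdversary q L n m Q) (G : BilinearGroup q L)
    (r : Fin A.coins → Bool) (pp : Fin L → Bool) (ρ : Fin n → ZMod q)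
    (T : Fin n → Fin n → Fin 8 → ZMod q) (Θ : Fin n → ZMod q) {𝒮 : Type} [Fintype 𝒮]
    (c : Fin Q → (Fin m → ZMod q) → 𝒮 → Fin m → Fin 8 → ZMod q)
    (h : Fin Q → (Fin m → ZMod q) → Equiv.Perm 𝒮) :
    𝔼 S : Fin Q → 𝒮, ind (run A G r pp ρ T Θ fun t x => c t x (h t x (S t))) =
      𝔼 S : Fin Q → 𝒮, ind (run A G r pp ρ T Θ fun t x => c t x (S t)) :=
  expect_interact_perm _ _ (fun t x S i s => G.enc₁ (G.in₁ (c t x S i s))) h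
    fun z => ind (A.guess (runView G r pp ρ T Θ z))

end Run

/-! ### Simulating the protocol by circuits -/

/-- On the parameters `pp p`, the group `G p` has circuits of size `M`. -/
structure Efficient {P : Type} {q L : ℕ} (G : P → BilinearGroup q L) (pp : P → Fin L → Bool)
    (M : ℕ) : Prop where
  mul₁ : MulCircuit (fun p => (G p).G₁) (fun p => (G p).enc₁) pp M
  mul₂ : MulCircuit (fun p => (G p).G₂) (fun p => (G p).enc₂) pp M
  gen₁ : Computes pp M fun p => (G p).enc₁ (G p).g₁
  gen₂ : Computes pp M fun p => (G p).enc₂ (G p).g₂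
  pair : ∃ f : (Fin 3 × Fin L → Bool) → Fin L → Bool, HasCircuit M f ∧ ∀ p x y,
    f (fun w => ![pp p, (G p).enc₁ x, (G p).enc₂ y] w.1 w.2) = (G p).encT ((G p).pair x y)

/-- The circuits of the generator are correct only on its support; indexing inputs by a type `P`
lets a simulator confine itself to such parameters. -/
theorem GroupGenerator.exists_efficient (𝒢 : GroupGenerator) :
    ∃ M : Polynomial ℕ, ∀ (k : ℕ) (P : Type) (pp : P → Fin (𝒢.len k) → Bool),
      (∀ p, pp p ∈ (𝒢.gen k).support) →
        Efficient (fun p => 𝒢.group k (pp p)) pp (M.eval k) := by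
  obtain ⟨M, h⟩ := 𝒢.efficient
  refine ⟨M, fun k P pp hp => ?_⟩
  obtain ⟨⟨f₁, c₁, h₁⟩, ⟨f₂, c₂, h₂⟩, ⟨f₃, c₃, h₃⟩, ⟨f₄, c₄, h₄⟩, -, ⟨f₅, c₅, h₅⟩⟩ := h k
  exact ⟨⟨f₃, c₃, fun p => h₃ _ (hp p)⟩, ⟨f₄, c₄, fun p => h₄ _ (hp p)⟩,
    ⟨f₁, c₁, fun p => h₁ _ (hp p)⟩, ⟨f₂, c₂, fun p => h₂ _ (hp p)⟩,
    ⟨f₅, c₅, fun p => h₅ _ (hp p)⟩⟩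

section Simulate

variable {P ι : Type} {q L M n m Q : ℕ} [NeZero q] {G : P → BilinearGroup q L}
  {pp : P → Fin L → Bool} {view : P → ι → Bool}

namespace Efficient

/-- The neutral element is obtained as $g_1^q$. -/
theorem one₁ (hG : Efficient G pp M) (hpp : Computes view 0 pp) (hq : q < 2 ^ (L + 1)) :
    ComputesElt (fun p => (G p).G₁) (fun p => (G p).enc₁) view (costOne M L) fun _ => 1 :=
  ((hG.mul₁.pow hpp (hpp.trans hG.gen₁) (NeZero.ne q) hq).mono (by simp [costOne])).congr fun p =>
    congrArg (G p).enc₁ ((congrArg ((G p).g₁ ^ ·) (G p).order₁.symm).trans (pow_orderOf_eq_one _))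

theorem one₂ (hG : Efficient G pp M) (hpp : Computes view 0 pp) (hq : q < 2 ^ (L + 1)) :
    ComputesElt (fun p => (G p).G₂) (fun p => (G p).enc₂) view (costOne M L) fun _ => 1 :=
  ((hG.mul₂.pow hpp (hpp.trans hG.gen₂) (NeZero.ne q) hq).mono (by simp [costOne])).congr fun p =>
    congrArg (G p).enc₂ ((congrArg ((G p).g₂ ^ ·) (G p).order₂.symm).trans (pow_orderOf_eq_one _))

theorem const₁ (hG : Efficient G pp M) (hpp : Computes view 0 pp) (hq : q < 2 ^ (L + 1))
    (a : ZMod q) : ComputesElt (fun p => (G p).G₁) (fun p => (G p).enc₁) view (costPow M L M)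
      fun p => (G p).in₁ a := by
  have h : ComputesElt (fun p => (G p).G₁) (fun p => (G p).enc₁) view M fun p => (G p).in₁ 1 := by
    refine ((hpp.trans hG.gen₁).mono (by simp)).congr fun p => ?_
    have := (G p).in₁_natCast 1
    rw [Nat.cast_one, pow_one] at this
    exact congrArg (G p).enc₁ this.symm
  refine (computes_pow hG.mul₁ hpp hq (fun p => ((G p).in₁_eq_one_iff 0).2 rfl)
    (fun p => (G p).in₁_add) h a).congr fun p => ?_
  simp only [one_mul]

/-- The generator of `GT` raised to a fixed power. -/
theorem constT (hG : Efficient G pp M) (hpp : Computes view 0 pp) (hq : q < 2 ^ (L + 1))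
    (a : ZMod q) : Computes view (costPow M L M + M + M)
      fun p => (G p).encT ((G p).gT ^ a.val) := by
  -- By bilinearity $g_T^a=\mu(g_1^a,g_2)$, so arithmetic in the source group and one pairing
  -- suffice.
  obtain ⟨f, hf, h⟩ := hG.pair
  have h3 : Computes view (costPow M L M + M) fun p (w : Fin 3 × Fin L) =>
      ![pp p, (G p).enc₁ ((G p).in₁ a), (G p).enc₂ (G p).g₂] w.1 w.2 := by
    rw [← zero_add (_ + M)]
    have h2 := hpp.trans hG.gen₂
    rw [zero_add] at h2
    refine Computes.merge hpp ((hG.const₁ hpp hq a).sum h2) ?_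
    rintro ⟨i, l⟩
    fin_cases i
    · exact Or.inl ⟨l, fun _ => rfl⟩
    · exact Or.inr (Or.inl ⟨Sum.inl l, fun _ => rfl⟩)
    · exact Or.inr (Or.inl ⟨Sum.inr l, fun _ => rfl⟩)
  refine (h3.circuit hf).congr fun p => ?_
  rw [h]
  unfold BilinearGroup.in₁
  rw [map_pow, MonoidHom.pow_apply, (G p).pair_gen]

end Efficient

/-- Gates for one query: the messages and the ciphertexts. -/
def costStep (M L m I s₁ sA : ℕ) : ℕ := sA + m * 8 * costForm M L m I s₁

/-- Gates for a simulation of the protocol. -/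
def costRun (M L n m Q I s₁ s₂ sA : ℕ) : ℕ :=
  n * n * 8 * s₂ + n * s₂ + n * (costPow M L M + M + M) + Q * costStep M L m I s₁ sA + sA

variable {I : Type} [Fintype I] {ν : P → I → ZMod q} {A : ExpAdversary q L n m Q} {s₁ s₂ sA : ℕ}
  {ρ : P → Fin n → ZMod q} {T : P → Fin n → Fin n → Fin 8 → ZMod q}
  {c : P → Fin Q → (Fin m → ZMod q) → Fin m → Fin 8 → ZMod q}

/-- The simulator carries its own input along with the view of the adversary. The query circuit
yields the messages in binary, the linear forms turn them into ciphertexts, and only the wires of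
round `t` are overwritten. -/
theorem computes_step (hA : A.SizeLE sA) (hG : Efficient G pp M) (hpp : Computes view 0 pp)
    (hq : q < 2 ^ (L + 1)) (r : Fin A.coins → Bool) (Θ : Fin n → ZMod q)
    (hν : ∀ h, ComputesElt (fun p => (G p).G₁) (fun p => (G p).enc₁) view s₁
      fun p => (G p).in₁ (ν p h))
    (hc : ∀ t i s, LinForm ν fun p x => c p t x i s) (t : Fin Q)
    (Z : P → Fin Q → Fin m → Fin 8 → Fin L → Bool) :
    Computes (fun p => Sum.elim (view p) (runView (G p) r (pp p) (ρ p) (T p) Θ (Z p)))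
      (costStep M L m (Fintype.card I) s₁ sA) fun p => Sum.elim (view p)
        (runView (G p) r (pp p) (ρ p) (T p) Θ (Function.update (Z p) t fun i s =>
          (G p).enc₁ ((G p).in₁ (c p t (runQuery A (G p) r (pp p) (ρ p) (T p) Θ t (Z p)) i s)))) := by
  set X := fun p => Sum.elim (view p) (runView (G p) r (pp p) (ρ p) (T p) Θ (Z p)) with hX
  set b : P → Fin m × Fin q.size → Bool :=
    fun p => A.query t (runView (G p) r (pp p) (ρ p) (T p) Θ (Z p)) with hb
  have hbX : Computes X (0 + sA) b :=
    Computes.circuit (Computes.input (view := X) Sum.inr) (hA.2.2.1 t)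
  set Y := fun p => Sum.elim (X p) (b p)
  have hYv : Computes Y 0 view := Computes.input fun i => Sum.inl (Sum.inl i)
  have hYpp : Computes Y 0 pp := hYv.trans hpp
  have hform : ∀ o : Fin m × Fin 8, Computes Y (costForm M L m (Fintype.card I) s₁) fun p =>
      (G p).enc₁ ((G p).in₁ (c p t (runQuery A (G p) r (pp p) (ρ p) (T p) Θ t (Z p)) o.1 o.2)) := by
    intro o
    have := computes_linForm (φ := fun p => (G p).in₁) hG.mul₁ hYpp hq
      (fun p => ((G p).in₁_eq_one_iff 0).2 rfl) (fun p => (G p).in₁_add) (hG.one₁ hYpp hq)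
      (fun h => hYv.trans (hν h)) (hc t o.1 o.2) (b := b) (Computes.input Sum.inr)
    rw [Fintype.card_fin, zero_add] at this
    exact this
  have hall := (Computes.id.sum hbX).trans (Computes.family (view := Y)
    (H := fun p (o : (Fin m × Fin 8) × Fin L) => (G p).enc₁ ((G p).in₁
      (c p t (runQuery A (G p) r (pp p) (ρ p) (T p) Θ t (Z p)) o.1.1 o.1.2)) o.2) hform)
  refine (Computes.merge (Computes.id (view := X)) hall ?_).mono
    (by simp [costStep])
  rintro (i | w)
  · exact Or.inl ⟨Sum.inl i, fun _ => rfl⟩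
  · cases w with
    | coin l => exact Or.inl ⟨Sum.inr (.coin l), fun _ => rfl⟩
    | pp l => exact Or.inl ⟨Sum.inr (.pp l), fun _ => rfl⟩
    | rho j l => exact Or.inl ⟨Sum.inr (.rho j l), fun _ => rfl⟩
    | tk i j s l => exact Or.inl ⟨Sum.inr (.tk i j s l), fun _ => rfl⟩
    | init j l => exact Or.inl ⟨Sum.inr (.init j l), fun _ => rfl⟩
    | ct t' i s l =>
      by_cases h : t' = t
      · subst h
        refine Or.inr (Or.inl ⟨((i, s), l), fun p => ?_⟩)
        simp [runView, expView]
      · refine Or.inl ⟨Sum.inr (.ct t' i s l), fun p => ?_⟩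
        simp [hX, runView, expView, Function.update_of_ne h]

/-- The cost is additive over the rounds because each step starts from the wires left by the
previous one. Coins and initial output are hard-wired; only tokens, `ρ` and ciphertexts may depend
on the input of the simulator. -/
theorem computes_run (hA : A.SizeLE sA) (hG : Efficient G pp M) (hpp : Computes view 0 pp)
    (hq : q < 2 ^ (L + 1)) (r : Fin A.coins → Bool) (Θ : Fin n → ZMod q)
    (hρ : ∀ j, ComputesElt (fun p => (G p).G₂) (fun p => (G p).enc₂) view s₂
      fun p => (G p).in₂ (ρ p j))
    (hT : ∀ i j s, ComputesElt (fun p => (G p).G₂) (fun p => (G p).enc₂) view s₂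
      fun p => (G p).in₂ (T p i j s))
    (hν : ∀ h, ComputesElt (fun p => (G p).G₁) (fun p => (G p).enc₁) view s₁
      fun p => (G p).in₁ (ν p h))
    (hc : ∀ t i s, LinForm ν fun p x => c p t x i s) :
    Computes view (costRun M L n m Q (Fintype.card I) s₁ s₂ sA) fun p (_ : Unit) =>
      run A (G p) r (pp p) (ρ p) (T p) Θ (c p) := by
  have htk := Computes.family (view := view) (J := Fin n × Fin n × Fin 8)
    (H := fun p o => (G p).enc₂ ((G p).in₂ (T p o.1.1 o.1.2.1 o.1.2.2)) o.2)
    fun j => hT j.1 j.2.1 j.2.2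
  have hrho := Computes.family (view := view) (J := Fin n)
    (H := fun p o => (G p).enc₂ ((G p).in₂ (ρ p o.1)) o.2) fun j => hρ j
  have hinit := Computes.family (view := view) (J := Fin n)
    (H := fun p o => (G p).encT ((G p).gT ^ (Θ o.1).val) o.2) fun j => hG.constT hpp hq (Θ j)
  have base : Computes view (n * n * 8 * s₂ + n * s₂ + n * (costPow M L M + M + M)) fun p =>
      Sum.elim (view p) (runView (Q := Q) (m := m) (G p) r (pp p) (ρ p) (T p) Θ
        fun _ _ _ _ => false) := by
    refine (Computes.merge (Computes.id.sum hpp) ((htk.sum hrho).sum hinit) ?_).mono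
      (by simp [mul_assoc])
    rintro (i | w)
    · exact Or.inl ⟨Sum.inl i, fun _ => rfl⟩
    · cases w with
      | coin l => exact Or.inr (Or.inr ⟨r l, fun _ => rfl⟩)
      | pp l => exact Or.inl ⟨Sum.inr l, fun _ => rfl⟩
      | rho j l => exact Or.inr (Or.inl ⟨Sum.inl (Sum.inr (j, l)), fun _ => rfl⟩)
      | tk i j s l => exact Or.inr (Or.inl ⟨Sum.inl (Sum.inl ((i, j, s), l)), fun _ => rfl⟩)
      | init j l => exact Or.inr (Or.inl ⟨Sum.inr (j, l), fun _ => rfl⟩)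
      | ct t i s l => exact Or.inr (Or.inr ⟨false, fun _ => rfl⟩)
  -- The starting state and its cost are left arbitrary so that the induction can absorb the first
  -- round into them.
  have loop : ∀ (l : List (Fin Q)) (Z : P → Fin Q → Fin m → Fin 8 → Fin L → Bool) (s : ℕ),
      Computes view s (fun p => Sum.elim (view p) (runView (G p) r (pp p) (ρ p) (T p) Θ (Z p))) →
      Computes view (s + l.length * costStep M L m (Fintype.card I) s₁ sA) fun p =>
        Sum.elim (view p) (runView (G p) r (pp p) (ρ p) (T p) Θ (l.foldl (fun z t =>
          Function.update z t fun i s => (G p).enc₁ ((G p).in₁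
            (c p t (runQuery A (G p) r (pp p) (ρ p) (T p) Θ t z) i s))) (Z p))) := by
    intro l
    induction l with
    | nil => intro Z s h; simpa using h
    | cons t l ih =>
      intro Z s h
      refine (ih _ _ (h.trans (computes_step hA hG hpp hq r Θ hν hc t Z))).mono ?_
      rw [List.length_cons, add_mul, one_mul]
      omega
  have final := (loop (List.finRange Q) _ _ base).trans
    (Computes.circuit (Computes.input Sum.inr) hA.2.2.2)
  rw [List.length_finRange] at final
  exact (final.mono (by simp [costRun])).congr fun p => rfl

end Simulate

end

/-! ### Optimal circuits and the general XDLin reduction. -/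

section

/-! ### Best adversaries of bounded size -/

instance finite_side : Finite Side :=
  Finite.of_injective (β := Bool) (fun | .one => false | .two => true) (by
    rintro (_ | _) (_ | _) h <;> simp_all)

instance finite_xdlinWire (c L : ℕ) : Finite (XDLinWire c L) :=
  Finite.of_injective (β := (Fin c ⊕ Fin L) ⊕ (Side × Fin 4 × Fin L) ⊕ Fin L)
    (fun
      | .coin l => .inl (.inl l)
      | .pp l => .inl (.inr l)
      | .elt y i l => .inr (.inl (y, i, l))
      | .target l => .inr (.inr l)) (by
    rintro (_ | _ | _ | _) (_ | _ | _ | _) h <;> simp_all)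

instance finite_cprfWire (c n κ N w : ℕ) : Finite (CPRFWire c n κ N w) :=
  Finite.of_injective (β := Fin c ⊕ (Fin n × Fin n × Fin κ) ⊕ (Fin N × Fin n × Fin w))
    (fun
      | .coin l => .inl l
      | .key i j l => .inr (.inl (i, j, l))
      | .ans t i l => .inr (.inr (t, i, l))) (by
    rintro (_ | _ | _) (_ | _ | _) h <;> simp_all)

theorem hasCircuit_const {ι κ : Type} (s : ℕ) (b : Bool) :
    HasCircuit s fun (_ : ι → Bool) (_ : κ) => b :=
  ⟨0, Nat.zero_le _, _, .start, fun _ => Or.inr ⟨b, rfl⟩⟩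

/-- Among the deterministic XDLin adversaries of size `s` there is a best one. -/
theorem exists_best_xdlin (𝒢 : GroupGenerator) (k s : ℕ) :
    ∃ D : XDLinAdversary (𝒢.len k), D.SizeLE s ∧
      ∀ g : Side → (XDLinWire 0 (𝒢.len k) → Bool) → Bool,
        (∀ x, HasCircuit s fun w (_ : Unit) => g x w) → xdlinAdv 𝒢 k ⟨0, g⟩ ≤ xdlinAdv 𝒢 k D := by
  let C := {g : Side → (XDLinWire 0 (𝒢.len k) → Bool) → Bool //
    ∀ x, HasCircuit s fun w (_ : Unit) => g x w}
  have : Nonempty C := ⟨⟨fun _ _ => false, fun _ => hasCircuit_const s false⟩⟩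
  -- With finitely many input wires there are finitely many Boolean functions, so the maximum is
  -- attained.
  obtain ⟨g, hg⟩ := Finite.exists_max fun g : C => xdlinAdv 𝒢 k ⟨0, g.1⟩
  exact ⟨⟨0, g.1⟩, ⟨Nat.zero_le _, g.2⟩, fun g' h => hg ⟨g', h⟩⟩

/-! ### Simulations and the XDLin advantage -/

section XDLin

variable {q : ℕ} [Fact q.Prime]

theorem expect_ite_eq_const (t : ZMod q) (x y : ℝ) :
    𝔼 e : ZMod q, (if e = t then x else y) = y + (x - y) * (1 / q) := by
  have h : ∀ e : ZMod q, (if e = t then x else y) = y + if e = t then x - y else 0 := by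
    intro e; split_ifs <;> ring
  simp only [h]
  rw [Finset.expect_add_distrib, Fintype.expect_const, Fintype.expect_eq_sum_div_card,
    Finset.sum_ite_eq' Finset.univ t, if_pos (Finset.mem_univ _), ZMod.card]
  ring

theorem expect_ite_ne_zero (x : ℝ) :
    𝔼 e : ZMod q, (if e ≠ 0 then x else 0) = (1 - 1 / q) * x := by
  have h : ∀ e : ZMod q, (if e ≠ 0 then x else 0) = if e = 0 then 0 else x := by
    intro e; split_ifs <;> simp_all
  simp only [h]
  rw [expect_ite_eq_const]
  ring

/-- The average over the five exponents of an XDLin instance. -/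
def expectInstance (f : ZMod q → ZMod q → ZMod q → ZMod q → ZMod q → ℝ) : ℝ :=
  𝔼 a, 𝔼 b, 𝔼 c, 𝔼 d, 𝔼 e, f a b c d e

theorem expect_expectInstance {Ω : Type} [Fintype Ω]
    (f : Ω → ZMod q → ZMod q → ZMod q → ZMod q → ZMod q → ℝ) :
    𝔼 ω, expectInstance (f ω) = expectInstance fun a b c d e => 𝔼 ω, f ω a b c d e := by
  unfold expectInstance
  rw [Finset.expect_comm]; refine Finset.expect_congr rfl fun a _ => ?_
  rw [Finset.expect_comm]; refine Finset.expect_congr rfl fun b _ => ?_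
  rw [Finset.expect_comm]; refine Finset.expect_congr rfl fun c _ => ?_
  rw [Finset.expect_comm]; refine Finset.expect_congr rfl fun d _ => ?_
  rw [Finset.expect_comm]

theorem expectInstance_sub (f g : ZMod q → ZMod q → ZMod q → ZMod q → ZMod q → ℝ) :
    expectInstance (fun a b c d e => f a b c d e - g a b c d e) =
      expectInstance f - expectInstance g := by
  simp only [expectInstance, expect_sub]

theorem mul_expectInstance (y : ℝ) (f : ZMod q → ZMod q → ZMod q → ZMod q → ZMod q → ℝ) :
    y * expectInstance f = expectInstance fun a b c d e => y * f a b c d e := by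
  simp only [expectInstance, Finset.mul_expect]

end XDLin

variable {𝒢 : GroupGenerator} {k : ℕ}

/-- The parameters that a deterministic XDLin adversary depends on. -/
abbrev XDLinInput (𝒢 : GroupGenerator) (k : ℕ) : Type :=
  {pp // pp ∈ (𝒢.gen k).support} × (Fin 4 → ZMod (𝒢.q k)) × ZMod (𝒢.q k)

/-- What a deterministic XDLin adversary sees. -/
def xdlinInputView (x : Side) (p : XDLinInput 𝒢 k) : XDLinWire 0 (𝒢.len k) → Bool :=
  xdlinView (𝒢.group k p.1) p.1 (fun l => l.elim0) p.2.1 x p.2.2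

theorem prOne_xdlinExp (g : Side → (XDLinWire 0 (𝒢.len k) → Bool) → Bool) (x : Side) (β : Bool) :
    prOne (xdlinExp 𝒢 k ⟨0, g⟩ x β) = ∑ pp, (𝒢.gen k pp).toReal *
      expectInstance fun a b c d e => ind (g x (xdlinView (𝒢.group k pp) pp (fun l => l.elim0)
        ![a, b, a * c, b * d] x (if β then e else c + d))) := by
  unfold xdlinExp
  rw [prOne_bind]
  refine Finset.sum_congr rfl fun pp _ => ?_
  congr 1
  rw [prOne_uniform_bind]
  have hr : ∀ r : Fin 0 → Bool, r = fun l => l.elim0 := fun r => Subsingleton.elim _ _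
  simp only [prOne_uniform_bind, prOne_pure, expectInstance]
  refine (Finset.expect_congr rfl fun r _ => ?_).trans (Fintype.expect_const _)
  rw [hr r]

/-- Gates for testing that two exponents are nonzero. -/
def costGuard (M L : ℕ) : ℕ := 2 * (costOne M L + L * 20) + 4

/-- If a family of circuits `sim ω` turns an XDLin instance with challenge `c + d + δ` into a game
whose (weighted) success probability is `g₀` for `δ = 0` and `g₁` for `δ ≠ 0`, then `g₀` and `g₁`
are as close as the XDLin advantage permits. -/
theorem xdlin_bound {s M : ℕ} {ε : ℝ}
    (hM : ∀ (P : Type) (pp : P → Fin (𝒢.len k) → Bool), (∀ p, pp p ∈ (𝒢.gen k).support) →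
      Efficient (fun p => 𝒢.group k (pp p)) pp M)
    (hε : ∀ g : Side → (XDLinWire 0 (𝒢.len k) → Bool) → Bool,
      (∀ x, HasCircuit (s + costGuard M (𝒢.len k)) fun w (_ : Unit) => g x w) →
        xdlinAdv 𝒢 k ⟨0, g⟩ ≤ ε)
    (x : Side) {Ω : Type} [Fintype Ω] [Nonempty Ω] {wgt : Ω → ℝ} (h0 : ∀ ω, 0 ≤ wgt ω)
    (h1 : ∀ ω, wgt ω ≤ 1)
    (sim : Ω → (Fin (𝒢.len k) → Bool) → (Fin 4 → ZMod (𝒢.q k)) → ZMod (𝒢.q k) → Bool)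
    (hsim : ∀ ω, Computes (xdlinInputView x) s fun (p : XDLinInput 𝒢 k) (_ : Unit) =>
      sim ω p.1 p.2.1 p.2.2)
    {g₀ g₁ : (Fin (𝒢.len k) → Bool) → ℝ}
    (hg : ∀ pp ∈ (𝒢.gen k).support, ∀ a b c d δ : ZMod (𝒢.q k), a ≠ 0 → b ≠ 0 →
      𝔼 ω, wgt ω * ind (sim ω pp ![a, b, a * c, b * d] (c + d + δ)) =
        if δ = 0 then g₀ pp else g₁ pp) :
    |∑ pp, (𝒢.gen k pp).toReal * (g₀ pp - g₁ pp)| * (1 - 1 / (𝒢.q k : ℝ)) ^ 3 ≤ ε := by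
  classical
  have hpp : Computes (xdlinInputView (𝒢 := 𝒢) (k := k) x) 0 fun p => p.1.1 :=
    Computes.input (view := xdlinInputView x) fun l => XDLinWire.pp l
  have hG := hM (XDLinInput 𝒢 k) (fun p => p.1.1) fun p => p.1.2
  have hq := BilinearGroup.lt_two_pow (𝒢.group k (𝒢.gen k).support_nonempty.some)
  have nonzero : ∀ i : Fin 4, Computes (xdlinInputView (𝒢 := 𝒢) (k := k) x)
      (costOne M (𝒢.len k) + 𝒢.len k * 20) fun p (_ : Unit) => decide (p.2.1 i ≠ 0) := by
    intro i
    have h : Computes (xdlinInputView (𝒢 := 𝒢) (k := k) x) 0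
        fun p => (𝒢.group k p.1).enc₁ ((𝒢.group k p.1).in₁ (p.2.1 i)) :=
      Computes.input (view := xdlinInputView x) fun l => XDLinWire.elt .one i l
    refine ((h.ne (hG.one₁ hpp hq)).mono (by simp)).congr fun p => ?_
    funext _
    rw [decide_eq_decide, not_iff_not, (𝒢.group k p.1).enc₁_inj.eq_iff]
    exact (𝒢.group k p.1).in₁_eq_one_iff _
  -- The games are controlled only for $a,b\neq0$, since these scalars serve in changes of basis.
  -- The circuit tests this and outputs 0 otherwise.
  have guarded : ∀ ω, Computes (xdlinInputView x) (s + costGuard M (𝒢.len k))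
      fun (p : XDLinInput 𝒢 k) (_ : Unit) =>
        (decide (p.2.1 0 ≠ 0) && decide (p.2.1 1 ≠ 0)) && sim ω p.1 p.2.1 p.2.2 := fun ω =>
    (((nonzero 0).and (nonzero 1)).and (hsim ω)).mono (by unfold costGuard; omega)
  choose f hf hfs using guarded
  set Φ : Ω → (Fin (𝒢.len k) → Bool) → ZMod (𝒢.q k) → ZMod (𝒢.q k) → ZMod (𝒢.q k) →
      ZMod (𝒢.q k) → ZMod (𝒢.q k) → ℝ := fun ω pp a b c d z =>
    ind ((decide (a ≠ 0) && decide (b ≠ 0)) && sim ω pp ![a, b, a * c, b * d] z) with hΦ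
  have single : ∀ ω, |∑ pp, (𝒢.gen k pp).toReal * expectInstance fun a b c d e =>
      Φ ω pp a b c d (c + d) - Φ ω pp a b c d e| ≤ ε := by
    intro ω
    -- The advantage is a maximum over both source groups, so the adversary may give up in the one
    -- for which the simulator is not meant.
    let g : Side → (XDLinWire 0 (𝒢.len k) → Bool) → Bool :=
      fun y w => if y = x then f ω w () else false
    have hgc : ∀ y, HasCircuit (s + costGuard M (𝒢.len k)) fun w (_ : Unit) => g y w := by
      intro y
      by_cases hy : y = x
      · simpa [g, hy] using hf ω
      · simpa [g, hy] using hasCircuit_const _ false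
    have hadv : |prOne (xdlinExp 𝒢 k ⟨0, g⟩ x false) - prOne (xdlinExp 𝒢 k ⟨0, g⟩ x true)| ≤
        xdlinAdv 𝒢 k ⟨0, g⟩ := by
      cases x
      · exact le_max_left _ _
      · exact le_max_right _ _
    refine le_trans (le_of_eq ?_) (hadv.trans (hε g hgc))
    rw [prOne_xdlinExp, prOne_xdlinExp, ← Finset.sum_sub_distrib]
    congr 1
    refine Finset.sum_congr rfl fun pp _ => ?_
    rw [expectInstance_sub, mul_sub]
    by_cases hs : pp ∈ (𝒢.gen k).support
    · have : ∀ a b c d z, ind (g x (xdlinView (𝒢.group k pp) pp (fun l => l.elim0)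
          ![a, b, a * c, b * d] x z)) = Φ ω pp a b c d z := by
        intro a b c d z
        have h := congrFun (hfs ω (⟨pp, hs⟩, ![a, b, a * c, b * d], z)) ()
        simp only [g, if_true, hΦ]
        exact congrArg ind h
      simp only [this, if_true, Bool.false_eq_true, if_false]
    · have : 𝒢.gen k pp = 0 := by simpa [PMF.mem_support_iff] using hs
      simp [this]
  have avg : |𝔼 ω, wgt ω * ∑ pp, (𝒢.gen k pp).toReal * expectInstance fun a b c d e =>
      Φ ω pp a b c d (c + d) - Φ ω pp a b c d e| ≤ ε := by
    refine abs_expect_le fun ω => ?_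
    rw [abs_mul, abs_of_nonneg (h0 ω)]
    exact (mul_le_of_le_one_left (abs_nonneg _) (h1 ω)).trans (single ω)
  have hΨ : ∀ pp ∈ (𝒢.gen k).support, ∀ a b c d z, 𝔼 ω, wgt ω * Φ ω pp a b c d z =
      if a ≠ 0 then (if b ≠ 0 then (if z = c + d then g₀ pp else g₁ pp) else 0) else 0 := by
    intro pp hs a b c d z
    by_cases ha : a = 0
    · simp [hΦ, ha, ind]
    by_cases hb : b = 0
    · simp [hΦ, hb, ind]
    have := hg pp hs a b c d (z - (c + d)) ha hb
    rw [add_sub_cancel] at this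
    simpa [hΦ, ha, hb, sub_eq_zero] using this
  -- The three factors $1-1/q$ come from $a\neq0$, from $b\neq0$, and from $e\neq c+d$: a uniform
  -- challenge hits $c+d$ with probability $1/q$, and then the simulator plays the first game after
  -- all.
  have main : 𝔼 ω, wgt ω * ∑ pp, (𝒢.gen k pp).toReal * expectInstance (fun a b c d e =>
      Φ ω pp a b c d (c + d) - Φ ω pp a b c d e) =
      (∑ pp, (𝒢.gen k pp).toReal * (g₀ pp - g₁ pp)) * (1 - 1 / (𝒢.q k : ℝ)) ^ 3 := by
    simp only [Finset.mul_sum]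
    rw [Finset.expect_sum_comm, Finset.sum_mul]
    refine Finset.sum_congr rfl fun pp _ => ?_
    by_cases hs : pp ∈ (𝒢.gen k).support
    · simp only [mul_left_comm (wgt _)]
      rw [← Finset.mul_expect, mul_assoc]
      congr 1
      simp only [mul_expectInstance]
      rw [expect_expectInstance]
      simp only [mul_sub, expect_sub]
      rw [expectInstance_sub]
      have pull : ∀ (a : ZMod (𝒢.q k)) (f : ZMod (𝒢.q k) → ℝ),
          𝔼 b, (if a ≠ 0 then f b else 0) = if a ≠ 0 then 𝔼 b, f b else 0 := by
        intro a f
        split_ifs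
        · rfl
        · exact Fintype.expect_const _
      simp only [hΨ pp hs, expectInstance, if_true, pull, expect_ite_eq_const,
        Fintype.expect_const, expect_ite_ne_zero]
      ring
    · have : 𝒢.gen k pp = 0 := by simpa [PMF.mem_support_iff] using hs
      simp [this]
  rw [main, abs_mul] at avg
  refine le_trans (le_of_eq ?_) avg
  congr 1
  rw [abs_of_nonneg]
  have : (1 : ℝ) ≤ 𝒢.q k := by exact_mod_cast (𝒢.prime k).one_lt.le
  have : 1 / (𝒢.q k : ℝ) ≤ 1 := by rw [div_le_one (by linarith)]; exact this
  exact pow_nonneg (by linarith) 3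

end

/-! ### Dual changes of basis and the games they act on. -/

section

/-! ### Elementary changes of basis -/

section Basis

variable {q : ℕ}

/-- The change of basis that adds `c` times slot `i` of a token to slot `j`. -/
def addSlot (i j : Fin 8) (h : i ≠ j) (c : ZMod q) : GL (Fin 8) (ZMod q) where
  val := Matrix.transvection i j c
  inv := Matrix.transvection i j (-c)
  val_inv := by rw [Matrix.transvection_mul_transvection_same i j h]; simp
  inv_val := by rw [Matrix.transvection_mul_transvection_same i j h]; simp

/-- The change of basis that multiplies slot `i` of a token by `u`. -/
def scaleSlot (i : Fin 8) (u : (ZMod q)ˣ) : GL (Fin 8) (ZMod q) where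
  val := Matrix.diagonal fun s => if s = i then (u : ZMod q) else 1
  inv := Matrix.diagonal fun s => if s = i then ((u⁻¹ : (ZMod q)ˣ) : ZMod q) else 1
  val_inv := by
    rw [Matrix.diagonal_mul_diagonal, ← Matrix.diagonal_one]
    congr 1
    funext s
    split_ifs <;> simp
  inv_val := by
    rw [Matrix.diagonal_mul_diagonal, ← Matrix.diagonal_one]
    congr 1
    funext s
    split_ifs <;> simp

theorem vecMul_addSlot (w : Fin 8 → ZMod q) (i j : Fin 8) (h : i ≠ j) (c : ZMod q) :
    w ᵥ* (addSlot i j h c : Matrix (Fin 8) (Fin 8) (ZMod q)) =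
      fun s => if s = j then w s + w i * c else w s := by
  change w ᵥ* (1 + Matrix.single i j c) = _
  rw [Matrix.vecMul_add, Matrix.vecMul_one]
  funext s
  simp only [Pi.add_apply, Matrix.vecMul, dotProduct, Matrix.single_apply]
  split_ifs with hs
  · simp [hs]
  · simp [Ne.symm hs]

theorem addSlot_mulVec (v : Fin 8 → ZMod q) (i j : Fin 8) (h : i ≠ j) (c : ZMod q) :
    (addSlot i j h c : Matrix (Fin 8) (Fin 8) (ZMod q)) *ᵥ v =
      fun s => if s = i then v s + c * v j else v s := by
  change (1 + Matrix.single i j c) *ᵥ v = _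
  rw [Matrix.add_mulVec, Matrix.one_mulVec]
  funext s
  simp only [Pi.add_apply, Matrix.mulVec, dotProduct, Matrix.single_apply]
  split_ifs with hs
  · simp [hs]
  · simp [Ne.symm hs]

theorem vecMul_scaleSlot (w : Fin 8 → ZMod q) (i : Fin 8) (u : (ZMod q)ˣ) :
    w ᵥ* (scaleSlot i u : Matrix (Fin 8) (Fin 8) (ZMod q)) =
      fun s => if s = i then w s * u else w s := by
  funext s
  change (w ᵥ* Matrix.diagonal _) s = _
  rw [Matrix.vecMul_diagonal]
  split_ifs <;> simp

theorem scaleSlot_mulVec (v : Fin 8 → ZMod q) (i : Fin 8) (u : (ZMod q)ˣ) :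
    (scaleSlot i u : Matrix (Fin 8) (Fin 8) (ZMod q)) *ᵥ v =
      fun s => if s = i then u * v s else v s := by
  funext s
  change (Matrix.diagonal _ *ᵥ v) s = _
  rw [Matrix.mulVec_diagonal]
  split_ifs <;> simp

end Basis

/-! ### Games -/

/-- The vectors whose entries sum to zero. -/
def ZeroSum (q n : ℕ) : AddSubgroup (Fin n → ZMod q) where
  carrier := {v | ∑ i, v i = 0}
  zero_mem' := by simp
  add_mem' := by
    intro a b ha hb
    simp only [Set.mem_ofPred_eq] at *
    simp [Finset.sum_add_distrib, ha, hb]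
  neg_mem' := by
    intro a ha
    simp only [Set.mem_ofPred_eq] at *
    simp [ha]

instance (q n : ℕ) [Fact q.Prime] : Fintype (ZeroSum q n) := Fintype.ofFinite _

/-- Shortens the instance search. -/
instance fintype_vector (q n : ℕ) [Fact q.Prime] : Fintype (Fin n → ZMod q) := inferInstance

/-- Shortens the instance search. -/
instance fintype_bases (q n : ℕ) [Fact q.Prime] : Fintype (Fin n → GL (Fin 8) (ZMod q)) :=
  inferInstance

/-- The randomness of one query: two vectors of masks and the noise of the ciphertexts. -/
abbrev Coins (q n m : ℕ) : Type :=
  ZeroSum q n × ZeroSum q n × (Fin m → ZMod q) × (Fin m → ZMod q)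

/-- A single sample space for the noise of the tokens, the randomness of the queries, and the
bases. -/
def Noise (q n m Q : ℕ) : Type :=
  (Fin n → Fin n → ZMod q) × (Fin n → Fin n → ZMod q) × (Fin Q → Coins q n m) ×
    (Fin n → GL (Fin 8) (ZMod q))

instance (q n m Q : ℕ) [Fact q.Prime] : Fintype (Noise q n m Q) :=
  inferInstanceAs (Fintype (_ × _ × _ × _))

instance (q n m Q : ℕ) : Nonempty (Noise q n m Q) := ⟨⟨0, 0, fun _ => 0, fun _ => 1⟩⟩

section Games

variable {q L n m Q : ℕ} [Fact q.Prime] (hmn : m ≤ n) (A : ExpAdversary q L n m Q)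
  (G : BilinearGroup q L) (r : Fin A.coins → Bool) (pp : Fin L → Bool) (ρ Θ : Fin n → ZMod q)

/-- The success of the adversary when tokens and ciphertexts have the slots `W` and `V` with respect
to the bases `R`. -/
def play (R : Fin n → GL (Fin 8) (ZMod q)) (W : Fin n → Fin n → Fin 8 → ZMod q)
    (V : Fin Q → (Fin m → ZMod q) → Fin m → Fin 8 → ZMod q) : ℝ :=
  ind (run A G r pp ρ (fun i j => W i j ᵥ* (R i : Matrix (Fin 8) (Fin 8) (ZMod q))) Θ
    fun t x i => (((R (Fin.castLE hmn i))⁻¹ : GL (Fin 8) (ZMod q)) :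
      Matrix (Fin 8) (Fin 8) (ZMod q)) *ᵥ V t x i)

/-- Left multiplication $R\mapsto NR$ preserves the uniform distribution on the bases. It multiplies
token rows by $N$ from the right and ciphertext columns by $N^{-1}$ from the left. Only honest
ciphertexts are visible, so the condition on them concerns honest indices alone. -/
theorem expect_play_basis {W W' : Fin n → Fin n → Fin 8 → ZMod q}
    {V V' : Fin Q → (Fin m → ZMod q) → Fin m → Fin 8 → ZMod q}
    (N : Fin n → GL (Fin 8) (ZMod q))
    (hW : ∀ i j, W' i j ᵥ* (N i : Matrix (Fin 8) (Fin 8) (ZMod q)) = W i j)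
    (hV : ∀ t x i, V' t x i =
      (N (Fin.castLE hmn i) : Matrix (Fin 8) (Fin 8) (ZMod q)) *ᵥ V t x i) :
    𝔼 R, play hmn A G r pp ρ Θ R W V = 𝔼 R, play hmn A G r pp ρ Θ R W' V' := by
  refine Fintype.expect_equiv (Equiv.mulLeft N) _ _ fun R => ?_
  unfold play
  congr 2
  · funext i j
    rw [← hW, Matrix.vecMul_vecMul]
    rfl
  · funext t x i
    rw [hV, Matrix.mulVec_mulVec]
    congr 1
    rw [← Units.val_mul]
    simp

/-- With the bases held fixed, the randomness of different queries is independent and each share is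
used in one answer only, so `expect_run_perm` applies. -/
theorem expect_play_perm (W : Fin n → Fin n → Fin 8 → ZMod q) {𝒮 : Type} [Fintype 𝒮]
    (V : (Fin m → ZMod q) → 𝒮 → Fin m → Fin 8 → ZMod q)
    (h : (Fin m → ZMod q) → Equiv.Perm 𝒮) :
    𝔼 S : Fin Q → 𝒮, 𝔼 R, play hmn A G r pp ρ Θ R W (fun t x => V x (h x (S t))) =
      𝔼 S : Fin Q → 𝒮, 𝔼 R, play hmn A G r pp ρ Θ R W fun t x => V x (S t) := by
  rw [Finset.expect_comm]
  conv_rhs => rw [Finset.expect_comm]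
  refine Finset.expect_congr rfl fun R _ => ?_
  exact expect_run_perm A G r pp ρ _ Θ (fun _ x s i => (((R (Fin.castLE hmn i))⁻¹ :
    GL (Fin 8) (ZMod q)) : Matrix (Fin 8) (Fin 8) (ZMod q)) *ᵥ V x s i) fun _ => h

/-- The average success over the noise of the tokens, the randomness of the queries, and the
bases. -/
def game (W : (Fin n → Fin n → ZMod q) → (Fin n → Fin n → ZMod q) →
      Fin n → Fin n → Fin 8 → ZMod q)
    (V : (Fin m → ZMod q) → Coins q n m → Fin m → Fin 8 → ZMod q) : ℝ :=
  𝔼 β, 𝔼 γ, 𝔼 S : Fin Q → Coins q n m, 𝔼 R,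
    play hmn A G r pp ρ Θ R (W β γ) fun t x => V x (S t)

variable {W W' : (Fin n → Fin n → ZMod q) → (Fin n → Fin n → ZMod q) →
    Fin n → Fin n → Fin 8 → ZMod q}
  {V V' : (Fin m → ZMod q) → Coins q n m → Fin m → Fin 8 → ZMod q}

theorem game_basis (N : Fin n → GL (Fin 8) (ZMod q))
    (hW : ∀ β γ i j, W' β γ i j ᵥ* (N i : Matrix (Fin 8) (Fin 8) (ZMod q)) = W β γ i j)
    (hV : ∀ x S i, V' x S i =
      (N (Fin.castLE hmn i) : Matrix (Fin 8) (Fin 8) (ZMod q)) *ᵥ V x S i) :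
    game hmn A G r pp ρ Θ W V = game hmn A G r pp ρ Θ W' V' := by
  unfold game
  refine Finset.expect_congr rfl fun β _ => Finset.expect_congr rfl fun γ _ =>
    Finset.expect_congr rfl fun S _ => ?_
  exact expect_play_basis hmn A G r pp ρ Θ N (hW β γ) fun t x i => hV x (S t) i

theorem game_perm (h : (Fin m → ZMod q) → Equiv.Perm (Coins q n m)) :
    game hmn A G r pp ρ Θ W (fun x S => V x (h x S)) = game hmn A G r pp ρ Θ W V := by
  unfold game
  refine Finset.expect_congr rfl fun β _ => Finset.expect_congr rfl fun γ _ => ?_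
  exact expect_play_perm hmn A G r pp ρ Θ (W β γ) V h

/-- The noise of the tokens is drawn once for the whole game, so here the permutations must not
depend on the messages. -/
theorem game_noise (e e' : Equiv.Perm (Fin n → Fin n → ZMod q)) :
    game hmn A G r pp ρ Θ (fun β γ => W (e β) (e' γ)) V = game hmn A G r pp ρ Θ W V := by
  unfold game
  refine (Finset.expect_congr rfl fun β _ => ?_).trans (expect_perm e _)
  exact expect_perm e' fun γ => 𝔼 S : Fin Q → Coins q n m, 𝔼 R,
    play hmn A G r pp ρ Θ R (W (e β) γ) fun t x => V x (S t)

theorem game_nonneg : 0 ≤ game hmn A G r pp ρ Θ W V :=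
  expect_nonneg fun _ => expect_nonneg fun _ => expect_nonneg fun _ => expect_nonneg fun _ =>
    ind_nonneg _

theorem game_le_one : game hmn A G r pp ρ Θ W V ≤ 1 :=
  expect_le_const fun _ => expect_le_const fun _ => expect_le_const fun _ =>
    expect_le_const fun _ => ind_le_one _

/-- The game as an average over a single sample space. -/
theorem expect_eq_game :
    𝔼 ω : Noise q n m Q,
      play hmn A G r pp ρ Θ ω.2.2.2 (W ω.1 ω.2.1) (fun t x => V x (ω.2.2.1 t)) =
    game hmn A G r pp ρ Θ W V := by
  refine (expect_prod _).trans (Finset.expect_congr rfl fun β _ => ?_)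
  refine (expect_prod _).trans (Finset.expect_congr rfl fun γ _ => ?_)
  exact expect_prod _

end Games

/-- Slots of a token. -/
def tokenSlots {q n : ℕ} (u₀ u₅ u₆ u₇ β γ : Fin n → Fin n → ZMod q) (i j : Fin n) :
    Fin 8 → ZMod q :=
  ![u₀ i j, 0, 0, β i j, γ i j, u₅ i j, u₆ i j, u₇ i j]

/-- Slots of the ciphertexts of a query with messages `x`. -/
def ctSlots {q n m : ℕ} (hmn : m ≤ n)
    (v₅ : (Fin m → ZMod q) → ZeroSum q n → ZeroSum q n → Fin m → ZMod q)
    (v₆ v₇ : (Fin m → ZMod q) → Fin m → ZMod q) (x : Fin m → ZMod q) (S : Coins q n m)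
    (i : Fin m) : Fin 8 → ZMod q :=
  ![S.1.1 (Fin.castLE hmn i), S.2.2.1 i, S.2.2.2 i, 0, 0, v₅ x S.1 S.2.1 i, v₆ x i, v₇ x i]

end

/-! ### Simulators built from XDLin instances, and the ciphertext hop. -/

section

variable {𝒢 : GroupGenerator} {k n m Q : ℕ}

/-! ### Simulation from an XDLin instance -/

/-- The exponents `0`/challenge, `1`, `a`, `b`, `ac`, `bd` that are available in the source group
`y` when the challenge lies in the source group `x`. -/
def bases (x y : Side) (p : XDLinInput 𝒢 k) : Option (Option (Fin 4)) → ZMod (𝒢.q k)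
  | none => match x, y with
    | .one, .one => p.2.2
    | .two, .two => p.2.2
    | _, _ => 0
  | some none => 1
  | some (some i) => p.2.1 i

/-- Gates for a linear form in the available exponents. -/
def costToken (M L : ℕ) : ℕ := costForm M L 0 6 (costOne M L)

/-- Gates for a simulation of the protocol from an XDLin instance. -/
def costSim (M L n m Q sA : ℕ) : ℕ := costRun M L n m Q 6 (costOne M L) (costToken M L) sA

/-- The circuits for the bilinear groups have size `M`. -/
def GroupSize (𝒢 : GroupGenerator) (k M : ℕ) : Prop :=
  ∀ (P : Type) (pp : P → Fin (𝒢.len k) → Bool), (∀ p, pp p ∈ (𝒢.gen k).support) →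
    Efficient (fun p => 𝒢.group k (pp p)) pp M

/-- Tokens may use the challenge only if it lies in the second source group, ciphertexts only if it
lies in the first; in the other group the corresponding base is 0. The elements $a,b,ac,bd$ are at
hand in both groups, and tokens are forms without message variables. -/
theorem computes_sim {M sA : ℕ} (hM : GroupSize 𝒢 k M)
    {A : ExpAdversary (𝒢.q k) (𝒢.len k) n m Q} (hA : A.SizeLE sA) (x : Side)
    (r : Fin A.coins → Bool) (Θ : Fin n → ZMod (𝒢.q k))
    {ρ : XDLinInput 𝒢 k → Fin n → ZMod (𝒢.q k)}
    {T : XDLinInput 𝒢 k → Fin n → Fin n → Fin 8 → ZMod (𝒢.q k)}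
    {c : XDLinInput 𝒢 k → Fin Q → (Fin m → ZMod (𝒢.q k)) → Fin m → Fin 8 → ZMod (𝒢.q k)}
    (hρ : ∀ j, LinForm (bases x .two) fun p (_ : Fin 0 → ZMod (𝒢.q k)) => ρ p j)
    (hT : ∀ i j s, LinForm (bases x .two) fun p (_ : Fin 0 → ZMod (𝒢.q k)) => T p i j s)
    (hc : ∀ t i s, LinForm (bases x .one) fun p y => c p t y i s) :
    Computes (xdlinInputView x) (costSim M (𝒢.len k) n m Q sA)
      fun (p : XDLinInput 𝒢 k) (_ : Unit) =>
        run A (𝒢.group k p.1) r p.1 (ρ p) (T p) Θ (c p) := by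
  have hpp : Computes (xdlinInputView (𝒢 := 𝒢) (k := k) x) 0 fun p => p.1.1 :=
    Computes.input (view := xdlinInputView x) fun l => XDLinWire.pp l
  have hG := hM (XDLinInput 𝒢 k) (fun p => p.1.1) fun p => p.1.2
  have hq := BilinearGroup.lt_two_pow (𝒢.group k (𝒢.gen k).support_nonempty.some)
  have h1 := hG.one₁ hpp hq
  have h2 := hG.one₂ hpp hq
  have hg1 : ComputesElt (fun p : XDLinInput 𝒢 k => (𝒢.group k p.1.1).G₁)
      (fun p => (𝒢.group k p.1.1).enc₁) (xdlinInputView x) (costOne M (𝒢.len k))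
      fun p => (𝒢.group k p.1.1).in₁ 1 := by
    refine ((hpp.trans hG.gen₁).mono (by simp [costOne])).congr fun p => ?_
    have := (𝒢.group k p.1.1).in₁_natCast 1
    rw [Nat.cast_one, pow_one] at this
    exact congrArg (𝒢.group k p.1.1).enc₁ this.symm
  have hg2 : ComputesElt (fun p : XDLinInput 𝒢 k => (𝒢.group k p.1.1).G₂)
      (fun p => (𝒢.group k p.1.1).enc₂) (xdlinInputView x) (costOne M (𝒢.len k))
      fun p => (𝒢.group k p.1.1).in₂ 1 := by
    refine ((hpp.trans hG.gen₂).mono (by simp [costOne])).congr fun p => ?_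
    have := (𝒢.group k p.1.1).in₂_natCast 1
    rw [Nat.cast_one, pow_one] at this
    exact congrArg (𝒢.group k p.1.1).enc₂ this.symm
  have zero₂ : ∀ p : XDLinInput 𝒢 k, (𝒢.group k p.1.1).in₂ 0 = 1 := fun p => by
    simp [BilinearGroup.in₂]
  have b1 : ∀ h, ComputesElt (fun p : XDLinInput 𝒢 k => (𝒢.group k p.1.1).G₁)
      (fun p => (𝒢.group k p.1.1).enc₁) (xdlinInputView x) (costOne M (𝒢.len k))
      fun p => (𝒢.group k p.1.1).in₁ (bases x .one p h) := by
    rintro (_ | _ | i)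
    · cases x
      · exact (Computes.input (view := xdlinInputView .one) fun l => XDLinWire.target l).mono
          (Nat.zero_le _)
      · exact h1.congr fun p => congrArg (𝒢.group k p.1.1).enc₁
          (((𝒢.group k p.1.1).in₁_eq_one_iff 0).2 rfl).symm
    · exact hg1
    · exact (Computes.input (view := xdlinInputView x) fun l => XDLinWire.elt .one i l).mono
        (Nat.zero_le _)
  have b2 : ∀ h, ComputesElt (fun p : XDLinInput 𝒢 k => (𝒢.group k p.1.1).G₂)
      (fun p => (𝒢.group k p.1.1).enc₂) (xdlinInputView x) (costOne M (𝒢.len k))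
      fun p => (𝒢.group k p.1.1).in₂ (bases x .two p h) := by
    rintro (_ | _ | i)
    · cases x
      · exact h2.congr fun p => congrArg (𝒢.group k p.1.1).enc₂ (zero₂ p).symm
      · exact (Computes.input (view := xdlinInputView .two) fun l => XDLinWire.target l).mono
          (Nat.zero_le _)
    · exact hg2
    · exact (Computes.input (view := xdlinInputView x) fun l => XDLinWire.elt .two i l).mono
        (Nat.zero_le _)
  have form : ∀ {c : XDLinInput 𝒢 k → ZMod (𝒢.q k)},
      (LinForm (bases x .two) fun p (_ : Fin 0 → ZMod (𝒢.q k)) => c p) →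
      ComputesElt (fun p : XDLinInput 𝒢 k => (𝒢.group k p.1.1).G₂)
        (fun p => (𝒢.group k p.1.1).enc₂) (xdlinInputView x) (costToken M (𝒢.len k))
        fun p => (𝒢.group k p.1.1).in₂ (c p) := by
    intro c hc
    have := computes_linForm (φ := fun p : XDLinInput 𝒢 k => (𝒢.group k p.1.1).in₂) hG.mul₂ hpp hq
      zero₂ (fun p => (𝒢.group k p.1.1).in₂_add) h2 b2 hc
      (Computes.const (view := xdlinInputView x) fun _ => false)
    simpa [costToken] using this
  have := computes_run hA hG hpp hq r Θ (fun j => form (hρ j)) (fun i j s => form (hT i j s)) b1 hc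
  simpa [costSim] using this

section Forms

variable {q : ℕ} {P I J : Type} [Fintype I] [Fintype J] {ν : P → I → ZMod q}

theorem LinForm.vec {e₀ e₁ e₂ e₃ e₄ e₅ e₆ e₇ : P → (J → ZMod q) → ZMod q}
    (h₀ : LinForm ν e₀) (h₁ : LinForm ν e₁) (h₂ : LinForm ν e₂) (h₃ : LinForm ν e₃)
    (h₄ : LinForm ν e₄) (h₅ : LinForm ν e₅) (h₆ : LinForm ν e₆) (h₇ : LinForm ν e₇) (s : Fin 8) :
    LinForm ν fun p x =>
      ![e₀ p x, e₁ p x, e₂ p x, e₃ p x, e₄ p x, e₅ p x, e₆ p x, e₇ p x] s := by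
  fin_cases s <;> assumption

end Forms

section Bases

variable {J : Type} [Fintype J] {x y : Side}

theorem LinForm.affine {f : (J → ZMod (𝒢.q k)) → ZMod (𝒢.q k)} (hf : IsAffine f) :
    LinForm (bases (𝒢 := 𝒢) x y) fun _ z => f z := by
  have := LinForm.coord (ν := bases (𝒢 := 𝒢) x y) (some none) hf
  simpa [bases] using this

theorem LinForm.const (a : ZMod (𝒢.q k)) :
    LinForm (bases (𝒢 := 𝒢) x y) fun _ (_ : J → ZMod (𝒢.q k)) => a :=
  .affine (.const a)

theorem LinForm.elt (i : Fin 4) {f : (J → ZMod (𝒢.q k)) → ZMod (𝒢.q k)} (hf : IsAffine f) :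
    LinForm (bases (𝒢 := 𝒢) x y) fun p z => p.2.1 i * f z :=
  LinForm.coord (ν := bases (𝒢 := 𝒢) x y) (some (some i)) hf

theorem LinForm.target {f : (J → ZMod (𝒢.q k)) → ZMod (𝒢.q k)} (hf : IsAffine f) :
    LinForm (bases (𝒢 := 𝒢) x x) fun p z => p.2.2 * f z := by
  cases x
  · exact LinForm.coord (ν := bases (𝒢 := 𝒢) .one .one) none hf
  · exact LinForm.coord (ν := bases (𝒢 := 𝒢) .two .two) none hf

end Bases

/-! ### The three kinds of game hops -/

/-- Every deterministic XDLin adversary that simulates the protocol has advantage at most `ε`. -/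
def XDLinBound (𝒢 : GroupGenerator) (k n m Q M sA : ℕ) (ε : ℝ) : Prop :=
  ∀ g : Side → (XDLinWire 0 (𝒢.len k) → Bool) → Bool,
    (∀ x, HasCircuit (costSim M (𝒢.len k) n m Q sA + costGuard M (𝒢.len k))
      fun w (_ : Unit) => g x w) → xdlinAdv 𝒢 k ⟨0, g⟩ ≤ ε

variable {M sA : ℕ} {ε : ℝ} (hmn : m ≤ n) {A : ExpAdversary (𝒢.q k) (𝒢.len k) n m Q}
  (r : Fin A.coins → Bool) (ρ Θ : Fin n → ZMod (𝒢.q k))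
  {u₀ u₅ u₆ u₇ : Fin n → Fin n → ZMod (𝒢.q k)}
  {v₅ : (Fin m → ZMod (𝒢.q k)) → ZeroSum (𝒢.q k) n → ZeroSum (𝒢.q k) n → Fin m → ZMod (𝒢.q k)}
  {v₆ v₇ : (Fin m → ZMod (𝒢.q k)) → Fin m → ZMod (𝒢.q k)}

/-- The adversary's success in the game with the given slots, averaged over everything except its
coins, `ρ` and `Θ`. -/
def value (u₀ u₅ u₆ u₇ : Fin n → Fin n → ZMod (𝒢.q k))
    (v₅ : (Fin m → ZMod (𝒢.q k)) → ZeroSum (𝒢.q k) n → ZeroSum (𝒢.q k) n → Fin m → ZMod (𝒢.q k))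
    (v₆ v₇ : (Fin m → ZMod (𝒢.q k)) → Fin m → ZMod (𝒢.q k)) : ℝ :=
  ∑ pp, (𝒢.gen k pp).toReal * game hmn A (𝒢.group k pp) r pp ρ Θ (tokenSlots u₀ u₅ u₆ u₇)
    (ctSlots hmn v₅ v₆ v₇)

/-- Slot 7 of the ciphertexts is hidden when the tokens of the honest senders vanish there. -/
theorem value_ciphertext_hop (hM : GroupSize 𝒢 k M) (hε : XDLinBound 𝒢 k n m Q M sA ε)
    (hA : A.SizeLE sA) (h₇ : ∀ i j, i.val < m → u₇ i j = 0)
    (hv₆ : ∀ i, IsAffine fun x => v₆ x i) (hv₇ : ∀ i, IsAffine fun x => v₇ x i) :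
    |value hmn r ρ Θ u₀ u₅ u₆ u₇ 0 v₆ 0 - value hmn r ρ Θ u₀ u₅ u₆ u₇ 0 v₆ v₇| *
      (1 - 1 / (𝒢.q k : ℝ)) ^ 3 ≤ ε := by
  classical
  unfold value
  rw [← Finset.sum_sub_distrib]
  simp only [← mul_sub]
  -- Slots 1 and 2 carry the noise in the scaled form $a(\alpha+cv_7)$ and $b(\alpha'+dv_7)$; slot 7
  -- carries $\alpha+\alpha'+zv_7$. Each needs only the exponents of the instance, and the noise
  -- differs from query to query, so the same instance works for all of them.
  refine xdlin_bound hM hε .one (Ω := Noise (𝒢.q k) n m Q) (wgt := fun _ => 1)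
    (fun _ => zero_le_one) (fun _ => le_rfl)
    (fun ω pp v z => run A (𝒢.group k pp) r pp ρ
      (fun i j => tokenSlots u₀ u₅ u₆ u₇ ω.1 ω.2.1 i j ᵥ*
        (ω.2.2.2 i : Matrix (Fin 8) (Fin 8) (ZMod (𝒢.q k)))) Θ
      fun t x i => (((ω.2.2.2 (Fin.castLE hmn i))⁻¹ : GL (Fin 8) (ZMod (𝒢.q k))) :
        Matrix (Fin 8) (Fin 8) (ZMod (𝒢.q k))) *ᵥ
          ![(ω.2.2.1 t).1.1 (Fin.castLE hmn i), v 0 * (ω.2.2.1 t).2.2.1 i + v 2 * v₇ x i,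
            v 1 * (ω.2.2.1 t).2.2.2 i + v 3 * v₇ x i, 0, 0, 0, v₆ x i,
            (ω.2.2.1 t).2.2.1 i + (ω.2.2.1 t).2.2.2 i + z * v₇ x i]) ?_ ?_
  · intro ω
    refine computes_sim hM hA .one r Θ (fun j => .const _) (fun i j s => .const _)
      fun t i s => ?_
    exact LinForm.mulVec (.vec (.const _) ((LinForm.elt 0 (.const _)).add (.elt 2 (hv₇ i)))
      ((LinForm.elt 1 (.const _)).add (.elt 3 (hv₇ i))) .zero .zero .zero (.affine (hv₆ i))
      ((LinForm.const _).add (.target (hv₇ i)))) _ s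
  · intro pp _ a b c d δ ha hb
    let V : ZMod (𝒢.q k) → (Fin m → ZMod (𝒢.q k)) → Coins (𝒢.q k) n m → Fin m → Fin 8 →
        ZMod (𝒢.q k) := fun y x S i =>
      ![S.1.1 (Fin.castLE hmn i), S.2.2.1 i, S.2.2.2 i, 0, 0, 0, v₆ x i, y * v₇ x i]
    -- Shifting the noise by $cv_7$ and $dv_7$ leaves exactly $\delta v_7$ in slot 7.
    let h : (Fin m → ZMod (𝒢.q k)) → Equiv.Perm (Coins (𝒢.q k) n m) := fun x =>
      (Equiv.refl _).prodCongr ((Equiv.refl _).prodCongr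
        ((Equiv.addRight fun i => c * v₇ x i).prodCongr (Equiv.addRight fun i => d * v₇ x i)))
    have e1 := expect_eq_game hmn A (𝒢.group k pp) r pp ρ Θ
      (W := tokenSlots u₀ u₅ u₆ u₇)
      (V := fun x S i => ![S.1.1 (Fin.castLE hmn i), a * S.2.2.1 i + a * c * v₇ x i,
            b * S.2.2.2 i + b * d * v₇ x i, 0, 0, 0, v₆ x i,
            S.2.2.1 i + S.2.2.2 i + (c + d + δ) * v₇ x i])
    have e2 : game hmn A (𝒢.group k pp) r pp ρ Θ (tokenSlots u₀ u₅ u₆ u₇)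
        (fun x S => V δ x (h x S)) = game hmn A (𝒢.group k pp) r pp ρ Θ (tokenSlots u₀ u₅ u₆ u₇)
          fun x S i => ![S.1.1 (Fin.castLE hmn i), a * S.2.2.1 i + a * c * v₇ x i,
            b * S.2.2.2 i + b * d * v₇ x i, 0, 0, 0, v₆ x i,
            S.2.2.1 i + S.2.2.2 i + (c + d + δ) * v₇ x i] := by
      -- On ciphertexts this adds slots 1 and 2 to slot 7 and then scales them by $a$ and $b$.
      -- Dually it adds slot 7 of a token to slots 1 and 2, which changes nothing because honest
      -- tokens vanish in all three.
      refine game_basis hmn A (𝒢.group k pp) r pp ρ Θ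
        (fun i => if i.val < m then scaleSlot 1 (Units.mk0 a ha) * scaleSlot 2 (Units.mk0 b hb) *
          addSlot 7 1 (by decide) 1 * addSlot 7 2 (by decide) 1 else 1) ?_ ?_
      · intro β γ i j
        by_cases hi : i.val < m
        · simp only [if_pos hi, Units.val_mul, ← Matrix.vecMul_vecMul, vecMul_scaleSlot,
            vecMul_addSlot]
          funext s
          fin_cases s <;> simp [tokenSlots, h₇ i j hi]
        · simp [if_neg hi]
      · intro x S i
        simp only [Fin.val_castLE, i.isLt, if_true, Units.val_mul, ← Matrix.mulVec_mulVec,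
          scaleSlot_mulVec, addSlot_mulVec, V, h]
        funext s
        fin_cases s <;> simp <;> ring
    have e3 := game_perm hmn A (𝒢.group k pp) r pp ρ Θ (W := tokenSlots u₀ u₅ u₆ u₇)
      (V := V δ) h
    simp only [one_mul]
    refine (e1.trans (e2.symm.trans e3)).trans ?_
    split_ifs with hδ
    · subst hδ
      congr 1
      funext x S i s
      fin_cases s <;> simp [V, ctSlots]
    -- A nonzero $\delta$ is a change of scale in slot 7, invisible in honest tokens.
    · symm
      refine game_basis hmn A (𝒢.group k pp) r pp ρ Θ
        (fun i => if i.val < m then scaleSlot 7 (Units.mk0 δ hδ) else 1) ?_ ?_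
      · intro β γ i j
        by_cases hi : i.val < m
        · simp only [if_pos hi, vecMul_scaleSlot]
          funext s
          fin_cases s <;> simp [tokenSlots, h₇ i j hi]
        · simp [if_neg hi]
      · intro x S i
        simp only [Fin.val_castLE, i.isLt, if_true, scaleSlot_mulVec, V]
        funext s
        fin_cases s <;> simp [ctSlots]

end

/-! ### The token hop and the mask hop. -/

section

variable {𝒢 : GroupGenerator} {k n m Q : ℕ} {M sA : ℕ} {ε : ℝ} (hmn : m ≤ n)
  {A : ExpAdversary (𝒢.q k) (𝒢.len k) n m Q} (r : Fin A.coins → Bool)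
  (ρ Θ : Fin n → ZMod (𝒢.q k)) {u₀ u₅ u₆ u₇ : Fin n → Fin n → ZMod (𝒢.q k)}
  {v₆ v₇ : (Fin m → ZMod (𝒢.q k)) → Fin m → ZMod (𝒢.q k)}

/-- Slot 5 of the tokens is hidden when the ciphertexts vanish there. -/
theorem value_token_hop (hM : GroupSize 𝒢 k M) (hε : XDLinBound 𝒢 k n m Q M sA ε)
    (hA : A.SizeLE sA) (hv₆ : ∀ i, IsAffine fun x => v₆ x i)
    (hv₇ : ∀ i, IsAffine fun x => v₇ x i) :
    |value hmn r ρ Θ u₀ 0 u₆ u₇ 0 v₆ v₇ - value hmn r ρ Θ u₀ u₅ u₆ u₇ 0 v₆ v₇| *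
      (1 - 1 / (𝒢.q k : ℝ)) ^ 3 ≤ ε := by
  classical
  unfold value
  rw [← Finset.sum_sub_distrib]
  simp only [← mul_sub]
  -- The dual of the ciphertext hop: the noise $\beta,\gamma$ of slots 3 and 4 hides slot 5. Since
  -- all visible ciphertexts vanish in these three slots, the changes of basis can be made for every
  -- sender.
  refine xdlin_bound hM hε .two (Ω := Noise (𝒢.q k) n m Q) (wgt := fun _ => 1)
    (fun _ => zero_le_one) (fun _ => le_rfl)
    (fun ω pp v z => run A (𝒢.group k pp) r pp ρ
      (fun i j => ![u₀ i j, 0, 0, v 0 * ω.1 i j + v 2 * u₅ i j, v 1 * ω.2.1 i j + v 3 * u₅ i j,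
          ω.1 i j + ω.2.1 i j + z * u₅ i j, u₆ i j, u₇ i j] ᵥ*
        (ω.2.2.2 i : Matrix (Fin 8) (Fin 8) (ZMod (𝒢.q k)))) Θ
      fun t x i => (((ω.2.2.2 (Fin.castLE hmn i))⁻¹ : GL (Fin 8) (ZMod (𝒢.q k))) :
        Matrix (Fin 8) (Fin 8) (ZMod (𝒢.q k))) *ᵥ ctSlots hmn 0 v₆ v₇ x (ω.2.2.1 t) i) ?_ ?_
  · intro ω
    refine computes_sim hM hA .two r Θ (fun j => .const _) (fun i j s => ?_) fun t i s => ?_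
    · exact LinForm.vecMul (.vec (.const _) .zero .zero
        ((LinForm.elt 0 (.const _)).add (.elt 2 (.const _)))
        ((LinForm.elt 1 (.const _)).add (.elt 3 (.const _)))
        ((LinForm.const _).add (.target (.const _))) (.const _) (.const _)) _ s
    · exact LinForm.mulVec (.vec (.const _) (.const _) (.const _) .zero .zero .zero
        (.affine (hv₆ i)) (.affine (hv₇ i))) _ s
  · intro pp _ a b c d δ ha hb
    let W : ZMod (𝒢.q k) → (Fin n → Fin n → ZMod (𝒢.q k)) → (Fin n → Fin n → ZMod (𝒢.q k)) →
        Fin n → Fin n → Fin 8 → ZMod (𝒢.q k) := fun y β γ i j =>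
      ![u₀ i j, 0, 0, β i j, γ i j, y * u₅ i j, u₆ i j, u₇ i j]
    have e1 := expect_eq_game hmn A (𝒢.group k pp) r pp ρ Θ
      (W := fun β γ i j => ![u₀ i j, 0, 0, a * β i j + a * c * u₅ i j,
        b * γ i j + b * d * u₅ i j, β i j + γ i j + (c + d + δ) * u₅ i j, u₆ i j, u₇ i j])
      (V := ctSlots hmn 0 v₆ v₇)
    have e2 : game hmn A (𝒢.group k pp) r pp ρ Θ
        (fun β γ i j => ![u₀ i j, 0, 0, a * β i j + a * c * u₅ i j,
          b * γ i j + b * d * u₅ i j, β i j + γ i j + (c + d + δ) * u₅ i j, u₆ i j, u₇ i j])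
        (ctSlots hmn 0 v₆ v₇) = game hmn A (𝒢.group k pp) r pp ρ Θ
          (fun β γ => W δ (Equiv.addRight (c • u₅) β) (Equiv.addRight (d • u₅) γ))
          (ctSlots hmn 0 v₆ v₇) := by
      refine game_basis hmn A (𝒢.group k pp) r pp ρ Θ
        (fun _ => addSlot 3 5 (by decide) 1 * addSlot 4 5 (by decide) 1 *
          scaleSlot 3 (Units.mk0 a ha) * scaleSlot 4 (Units.mk0 b hb)) ?_ ?_
      · intro β γ i j
        simp only [Units.val_mul, ← Matrix.vecMul_vecMul, vecMul_scaleSlot, vecMul_addSlot, W]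
        funext s
        fin_cases s <;> simp <;> ring
      · intro x S i
        simp only [Units.val_mul, ← Matrix.mulVec_mulVec, scaleSlot_mulVec, addSlot_mulVec]
        funext s
        fin_cases s <;> simp [ctSlots]
    have e3 := game_noise hmn A (𝒢.group k pp) r pp ρ Θ (W := W δ) (V := ctSlots hmn 0 v₆ v₇)
      (Equiv.addRight (c • u₅)) (Equiv.addRight (d • u₅))
    simp only [one_mul]
    refine (e1.trans (e2.trans e3)).trans ?_
    split_ifs with hδ
    · subst hδ
      congr 1
      funext β γ i j s
      fin_cases s <;> simp [W, tokenSlots]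
    · refine game_basis hmn A (𝒢.group k pp) r pp ρ Θ
        (fun _ => scaleSlot 5 (Units.mk0 δ hδ)) ?_ ?_
      · intro β γ i j
        simp only [vecMul_scaleSlot, W]
        funext s
        fin_cases s <;> simp [tokenSlots, mul_comm]
      · intro x S i
        simp only [scaleSlot_mulVec]
        funext s
        fin_cases s <;> simp [ctSlots]

/-- Multiplication of a vector with zero sum by a scalar. -/
def ZeroSum.scale {q n : ℕ} (c : ZMod q) (v : ZeroSum q n) : ZeroSum q n :=
  ⟨fun i => c * v.1 i, by
    have h : ∑ i, v.1 i = 0 := v.2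
    change ∑ i, c * v.1 i = 0
    rw [← Finset.mul_sum, h, mul_zero]⟩

theorem ZeroSum.scale_scale {q n : ℕ} (c d : ZMod q) (h : c * d = 1) (v : ZeroSum q n) :
    ZeroSum.scale c (ZeroSum.scale d v) = v := by
  apply Subtype.ext
  funext i
  simp [ZeroSum.scale, ← mul_assoc, h]

/-- The second vector of masks as the sum of the first one and a multiple of an independent one. -/
def mixMasks {q n m : ℕ} [Fact q.Prime] (δ : ZMod q) (hδ : δ ≠ 0) :
    Equiv.Perm (Coins q n m) where
  toFun S := (S.1, S.1 + ZeroSum.scale δ S.2.1, S.2.2)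
  invFun S := (S.1, ZeroSum.scale δ⁻¹ (S.2.1 - S.1), S.2.2)
  left_inv := fun ⟨K, K', T⟩ => by
    have : K + ZeroSum.scale δ K' - K = ZeroSum.scale δ K' := add_sub_cancel_left _ _
    dsimp only
    rw [this, ZeroSum.scale_scale _ _ (inv_mul_cancel₀ hδ)]
  right_inv := fun ⟨K, K', T⟩ => by
    dsimp only
    rw [ZeroSum.scale_scale _ _ (mul_inv_cancel₀ hδ), add_sub_cancel]

/-- For $\delta\neq0$ the pair $(K,K+\delta K')$ is distributed like a pair of independent vectors.
-/
theorem game_mixMasks {q L n m Q : ℕ} [Fact q.Prime] (hmn : m ≤ n) (A : ExpAdversary q L n m Q)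
    (G : BilinearGroup q L) (r : Fin A.coins → Bool) (pp : Fin L → Bool) (ρ Θ : Fin n → ZMod q)
    {W : (Fin n → Fin n → ZMod q) → (Fin n → Fin n → ZMod q) → Fin n → Fin n → Fin 8 → ZMod q}
    {v₆ v₇ : (Fin m → ZMod q) → Fin m → ZMod q} {δ : ZMod q} (hδ : δ ≠ 0) :
    game hmn A G r pp ρ Θ W (fun x S i => ![S.1.1 (Fin.castLE hmn i), S.2.2.1 i, S.2.2.2 i, 0, 0,
        S.1.1 (Fin.castLE hmn i) + δ * S.2.1.1 (Fin.castLE hmn i), v₆ x i, v₇ x i]) =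
      game hmn A G r pp ρ Θ W
        (ctSlots hmn (fun _ _ K' i => K'.1 (Fin.castLE hmn i)) v₆ v₇) :=
  game_perm hmn A G r pp ρ Θ (V := ctSlots hmn (fun _ _ K' i => K'.1 (Fin.castLE hmn i)) v₆ v₇)
    fun _ => mixMasks δ hδ

/-- The indicator of `ρ_j ≠ 0` for all honest `j`. -/
def goodWeight {q n : ℕ} (m : ℕ) (ρ : Fin n → ZMod q) : ℝ :=
  open Classical in if ∀ j, j.val < m → ρ j ≠ 0 then 1 else 0

/-- Slot 0 of the tokens when column `l` has been separated. -/
def splitRest {q n : ℕ} (m : ℕ) (l : Fin n) (ρ : Fin n → ZMod q) (i j : Fin n) : ZMod q :=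
  if i.val < m ∧ j = l then 0 else ρ j

/-- Slot 5 of the tokens when column `l` has been separated. -/
def splitColumn {q n : ℕ} (m : ℕ) (l : Fin n) (ρ : Fin n → ZMod q) (i j : Fin n) : ZMod q :=
  if i.val < m ∧ j = l then ρ j else 0

/-- When column `l` of the tokens has been separated, its masks may be chosen independently of the
masks of the other columns. -/
theorem value_mask_hop (hM : GroupSize 𝒢 k M) (hε : XDLinBound 𝒢 k n m Q M sA ε)
    (hA : A.SizeLE sA) (l : Fin n) (hv₆ : ∀ i, IsAffine fun x => v₆ x i)
    (hv₇ : ∀ i, IsAffine fun x => v₇ x i) :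
    |𝔼 ρ, goodWeight m ρ * (value hmn r ρ Θ (splitRest m l ρ) (splitColumn m l ρ) u₆ u₇
        (fun _ K _ i => K.1 (Fin.castLE hmn i)) v₆ v₇ -
      value hmn r ρ Θ (splitRest m l ρ) (splitColumn m l ρ) u₆ u₇
        (fun _ _ K' i => K'.1 (Fin.castLE hmn i)) v₆ v₇)| * (1 - 1 / (𝒢.q k : ℝ)) ^ 3 ≤ ε := by
  classical
  have hswap : ∀ f g : (Fin n → ZMod (𝒢.q k)) → (Fin (𝒢.len k) → Bool) → ℝ,
      𝔼 ρ, goodWeight m ρ * (∑ pp, (𝒢.gen k pp).toReal * f ρ pp -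
        ∑ pp, (𝒢.gen k pp).toReal * g ρ pp) =
      ∑ pp, (𝒢.gen k pp).toReal *
        (𝔼 ρ, goodWeight m ρ * f ρ pp - 𝔼 ρ, goodWeight m ρ * g ρ pp) := by
    intro f g
    simp only [← Finset.sum_sub_distrib, ← mul_sub, Finset.mul_sum, ← expect_sub]
    rw [Finset.expect_sum_comm]
    refine Finset.sum_congr rfl fun pp _ => ?_
    rw [Finset.mul_expect]
    exact Finset.expect_congr rfl fun ρ _ => by ring
  unfold value
  rw [hswap]
  -- The instance itself provides the scale of $\rho$: $\rho_j=a s_j$ for $j\neq l$ and $\rho_l=b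
  -- s_l$, with $s$ known. This is why the hop is stated on average over $\rho$. The vector $K'$ is
  -- multiplied by the challenge, so that $\delta K'$ survives in slot 5.
  refine xdlin_bound hM hε .one (Ω := (Fin n → ZMod (𝒢.q k)) × Noise (𝒢.q k) n m Q)
    (wgt := fun ω => goodWeight m ω.1)
    (fun ω => by unfold goodWeight; split_ifs <;> norm_num)
    (fun ω => by unfold goodWeight; split_ifs <;> norm_num)
    (fun ω pp v z => run A (𝒢.group k pp) r pp (fun j => (if j = l then v 1 else v 0) * ω.1 j)
      (fun i j => ![if i.val < m then (if j = l then 0 else ω.1 j) else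
            (if j = l then v 1 else v 0) * ω.1 j,
          if i.val < m ∧ j = l then ω.1 j else 0, 0, ω.2.1 i j, ω.2.2.1 i j,
          if i.val < m ∧ j = l then v 1 * ω.1 j else 0, u₆ i j, u₇ i j] ᵥ*
        (ω.2.2.2.2 i : Matrix (Fin 8) (Fin 8) (ZMod (𝒢.q k)))) Θ
      fun t x i => (((ω.2.2.2.2 (Fin.castLE hmn i))⁻¹ : GL (Fin 8) (ZMod (𝒢.q k))) :
        Matrix (Fin 8) (Fin 8) (ZMod (𝒢.q k))) *ᵥ
          ![v 2 * (ω.2.2.2.1 t).2.1.1 (Fin.castLE hmn i) +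
              v 0 * (ω.2.2.2.1 t).1.1 (Fin.castLE hmn i),
            v 1 * (-(ω.2.2.2.1 t).2.2.1 i) + v 3 * (-(ω.2.2.2.1 t).2.1.1 (Fin.castLE hmn i)),
            (ω.2.2.2.1 t).2.2.2 i, 0, 0,
            z * (ω.2.2.2.1 t).2.1.1 (Fin.castLE hmn i) +
              ((ω.2.2.2.1 t).1.1 (Fin.castLE hmn i) + (ω.2.2.2.1 t).2.2.1 i),
            v₆ x i, v₇ x i]) ?_ ?_
  · intro ω
    have hmul : ∀ j, LinForm (bases (𝒢 := 𝒢) (k := k) .one .two)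
        fun p (_ : Fin 0 → ZMod (𝒢.q k)) => (if j = l then p.2.1 1 else p.2.1 0) * ω.1 j := by
      intro j
      split_ifs
      · exact .elt 1 (.const _)
      · exact .elt 0 (.const _)
    refine computes_sim hM hA .one r Θ hmul (fun i j s => ?_) fun t i s => ?_
    · refine LinForm.vecMul (.vec ?_ (.const _) .zero (.const _) (.const _) ?_ (.const _)
        (.const _)) _ s
      · by_cases hi : i.val < m
        · simp only [if_pos hi]
          exact .const _
        · simp only [if_neg hi]
          exact hmul j
      · by_cases hi : i.val < m ∧ j = l
        · simp only [if_pos hi]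
          exact .elt 1 (.const _)
        · simp only [if_neg hi]
          exact .zero
    · exact LinForm.mulVec (.vec ((LinForm.elt 2 (.const _)).add (.elt 0 (.const _)))
        ((LinForm.elt 1 (.const _)).add (.elt 3 (.const _))) (.const _) .zero .zero
        ((LinForm.target (.const _)).add (.const _)) (.affine (hv₆ i)) (.affine (hv₇ i))) _ s
  · intro pp _ a b c d δ ha hb
    -- Scaling by $a$ and $b$ permutes the vectors $\rho$ and preserves the nonvanishing of their
    -- entries.
    let e : Equiv.Perm (Fin n → ZMod (𝒢.q k)) := Equiv.piCongrRight fun j =>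
      Equiv.mulLeft₀ (if j = l then b else a) (by split_ifs <;> assumption)
    have he : ∀ s j, e s j = (if j = l then b else a) * s j := fun _ _ => rfl
    have hgood : ∀ s, goodWeight m (e s) = goodWeight m s := by
      intro s
      unfold goodWeight
      congr 1
      refine propext (forall_congr' fun j => imp_congr_right fun _ => not_congr ?_)
      rw [he, mul_eq_zero, or_iff_right]
      split_ifs <;> assumption
    let V : ZMod (𝒢.q k) → (Fin m → ZMod (𝒢.q k)) → Coins (𝒢.q k) n m → Fin m → Fin 8 →
        ZMod (𝒢.q k) := fun y x S i =>
      ![S.1.1 (Fin.castLE hmn i), S.2.2.1 i, S.2.2.2 i, 0, 0,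
        S.1.1 (Fin.castLE hmn i) + y * S.2.1.1 (Fin.castLE hmn i), v₆ x i, v₇ x i]
    -- With $K+cK'$ as first mask and $\alpha+dK'$ as noise, slot 5 becomes
    -- $K+\alpha+(c+d+\delta)K'$ once slot 1 is added to it.
    let h : Equiv.Perm (Coins (𝒢.q k) n m) :=
      { toFun := fun S => (S.1 + ZeroSum.scale c S.2.1, S.2.1,
          fun i => S.2.2.1 i + d * S.2.1.1 (Fin.castLE hmn i), S.2.2.2)
        invFun := fun S => (S.1 - ZeroSum.scale c S.2.1, S.2.1,
          fun i => S.2.2.1 i - d * S.2.1.1 (Fin.castLE hmn i), S.2.2.2)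
        left_inv := fun S => by simp
        right_inv := fun S => by simp }
    have e1 : ∀ s, 𝔼 ω : Noise (𝒢.q k) n m Q, play hmn A (𝒢.group k pp) r pp (e s) Θ ω.2.2.2
        (fun i j => ![if i.val < m then (if j = l then 0 else s j) else
            (if j = l then b else a) * s j,
          if i.val < m ∧ j = l then s j else 0, 0, ω.1 i j, ω.2.1 i j,
          if i.val < m ∧ j = l then b * s j else 0, u₆ i j, u₇ i j])
        (fun t x i => ![a * c * (ω.2.2.1 t).2.1.1 (Fin.castLE hmn i) +
              a * (ω.2.2.1 t).1.1 (Fin.castLE hmn i),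
            b * (-(ω.2.2.1 t).2.2.1 i) + b * d * (-(ω.2.2.1 t).2.1.1 (Fin.castLE hmn i)),
            (ω.2.2.1 t).2.2.2 i, 0, 0,
            (c + d + δ) * (ω.2.2.1 t).2.1.1 (Fin.castLE hmn i) +
              ((ω.2.2.1 t).1.1 (Fin.castLE hmn i) + (ω.2.2.1 t).2.2.1 i),
            v₆ x i, v₇ x i]) =
        game hmn A (𝒢.group k pp) r pp (e s) Θ
          (tokenSlots (splitRest m l (e s)) (splitColumn m l (e s)) u₆ u₇)
          (fun x S => V δ x (h S)) := by
      intro s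
      refine (expect_eq_game hmn A (𝒢.group k pp) r pp (e s) Θ
        (W := fun β γ i j => ![if i.val < m then (if j = l then 0 else s j) else
            (if j = l then b else a) * s j,
          if i.val < m ∧ j = l then s j else 0, 0, β i j, γ i j,
          if i.val < m ∧ j = l then b * s j else 0, u₆ i j, u₇ i j])
        (V := fun x S i => ![a * c * S.2.1.1 (Fin.castLE hmn i) + a * S.1.1 (Fin.castLE hmn i),
            b * (-S.2.2.1 i) + b * d * (-S.2.1.1 (Fin.castLE hmn i)), S.2.2.2 i, 0, 0,
            (c + d + δ) * S.2.1.1 (Fin.castLE hmn i) +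
              (S.1.1 (Fin.castLE hmn i) + S.2.2.1 i), v₆ x i, v₇ x i])).trans ?_
      symm
      -- The sign in slot 1 makes the simulated entry $s_l$, scaled by $-b$, cancel the $bs_l$ that
      -- slot 5 contributes there. For $i\ge m$ no ciphertext is simulated, so these tokens can be
      -- written directly.
      refine game_basis hmn A (𝒢.group k pp) r pp (e s) Θ
        (fun i => if i.val < m then scaleSlot 0 (Units.mk0 a ha) *
          scaleSlot 1 (-(Units.mk0 b hb)) * addSlot 5 1 (by decide) 1 else 1) ?_ ?_
      · intro β γ i j
        by_cases hi : i.val < m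
        · simp only [if_true, Units.val_mul, ← Matrix.vecMul_vecMul, vecMul_scaleSlot,
            vecMul_addSlot, tokenSlots, splitRest, splitColumn, he, hi, true_and]
          by_cases hj : j = l
          · funext s
            fin_cases s <;> simp [hj, mul_comm]
          · funext s
            fin_cases s <;> simp [hj, mul_comm]
        · funext s
          simp only [tokenSlots, splitRest, splitColumn, he]
          fin_cases s <;> simp [hi]
      · intro x S i
        simp only [Fin.val_castLE, i.isLt, if_true, Units.val_mul, ← Matrix.mulVec_mulVec,
          scaleSlot_mulVec, addSlot_mulVec, V, h]
        funext s
        fin_cases s <;> simp [ZeroSum.scale] <;> ring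
    have e2 : ∀ s, game hmn A (𝒢.group k pp) r pp (e s) Θ
          (tokenSlots (splitRest m l (e s)) (splitColumn m l (e s)) u₆ u₇)
          (fun x S => V δ x (h S)) = game hmn A (𝒢.group k pp) r pp (e s) Θ
          (tokenSlots (splitRest m l (e s)) (splitColumn m l (e s)) u₆ u₇) (V δ) := fun s =>
      game_perm hmn A (𝒢.group k pp) r pp (e s) Θ (V := V δ) fun _ => h
    have e3 := expect_perm e fun ρ => goodWeight m ρ * game hmn A (𝒢.group k pp) r pp ρ Θ
      (tokenSlots (splitRest m l ρ) (splitColumn m l ρ) u₆ u₇) (V δ)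
    refine (expect_prod _).trans ?_
    refine (Finset.expect_congr rfl fun s _ => ?_).trans (e3.trans ?_)
    · rw [hgood, ← e2, ← e1, Finset.mul_expect]
      exact Finset.expect_congr rfl fun ω _ => rfl
    · split_ifs with hδ
      · subst hδ
        refine Finset.expect_congr rfl fun ρ _ => ?_
        congr 2
        funext x S i s
        fin_cases s <;> simp [V, ctSlots]
      · refine Finset.expect_congr rfl fun ρ _ => ?_
        exact congrArg (goodWeight m ρ * ·) (game_mixMasks hmn A (𝒢.group k pp) r pp ρ Θ hδ)

end

section

variable {𝒢 : GroupGenerator} {k n m Q : ℕ} {M sA : ℕ} {ε : ℝ} (hmn : m ≤ n)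
  {A : ExpAdversary (𝒢.q k) (𝒢.len k) n m Q} (r : Fin A.coins → Bool)
  (ρ Θ : Fin n → ZMod (𝒢.q k)) {u₀ u₅ u₆ u₇ u₆' u₇' : Fin n → Fin n → ZMod (𝒢.q k)}
  {v₅ v₅' : (Fin m → ZMod (𝒢.q k)) → ZeroSum (𝒢.q k) n → ZeroSum (𝒢.q k) n → Fin m → ZMod (𝒢.q k)}
  {v₆ v₇ v₆' v₇' : (Fin m → ZMod (𝒢.q k)) → Fin m → ZMod (𝒢.q k)}

/-! ### Rewriting the games -/

theorem value_basis (N : Fin n → GL (Fin 8) (ZMod (𝒢.q k)))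
    {u₀' u₅' : Fin n → Fin n → ZMod (𝒢.q k)}
    (hW : ∀ β γ i j, tokenSlots u₀' u₅' u₆' u₇' β γ i j ᵥ*
      (N i : Matrix (Fin 8) (Fin 8) (ZMod (𝒢.q k))) = tokenSlots u₀ u₅ u₆ u₇ β γ i j)
    (hV : ∀ x S i, ctSlots hmn v₅' v₆' v₇' x S i =
      (N (Fin.castLE hmn i) : Matrix (Fin 8) (Fin 8) (ZMod (𝒢.q k))) *ᵥ
        ctSlots hmn v₅ v₆ v₇ x S i) :
    value hmn r ρ Θ u₀ u₅ u₆ u₇ v₅ v₆ v₇ = value hmn r ρ Θ u₀' u₅' u₆' u₇' v₅' v₆' v₇' := by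
  unfold value
  exact Finset.sum_congr rfl fun pp _ => congrArg _ (game_basis hmn A _ r pp ρ Θ N hW hV)

theorem value_nonneg : 0 ≤ value hmn r ρ Θ u₀ u₅ u₆ u₇ v₅ v₆ v₇ :=
  Finset.sum_nonneg fun _ _ => mul_nonneg ENNReal.toReal_nonneg (game_nonneg _ _ _ _ _ _ _)

theorem value_le_one : value hmn r ρ Θ u₀ u₅ u₆ u₇ v₅ v₆ v₇ ≤ 1 := by
  rw [← sum_weights (𝒢.gen k)]
  exact Finset.sum_le_sum fun _ _ =>
    mul_le_of_le_one_right ENNReal.toReal_nonneg (game_le_one _ _ _ _ _ _ _)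

/-- Without queries the ciphertexts do not matter. -/
theorem value_of_no_query (hQ : Q = 0) :
    value hmn r ρ Θ u₀ u₅ u₆ u₇ v₅ v₆ v₇ = value hmn r ρ Θ u₀ u₅ u₆ u₇ v₅' v₆' v₇' := by
  subst hQ
  unfold value game
  have : ∀ S : Fin 0 → Coins (𝒢.q k) n m, (fun t x => ctSlots hmn v₅ v₆ v₇ x (S t)) =
      fun t x => ctSlots hmn v₅' v₆' v₇' x (S t) := fun S => funext fun t => t.elim0
  simp only [this]

/-- One column of the tokens may be moved from slot 0 to slot 5, which then masks slot 5 of the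
ciphertexts. -/
theorem value_split (l : Fin n) :
    value hmn r ρ Θ (fun _ j => ρ j) (splitColumn m l ρ) u₆ u₇ 0 v₆ v₇ =
      value hmn r ρ Θ (splitRest m l ρ) (splitColumn m l ρ) u₆ u₇
        (fun _ K _ i => K.1 (Fin.castLE hmn i)) v₆ v₇ := by
  refine value_basis hmn r ρ Θ (fun _ => addSlot 5 0 (by decide) 1) (fun β γ i j => ?_)
    fun x S i => ?_
  · rw [vecMul_addSlot]
    funext s
    fin_cases s <;> simp [tokenSlots, splitRest, splitColumn]
    split_ifs <;> simp
  · rw [addSlot_mulVec]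
    funext s
    fin_cases s <;> simp [ctSlots]

/-- Multiples of slot 5 of the tokens may be moved to slots 6 and 7 when this changes the masks in
slot 5 of the ciphertexts by a vector with zero sum. -/
theorem value_shift (c d : Fin n → ZMod (𝒢.q k)) (h₆ : ∀ i j, u₆ i j = u₆' i j + u₅ i j * c i)
    (h₇ : ∀ i j, u₇ i j = u₇' i j + u₅ i j * d i)
    (hsum : ∀ x, ∑ i : Fin m,
      (c (Fin.castLE hmn i) * v₆ x i + d (Fin.castLE hmn i) * v₇ x i) = 0) :
    value hmn r ρ Θ u₀ u₅ u₆ u₇ (fun _ _ K' i => K'.1 (Fin.castLE hmn i)) v₆ v₇ =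
      value hmn r ρ Θ u₀ u₅ u₆' u₇' (fun _ _ K' i => K'.1 (Fin.castLE hmn i)) v₆ v₇ := by
  let y : (Fin m → ZMod (𝒢.q k)) → Fin m → ZMod (𝒢.q k) := fun x i =>
    c (Fin.castLE hmn i) * v₆ x i + d (Fin.castLE hmn i) * v₇ x i
  -- The change of the masks, extended by zero to the senders without ciphertexts. Its sum vanishes
  -- by `hsum`, so translating the second masks by it is a permutation.
  let w : (Fin m → ZMod (𝒢.q k)) → ZeroSum (𝒢.q k) n := fun x =>
    ⟨∑ i, Pi.single (Fin.castLE hmn i) (y x i), by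
      change ∑ j, (∑ i, Pi.single (Fin.castLE hmn i) (y x i) : Fin n → ZMod (𝒢.q k)) j = 0
      simp only [Finset.sum_apply]
      rw [Finset.sum_comm]
      simpa using hsum x⟩
  have hw : ∀ x i, (w x).1 (Fin.castLE hmn i) = y x i := by
    intro x i
    change (∑ i', Pi.single (Fin.castLE hmn i') (y x i') : Fin n → ZMod (𝒢.q k)) _ = _
    rw [Finset.sum_apply, Finset.sum_eq_single i]
    · simp
    · intro i' _ h
      exact Pi.single_eq_of_ne (fun h' => h (Fin.castLE_injective hmn h').symm) _
    · simp
  have e1 : value hmn r ρ Θ u₀ u₅ u₆ u₇ (fun _ _ K' i => K'.1 (Fin.castLE hmn i)) v₆ v₇ =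
      value hmn r ρ Θ u₀ u₅ u₆' u₇'
        (fun x _ K' i => K'.1 (Fin.castLE hmn i) + y x i) v₆ v₇ := by
    refine value_basis hmn r ρ Θ
      (fun i => addSlot 5 6 (by decide) (c i) * addSlot 5 7 (by decide) (d i))
      (fun β γ i j => ?_) fun x S i => ?_
    · rw [Units.val_mul, ← Matrix.vecMul_vecMul, vecMul_addSlot, vecMul_addSlot]
      funext s
      fin_cases s <;> simp [tokenSlots, h₆, h₇]
    · rw [Units.val_mul, ← Matrix.mulVec_mulVec, addSlot_mulVec, addSlot_mulVec]
      funext s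
      fin_cases s <;> simp [ctSlots, y]
      ring
  rw [e1]
  unfold value
  refine Finset.sum_congr rfl fun pp _ => congrArg _ ?_
  refine Eq.trans ?_ (game_perm hmn A _ r pp ρ Θ fun x =>
    (Equiv.refl _).prodCongr ((Equiv.addRight (w x)).prodCongr (Equiv.refl _)))
  congr 1
  funext x S i s
  fin_cases s <;> simp [ctSlots, hw]

/-- Slots 6 and 7 of the honest senders may be exchanged. -/
theorem value_swap (h₆ : ∀ i j, i.val < m → u₆' i j = u₇ i j)
    (h₇ : ∀ i j, i.val < m → u₇' i j = u₆ i j) (h₆' : ∀ i j, ¬ i.val < m → u₆' i j = u₆ i j)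
    (h₇' : ∀ i j, ¬ i.val < m → u₇' i j = u₇ i j) :
    value hmn r ρ Θ u₀ u₅ u₆ u₇ v₅ v₆ v₇ = value hmn r ρ Θ u₀ u₅ u₆' u₇' v₅ v₇ v₆ := by
  -- Three transvections and a sign realise the transposition: on $(w_6,w_7)$ they give
  -- $(w_6,w_6+w_7)$, $(-w_7,w_6+w_7)$, $(-w_7,w_6)$, $(w_7,w_6)$.
  refine value_basis hmn r ρ Θ (fun i => if i.val < m then addSlot 6 7 (by decide) 1 *
    addSlot 7 6 (by decide) (-1) * addSlot 6 7 (by decide) 1 * scaleSlot 6 (-1) else 1)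
    (fun β γ i j => ?_) fun x S i => ?_
  · by_cases hi : i.val < m
    · rw [if_pos hi]
      simp only [Units.val_mul, ← Matrix.vecMul_vecMul, vecMul_addSlot, vecMul_scaleSlot]
      funext s
      fin_cases s <;> simp [tokenSlots, h₆ i j hi, h₇ i j hi]
    · rw [if_neg hi]
      funext s
      fin_cases s <;> simp [tokenSlots, h₆' i j hi, h₇' i j hi]
  · rw [if_pos (by simp)]
    simp only [Units.val_mul, ← Matrix.mulVec_mulVec, addSlot_mulVec, scaleSlot_mulVec]
    funext s
    fin_cases s <;> simp [ctSlots]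

/-! ### Averages over the good `ρ` -/

theorem goodWeight_nonneg {q : ℕ} (ρ : Fin n → ZMod q) : 0 ≤ goodWeight m ρ := by
  unfold goodWeight; split_ifs <;> norm_num

theorem goodWeight_le_one {q : ℕ} (ρ : Fin n → ZMod q) : goodWeight m ρ ≤ 1 := by
  unfold goodWeight; split_ifs <;> norm_num

/-- The average over `ρ` without zeros among the honest columns. -/
def goodAvg {q n : ℕ} [Fact q.Prime] (m : ℕ) (f : (Fin n → ZMod q) → ℝ) : ℝ :=
  𝔼 ρ, goodWeight m ρ * f ρ

section Avg

variable {q : ℕ} [Fact q.Prime]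

theorem abs_goodAvg_sub_le {f g : (Fin n → ZMod q) → ℝ} {c : ℝ}
    (h : ∀ ρ, |f ρ - g ρ| ≤ c) : |goodAvg m f - goodAvg m g| ≤ c := by
  refine abs_expect_sub_le fun ρ => ?_
  rw [← mul_sub, abs_mul, abs_of_nonneg (goodWeight_nonneg ρ)]
  calc goodWeight m ρ * |f ρ - g ρ| ≤ 1 * c :=
        mul_le_mul (goodWeight_le_one ρ) (h ρ) (abs_nonneg _) zero_le_one
    _ = c := one_mul c

/-- This is where excluding zeros pays: exact identities between games may divide by the honest
entries of $\rho$. -/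
theorem goodAvg_congr {f g : (Fin n → ZMod q) → ℝ}
    (h : ∀ ρ, (∀ j : Fin n, j.val < m → ρ j ≠ 0) → f ρ = g ρ) : goodAvg m f = goodAvg m g := by
  refine Finset.expect_congr rfl fun ρ _ => ?_
  by_cases hρ : ∀ j : Fin n, j.val < m → ρ j ≠ 0
  · rw [h ρ hρ]
  · simp [goodWeight, hρ]

/-- A union bound: each of the $m$ honest entries of $\rho$ vanishes with probability $1/q$. -/
theorem abs_expect_sub_goodAvg_le (hmn : m ≤ n) {f : (Fin n → ZMod q) → ℝ} (h₀ : ∀ ρ, 0 ≤ f ρ)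
    (h₁ : ∀ ρ, f ρ ≤ 1) : |𝔼 ρ, f ρ - goodAvg m f| ≤ (m : ℝ) / q := by
  classical
  have hzero : ∀ j : Fin n, 𝔼 ρ : Fin n → ZMod q, (if ρ j = 0 then (1 : ℝ) else 0) = 1 / q := by
    intro j
    refine (expect_comp_surjective (Pi.evalAddMonoidHom (fun _ => ZMod q) j)
      (Function.surjective_eval j) fun a => if a = 0 then (1 : ℝ) else 0).trans ?_
    rw [Fintype.expect_eq_sum_div_card, Finset.sum_ite_eq', ZMod.card]
    simp
  unfold goodAvg
  rw [← expect_sub]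
  calc |𝔼 ρ, (f ρ - goodWeight m ρ * f ρ)|
      ≤ 𝔼 ρ : Fin n → ZMod q, ∑ j : Fin m, (if ρ (Fin.castLE hmn j) = 0 then (1 : ℝ) else 0) := by
        refine (Finset.abs_expect_le _ _).trans (expect_mono fun ρ => ?_)
        have hs : 0 ≤ ∑ j : Fin m, (if ρ (Fin.castLE hmn j) = 0 then (1 : ℝ) else 0) :=
          Finset.sum_nonneg fun j _ => by split_ifs <;> norm_num
        by_cases hρ : ∀ j : Fin n, j.val < m → ρ j ≠ 0
        · rw [goodWeight, if_pos hρ, one_mul, sub_self, abs_zero]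
          exact hs
        · simp only [goodWeight, hρ, if_false, zero_mul, sub_zero, abs_of_nonneg (h₀ ρ)]
          push Not at hρ
          obtain ⟨j, hj, hj0⟩ := hρ
          refine (h₁ ρ).trans ?_
          have := Finset.single_le_sum (f := fun j : Fin m =>
            (if ρ (Fin.castLE hmn j) = 0 then (1 : ℝ) else 0))
            (fun j _ => by split_ifs <;> norm_num) (Finset.mem_univ ⟨j, hj⟩)
          refine le_trans (le_of_eq ?_) this
          rw [if_pos]
          exact hj0
    _ = (m : ℝ) / q := by
        rw [Finset.expect_sum_comm]
        simp only [hzero, Finset.sum_const, Finset.card_univ, Fintype.card_fin, nsmul_eq_mul]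
        ring

end Avg

end

/-! ### The hybrid argument over the columns. -/

section

variable {𝒢 : GroupGenerator} {k n m Q : ℕ} {M sA : ℕ} {ε : ℝ} (hmn : m ≤ n)
  {A : ExpAdversary (𝒢.q k) (𝒢.len k) n m Q} (r : Fin A.coins → Bool)
  (Θ : Fin n → ZMod (𝒢.q k)) {u₆ u₇ : Fin n → Fin n → ZMod (𝒢.q k)}
  {v₆ v₇ : (Fin m → ZMod (𝒢.q k)) → Fin m → ZMod (𝒢.q k)}

/-! ### From one routing permutation to the other -/

/-- The loss of one game hop when XDLin adversaries have advantage at most `ε`. -/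
def hopLoss (q : ℕ) (ε : ℝ) : ℝ := ε / (1 - 1 / (q : ℝ)) ^ 3

/-- The loss of a game hop that changes the ciphertexts of the queries. -/
def queryLoss (q Q : ℕ) (ε : ℝ) : ℝ := if Q = 0 then 0 else hopLoss q ε

theorem le_hopLoss {q : ℕ} (hq : q.Prime) {x ε : ℝ} (h : x * (1 - 1 / (q : ℝ)) ^ 3 ≤ ε) :
    x ≤ hopLoss q ε := by
  have hq1 : (1 : ℝ) < q := by exact_mod_cast hq.one_lt
  have : 1 / (q : ℝ) < 1 := (div_lt_one (by linarith)).2 hq1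
  exact (le_div_iff₀ (pow_pos (by linarith) 3)).2 h

/-- Recording that the hop is free without queries matters in the final count: for $Q=0$ the bound
leaves room for only $m^2$ XDLin terms in the bracket. -/
theorem value_ciphertext_hop' (ρ : Fin n → ZMod (𝒢.q k)) (hM : GroupSize 𝒢 k M)
    (hε : XDLinBound 𝒢 k n m Q M sA ε) (hA : A.SizeLE sA)
    (h₇ : ∀ i j, i.val < m → u₇ i j = 0)
    (hv₆ : ∀ i, IsAffine fun x => v₆ x i) (hv₇ : ∀ i, IsAffine fun x => v₇ x i) :
    |value hmn r ρ Θ (fun _ j => ρ j) 0 u₆ u₇ 0 v₆ 0 -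
      value hmn r ρ Θ (fun _ j => ρ j) 0 u₆ u₇ 0 v₆ v₇| ≤ queryLoss (𝒢.q k) Q ε := by
  unfold queryLoss
  split_ifs with hQ
  · rw [value_of_no_query hmn r ρ Θ hQ (v₅' := 0) (v₆' := v₆) (v₇' := v₇), sub_self, abs_zero]
  · exact le_hopLoss (𝒢.prime k) (value_ciphertext_hop hmn r ρ Θ hM hε hA h₇ hv₆ hv₇)

/-- The average over the good `ρ` when column `l` is separated and has independent masks is close to
the one without column separation. -/
theorem goodAvg_separate (hM : GroupSize 𝒢 k M) (hε : XDLinBound 𝒢 k n m Q M sA ε)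
    (hA : A.SizeLE sA) (l : Fin n) (hv₆ : ∀ i, IsAffine fun x => v₆ x i)
    (hv₇ : ∀ i, IsAffine fun x => v₇ x i) :
    |goodAvg m (fun ρ => value hmn r ρ Θ (fun _ j => ρ j) 0 u₆ u₇ 0 v₆ v₇) -
      goodAvg m fun ρ => value hmn r ρ Θ (splitRest m l ρ) (splitColumn m l ρ) u₆ u₇
        (fun _ _ K' i => K'.1 (Fin.castLE hmn i)) v₆ v₇| ≤
      hopLoss (𝒢.q k) ε + queryLoss (𝒢.q k) Q ε := by
  -- A copy of column $l$ is created in slot 5, subtracted from slot 0 by an exact change of basis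
  -- (`value_split`), and then given masks of its own.
  have h1 := abs_goodAvg_sub_le (m := m) fun ρ => le_hopLoss (𝒢.prime k)
    (value_token_hop hmn r ρ Θ (u₀ := fun _ j => ρ j) (u₅ := splitColumn m l ρ) (u₆ := u₆)
      (u₇ := u₇) hM hε hA hv₆ hv₇)
  simp only [value_split] at h1
  refine (abs_sub_le _ _ _).trans (add_le_add h1 ?_)
  unfold queryLoss
  split_ifs with hQ
  · refine (abs_goodAvg_sub_le fun ρ => ?_)
    rw [value_of_no_query hmn r ρ Θ hQ (v₅' := fun _ _ K' i => K'.1 (Fin.castLE hmn i))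
      (v₆' := v₆) (v₇' := v₇), sub_self, abs_zero]
  · unfold goodAvg
    rw [← expect_sub]
    simp only [← mul_sub]
    exact le_hopLoss (𝒢.prime k) (value_mask_hop hmn r Θ hM hε hA l hv₆ hv₇)

variable (π : Equiv.Perm (Fin m))

/-- The permutation of all senders that extends a permutation of the honest ones. -/
abbrev extendPerm (hmn : m ≤ n) (π : Equiv.Perm (Fin m)) : Equiv.Perm (Fin n) :=
  π.viaFintypeEmbedding (Fin.castLEEmb hmn)

theorem extendPerm_castLE (i : Fin m) :
    extendPerm hmn π (Fin.castLE hmn i) = Fin.castLE hmn (π i) :=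
  Equiv.Perm.viaFintypeEmbedding_apply_image π (Fin.castLEEmb hmn) i

theorem extendPerm_of_le (j : Fin n) (hj : m ≤ j.val) : extendPerm hmn π j = j := by
  refine Equiv.Perm.viaFintypeEmbedding_apply_notMem_range π (Fin.castLEEmb hmn) ?_
  rintro ⟨i, rfl⟩
  simp at hj
  omega

/-- Slot 6 of the tokens when the columns below `l` route by the identity and the others by
`σ`. -/
def oldColumns (σ : Equiv.Perm (Fin n)) (l : ℕ) (i j : Fin n) : ZMod (𝒢.q k) :=
  if j = σ i ∧ l ≤ j.val then Θ j else 0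

/-- Slot 7 of the tokens when the columns below `l` route by the identity. -/
def newColumns (l : ℕ) (i j : Fin n) : ZMod (𝒢.q k) :=
  if j = i ∧ j.val < l then Θ j else 0

/-- The average success when the columns below `l` have been switched. -/
def stage (l : ℕ) : ℝ :=
  goodAvg m fun ρ => value hmn r ρ Θ (fun _ j => ρ j) 0 (oldColumns Θ (extendPerm hmn π) l)
    (newColumns Θ l) 0 (fun x => x) fun x i => x (π⁻¹ i)

/-- Switching a single column. -/
theorem abs_stage_succ_le (hM : GroupSize 𝒢 k M) (hε : XDLinBound 𝒢 k n m Q M sA ε)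
    (hA : A.SizeLE sA) (l : Fin m) :
    |stage hmn r Θ π l.val - stage hmn r Θ π (l.val + 1)| ≤
      2 * (hopLoss (𝒢.q k) ε + queryLoss (𝒢.q k) Q ε) := by
  classical
  -- The same column is separated before and after the switch, so the two separated games can be
  -- compared exactly.
  have h := fun l' => goodAvg_separate hmn r Θ (u₆ := oldColumns Θ (extendPerm hmn π) l')
    (u₇ := newColumns Θ l') hM hε hA (Fin.castLE hmn l) (v₆ := fun x => x)
    (v₇ := fun x i => x (π⁻¹ i)) (fun i => IsAffine.coord i) fun i => IsAffine.coord (π⁻¹ i)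
  have hmid := goodAvg_congr (m := m) (f := fun ρ => value hmn r ρ Θ
      (splitRest m (Fin.castLE hmn l) ρ) (splitColumn m (Fin.castLE hmn l) ρ)
      (oldColumns Θ (extendPerm hmn π) l.val) (newColumns Θ l.val)
      (fun _ _ K' i => K'.1 (Fin.castLE hmn i)) (fun x => x) fun x i => x (π⁻¹ i))
    (g := fun ρ => value hmn r ρ Θ
      (splitRest m (Fin.castLE hmn l) ρ) (splitColumn m (Fin.castLE hmn l) ρ)
      (oldColumns Θ (extendPerm hmn π) (l.val + 1)) (newColumns Θ (l.val + 1))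
      (fun _ _ K' i => K'.1 (Fin.castLE hmn i)) (fun x => x) fun x i => x (π⁻¹ i)) ?_
  · have h1 := h l.val
    have h2 := h (l.val + 1)
    rw [abs_sub_comm] at h2
    rw [hmid] at h1
    calc |stage hmn r Θ π l.val - stage hmn r Θ π (l.val + 1)| ≤ _ := abs_sub_le _ _ _
      _ ≤ _ := add_le_add h1 h2
      _ = _ := by ring
  · intro ρ hρ
    set L := Fin.castLE hmn l with hL
    have hρl : ρ L ≠ 0 := hρ L l.isLt
    have hLm : L.val < m := l.isLt
    have hval : ∀ j : Fin n, j ≠ L → (l.val ≤ j.val ↔ l.val + 1 ≤ j.val) := by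
      intro j hj
      have : j.val ≠ l.val := fun h' => hj (Fin.ext h')
      omega
    have hlow : ∀ i, L = extendPerm hmn π i → i.val < m := by
      intro i hi
      by_contra hi'
      rw [extendPerm_of_le hmn π i (not_lt.1 hi')] at hi
      omega
    -- Slot 5 of column $l$ contains $\rho_l$ in every honest row. The multiples
    -- $\pm\Theta_l/\rho_l$ therefore account for removing $\Theta_l$ from slot 6 of row
    -- $\pi^{-1}(l)$ and inserting it in slot 7 of row $l$.
    refine value_shift hmn r ρ Θ
      (fun i => if L = extendPerm hmn π i then Θ L / ρ L else 0)
      (fun i => if L = i then -(Θ L / ρ L) else 0) (fun i j => ?_) (fun i j => ?_) fun x => ?_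
    · by_cases hj : j = L
      · rw [hj]
        by_cases hi : L = extendPerm hmn π i
        · have e1 : oldColumns Θ (extendPerm hmn π) l.val i L = Θ L := if_pos ⟨hi, le_rfl⟩
          have e2 : oldColumns Θ (extendPerm hmn π) (l.val + 1) i L = 0 :=
            if_neg fun h => absurd h.2 (Nat.not_succ_le_self _)
          have e3 : splitColumn m L ρ i L = ρ L := if_pos ⟨hlow i hi, rfl⟩
          rw [e1, e2, e3, if_pos hi, zero_add, mul_div_cancel₀ _ hρl]
        · simp [oldColumns, hi]
      · simp [oldColumns, splitColumn, hj, hval j hj]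
    · by_cases hj : j = L
      · rw [hj]
        by_cases hi : L = i
        · have e1 : newColumns Θ l.val i L = 0 := if_neg fun h => lt_irrefl _ h.2
          have e2 : newColumns Θ (l.val + 1) i L = Θ L := if_pos ⟨hi, Nat.lt_succ_self _⟩
          have e3 : splitColumn m L ρ i L = ρ L := if_pos ⟨hi ▸ hLm, rfl⟩
          rw [e1, e2, e3, if_pos hi, mul_neg, mul_div_cancel₀ _ hρl, add_neg_cancel]
        · simp [newColumns, hi]
      · have : (j.val < l.val ↔ j.val < l.val + 1) := by
          have := hval j hj
          omega
        simp [newColumns, splitColumn, hj, this]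
    -- The two contributions are opposite multiples of $x_{\pi^{-1}(l)}$: slot 6 holds it in row
    -- $\pi^{-1}(l)$, slot 7 in row $l$.
    · have hc : ∀ i : Fin m, L = extendPerm hmn π (Fin.castLE hmn i) ↔ i = π⁻¹ l := by
        intro i
        rw [extendPerm_castLE, hL, (Fin.castLE_injective hmn).eq_iff, Equiv.Perm.eq_inv_iff_eq,
          eq_comm]
      have hd : ∀ i : Fin m, L = Fin.castLE hmn i ↔ i = l := by
        intro i
        rw [hL, (Fin.castLE_injective hmn).eq_iff, eq_comm]
      simp only [hc, hd, ite_mul, zero_mul, Finset.sum_add_distrib, Finset.sum_ite_eq',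
        Finset.mem_univ, if_true]
      ring

theorem abs_stage_zero_sub_le (hM : GroupSize 𝒢 k M) (hε : XDLinBound 𝒢 k n m Q M sA ε)
    (hA : A.SizeLE sA) : |stage hmn r Θ π 0 - stage hmn r Θ π m| ≤
      m * (2 * (hopLoss (𝒢.q k) ε + queryLoss (𝒢.q k) Q ε)) := by
  have h : ∀ l ≤ m, |stage hmn r Θ π 0 - stage hmn r Θ π l| ≤
      l * (2 * (hopLoss (𝒢.q k) ε + queryLoss (𝒢.q k) Q ε)) := by
    intro l
    induction l with
    | zero => simp
    | succ l ih =>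
      intro hl
      refine (abs_sub_le _ (stage hmn r Θ π l) _).trans ?_
      have := add_le_add (ih (by omega)) (abs_stage_succ_le hmn r Θ π hM hε hA ⟨l, hl⟩)
      push_cast
      linarith
  exact h m le_rfl

/-- The success when the tokens route by `σ` and sender `i` encrypts `v x i`. -/
def world (σ : Equiv.Perm (Fin n)) (v : (Fin m → ZMod (𝒢.q k)) → Fin m → ZMod (𝒢.q k)) : ℝ :=
  𝔼 ρ, value hmn r ρ Θ (fun _ j => ρ j) 0 (fun i j => if j = σ i then Θ j else 0) 0 0 v 0

/-- Routing by `π` cannot be told from routing permuted messages by the identity. -/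
theorem abs_world_sub_le (hM : GroupSize 𝒢 k M) (hε : XDLinBound 𝒢 k n m Q M sA ε)
    (hA : A.SizeLE sA) :
    |world hmn r Θ (extendPerm hmn π) (fun x => x) - world hmn r Θ 1 fun x i => x (π⁻¹ i)| ≤
      2 * ((m : ℝ) / 𝒢.q k) + 2 * queryLoss (𝒢.q k) Q ε +
        m * (2 * (hopLoss (𝒢.q k) ε + queryLoss (𝒢.q k) Q ε)) := by
  have a1 := abs_expect_sub_goodAvg_le hmn (f := fun ρ => value hmn r ρ Θ (fun _ j => ρ j) 0
    (fun i j => if j = extendPerm hmn π i then Θ j else 0) 0 0 (fun x => x) 0)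
    (fun ρ => value_nonneg hmn r ρ Θ) fun ρ => value_le_one hmn r ρ Θ
  -- Slot 7 of all tokens is still empty, so the permuted messages can be placed there. The same
  -- argument from the other end, in `b2`, places the unpermuted ones.
  have a2 := abs_goodAvg_sub_le (m := m) fun ρ => value_ciphertext_hop' hmn r Θ ρ
    (u₆ := fun i j => if j = extendPerm hmn π i then Θ j else 0) (u₇ := 0)
    (v₆ := fun x => x) (v₇ := fun x i => x (π⁻¹ i)) hM hε hA (fun _ _ _ => rfl)
    (fun i => IsAffine.coord i) fun i => IsAffine.coord (π⁻¹ i)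
  have a3 := abs_stage_zero_sub_le hmn r Θ π hM hε hA
  have b1 := abs_expect_sub_goodAvg_le hmn (f := fun ρ => value hmn r ρ Θ (fun _ j => ρ j) 0
    (fun i j => if j = (1 : Equiv.Perm (Fin n)) i then Θ j else 0) 0 0 (fun x i => x (π⁻¹ i)) 0)
    (fun ρ => value_nonneg hmn r ρ Θ) fun ρ => value_le_one hmn r ρ Θ
  have b2 := abs_goodAvg_sub_le (m := m) fun ρ => value_ciphertext_hop' hmn r Θ ρ
    (u₆ := fun i j => if j = (1 : Equiv.Perm (Fin n)) i then Θ j else 0) (u₇ := 0)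
    (v₆ := fun x i => x (π⁻¹ i)) (v₇ := fun x => x) hM hε hA (fun _ _ _ => rfl)
    (fun i => IsAffine.coord (π⁻¹ i)) fun i => IsAffine.coord i
  have first : stage hmn r Θ π 0 = goodAvg m fun ρ => value hmn r ρ Θ (fun _ j => ρ j) 0
      (fun i j => if j = extendPerm hmn π i then Θ j else 0) 0 0 (fun x => x)
        fun x i => x (π⁻¹ i) := by
    have e1 : oldColumns Θ (extendPerm hmn π) 0 =
        fun i j => if j = extendPerm hmn π i then Θ j else 0 := by
      funext i j
      simp [oldColumns]
    have e2 : newColumns (𝒢 := 𝒢) (k := k) Θ 0 = 0 := by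
      funext i j
      simp [newColumns]
    unfold stage
    rw [e1, e2]
  -- After stage $m$ honest tokens use slot 7 only, routed by the identity. The remaining tokens
  -- keep slot 6; they are fixed by the extended permutation, so both worlds agree on them.
  have last : stage hmn r Θ π m = goodAvg m fun ρ => value hmn r ρ Θ (fun _ j => ρ j) 0
      (fun i j => if j = (1 : Equiv.Perm (Fin n)) i then Θ j else 0) 0 0
        (fun x i => x (π⁻¹ i)) fun x => x := by
    have hσ : ∀ i j : Fin n, i.val < m → ¬ (j = extendPerm hmn π i ∧ m ≤ j.val) := by
      rintro i j hi ⟨rfl, h⟩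
      have := extendPerm_castLE hmn π ⟨i, hi⟩
      change extendPerm hmn π i = _ at this
      rw [this] at h
      exact absurd h (by simp)
    refine goodAvg_congr fun ρ _ => value_swap hmn r ρ Θ (fun i j hi => ?_) (fun i j hi => ?_)
      (fun i j hi => ?_) fun i j hi => ?_
    · simp only [newColumns, Equiv.Perm.one_apply]
      refine if_congr ⟨fun h => ⟨h, h ▸ hi⟩, And.left⟩ rfl rfl
    · rw [oldColumns, if_neg (hσ i j hi)]
      rfl
    · simp only [oldColumns, Equiv.Perm.one_apply, extendPerm_of_le hmn π i (not_lt.1 hi)]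
      refine if_congr ⟨fun h => ⟨h, h ▸ not_lt.1 hi⟩, And.left⟩ rfl rfl
    · rw [newColumns, if_neg]
      · rfl
      · rintro ⟨rfl, h⟩
        exact hi h
  rw [first, last] at a3
  rw [abs_le] at *
  unfold world
  constructor <;> linarith [a1.1, a1.2, a2.1, a2.2, a3.1, a3.2, b1.1, b1.2, b2.1, b2.2]

end

section

/-! ### Simulation from the correlated pseudorandom function -/

section CPRF

variable {q k n κ Q : ℕ}

/-- The CPRF adversary that corrupts nobody and asks for the periods `1, …, Q`. -/
def cprfGuesser (hn : 2 ≤ n) (g : (CPRFWire 0 n κ Q q.size → Bool) → Bool) :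
    CPRFAdversary q k n κ where
  coins := 0
  rounds := Q
  corrupt _ := ∅
  corrupt_card _ := by simpa using hn
  query t _ := period k (t.val + 1)
  guess := g

theorem cprfGuesser_sizeLE (hn : 2 ≤ n) {g : (CPRFWire 0 n κ Q q.size → Bool) → Bool} {s : ℕ}
    (hg : HasCircuit s fun w (_ : Unit) => g w) :
    (cprfGuesser (k := k) hn g).SizeLE (Q + s) := by
  refine ⟨Nat.zero_le _, Nat.le_add_right _ _, ?_, fun t => ?_, hg.mono (Nat.le_add_left _ _)⟩
  · have := hasCircuit_const (ι := Fin (cprfGuesser (k := k) hn g).coins) (κ := Fin n) (Q + s) false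
    simpa [cprfGuesser] using this
  · exact ⟨0, Nat.zero_le _, _, .start, fun o => Or.inr ⟨_, rfl⟩⟩

/-- Among the adversaries that corrupt nobody and ask for the periods `1, …, Q` there is a best
one. -/
theorem exists_best_cprf {q : ℕ → ℕ} (F : FunFamily q) (k n Q s : ℕ) [Fact (q k).Prime]
    (hn : 2 ≤ n) : ∃ B : CPRFAdversary (q k) k n (F.keyLen k), B.SizeLE (Q + s) ∧
      ∀ g : (CPRFWire 0 n (F.keyLen k) Q (q k).size → Bool) → Bool,
        (HasCircuit s fun w (_ : Unit) => g w) →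
          cprfAdv F k n (cprfGuesser hn g) ≤ cprfAdv F k n B := by
  let C := {g : (CPRFWire 0 n (F.keyLen k) Q (q k).size → Bool) → Bool //
    HasCircuit s fun w (_ : Unit) => g w}
  have : Nonempty C := ⟨⟨fun _ => false, hasCircuit_const s false⟩⟩
  obtain ⟨g, hg⟩ := Finite.exists_max fun g : C => cprfAdv F k n (cprfGuesser hn g.1)
  exact ⟨cprfGuesser hn g.1, cprfGuesser_sizeLE hn g.2, fun g' h => hg ⟨g', h⟩⟩

/-- What the adversary sees when the answers are `S`. -/
def maskView (S : Fin Q → ZeroSum q n) : CPRFWire 0 n κ Q q.size → Bool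
  | .coin l => l.elim0
  | .key _ _ _ => false
  | .ans t i l => bitsOf ((S t).1 i) l

theorem cprfGuesser_play (hn : 2 ≤ n) (g : (CPRFWire 0 n κ Q q.size → Bool) → Bool)
    (r : Fin (cprfGuesser (k := k) hn g).coins → Bool) (key : Fin n → Fin n → Fin κ → Bool)
    (V : (Fin k → Bool) → Fin n → ZMod q) (S : Fin Q → ZeroSum q n)
    (hS : ∀ t, (S t).1 = V (period k (t.val + 1))) :
    (cprfGuesser hn g).play r key V = g (maskView S) := by
  unfold CPRFAdversary.play
  change g _ = g _
  congr 1
  funext w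
  cases w with
  | coin l => exact Fin.elim0 l
  | key i j l => simp [cprfView, maskView, cprfGuesser]
  | ans t i l =>
    have := congrFun (interact_const (N := Q) (X := Fin k → Bool)
      (Y := Fin n → Fin q.size → Bool) (fun _ _ => false)
      (fun _ s i => bitsOf (V s i)) fun t => period k (t.val + 1)) t
    have hc : decide (i ∉ (cprfGuesser (k := k) hn g).corrupt r) = true := by
      simp [cprfGuesser]
    change (decide (i ∉ (cprfGuesser (k := k) hn g).corrupt r) && _) = bitsOf ((S t).1 i) l
    rw [hc, Bool.true_and]
    refine (congrFun (congrFun this i) l).trans ?_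
    exact congrArg (fun V' : Fin n → ZMod q => bitsOf (V' i) l) (hS t).symm

/-- The values of the CPRF in the periods `1, …, Q`. -/
def cprfMasks (f : (Fin κ → Bool) → (Fin k → Bool) → ZMod q) (key : Fin n → Fin n → Fin κ → Bool)
    (t : Fin Q) : ZeroSum q n :=
  ⟨fun i => cprf f key i (period k (t.val + 1)), sum_cprf f key _⟩

theorem period_injective {s t : ℕ} (hs : s < 2 ^ k) (ht : t < 2 ^ k)
    (h : period k s = period k t) : s = t := by
  refine Nat.eq_of_testBit_eq fun l => ?_
  by_cases hl : l < k
  · exact congrFun h ⟨l, hl⟩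
  · have hk : 2 ^ k ≤ 2 ^ l := Nat.pow_le_pow_right (by norm_num) (not_lt.1 hl)
    rw [Nat.testBit_lt_two_pow (hs.trans_le hk), Nat.testBit_lt_two_pow (ht.trans_le hk)]

/-- When nobody is corrupted, the values of the ideal functionality are uniform. -/
theorem expect_tables [Fact q.Prime] (hQ : Q < 2 ^ k)
    (f : (Fin κ → Bool) → (Fin k → Bool) → ZMod q) (key : Fin n → Fin n → Fin κ → Bool)
    (h : (Fin Q → ZeroSum q n) → ℝ) :
    𝔼 d : Tables f ∅ key, h (fun t => ⟨d.1 (period k (t.val + 1)), (d.2 _).2⟩) =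
      𝔼 S, h S := by
  classical
  let e : Tables f ∅ key ≃ ((Fin k → Bool) → ZeroSum q n) :=
    { toFun := fun d t => ⟨d.1 t, (d.2 t).2⟩
      invFun := fun D => ⟨fun t => (D t).1, fun t => ⟨by simp, (D t).2⟩⟩
      left_inv := fun _ => rfl
      right_inv := fun _ => rfl }
  let φ : ((Fin k → Bool) → ZeroSum q n) →+ (Fin Q → ZeroSum q n) :=
    { toFun := fun D t => D (period k (t.val + 1))
      map_zero' := rfl
      map_add' := fun _ _ => rfl }
  have hφ : Function.Surjective φ := by
    refine Function.Injective.surjective_comp_right (f := fun t : Fin Q => period k (t.val + 1)) ?_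
    intro s t hst
    have := period_injective (by omega) (by omega) hst
    exact Fin.ext (by omega)
  rw [← expect_comp_surjective φ hφ h]
  exact Fintype.expect_equiv e _ _ fun d => rfl

end CPRF

/-- Every adversary that corrupts nobody, asks for the periods `1, …, Q` and guesses by a circuit of
size `s` has CPRF advantage at most `ε`. -/
def CPRFBound {q : ℕ → ℕ} (F : FunFamily q) (k n Q s : ℕ) [Fact (q k).Prime] (ε : ℝ) : Prop :=
  ∀ g : (CPRFWire 0 n (F.keyLen k) Q (q k).size → Bool) → Bool,
    (HasCircuit s fun w (_ : Unit) => g w) → ∀ hn : 2 ≤ n, cprfAdv F k n (cprfGuesser hn g) ≤ ε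

/-- The values of all senders in one period form a vector with zero sum, so an adversary that
corrupts nobody sees CPRF masks in one experiment and uniform zero-sum masks in the other. Period 0
is never needed. -/
theorem cprf_bound {q : ℕ → ℕ} {F : FunFamily q} {k n Q s : ℕ} [Fact (q k).Prime] {ε : ℝ}
    (hε : CPRFBound F k n Q s ε) (hn : 2 ≤ n) (hQ : Q < 2 ^ k)
    {H : (Fin Q → ZeroSum (q k) n) → Bool}
    (hH : Computes (maskView (κ := F.keyLen k)) s fun S (_ : Unit) => H S) :
    |𝔼 key : Fin n → Fin n → Fin (F.keyLen k) → Bool, ind (H (cprfMasks (F.eval k) key)) -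
      𝔼 S, ind (H S)| ≤ ε := by
  obtain ⟨f, hf, hfH⟩ := hH
  have hfH' : ∀ S, f (maskView S) () = H S := fun S => congrFun (hfH S) ()
  refine le_trans (le_of_eq ?_) (hε (fun w => f w ()) hf hn)
  unfold cprfAdv cprfExp
  simp only [prOne_uniform_bind, prOne_pure]
  congr 2
  · refine ((Finset.expect_congr rfl fun r _ => ?_).trans (Fintype.expect_const _)).symm
    refine Finset.expect_congr rfl fun key _ => ?_
    refine (Finset.expect_congr rfl fun d _ => ?_).trans (Fintype.expect_const _)
    rw [← hfH']
    congr 1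
    exact cprfGuesser_play hn _ r key _ _ fun t => rfl
  · refine ((Finset.expect_congr rfl fun r _ => ?_).trans (Fintype.expect_const _)).symm
    refine (Finset.expect_congr rfl fun key _ => ?_).trans (Fintype.expect_const _)
    rw [← expect_tables hQ (F.eval k) key fun S => ind (H S)]
    refine Finset.expect_congr rfl fun d _ => ?_
    rw [← hfH']
    congr 1
    exact cprfGuesser_play hn _ r key _ _ fun t => rfl

/-- Gates for the masks in the exponent. -/
def costMask (M L : ℕ) : ℕ := costForm M L 1 1 (costOne M L)

/-- Gates for a simulation of the protocol from the masks. -/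
def costMaskSim (M L n m Q sA : ℕ) : ℕ := costRun M L n m Q (Q * n + 1) (costMask M L) 0 sA

/-- Parameters, bases, tokens and noise are fixed and can be wired in, at no cost in gates. Only the
masks vary; they arrive as bits, hence each is first raised into the exponent and then used as a
base of the linear forms. -/
theorem computes_mask_sim {𝒢 : GroupGenerator} {k n m Q κ : ℕ} {M sA : ℕ} (hmn : m ≤ n)
    (hM : GroupSize 𝒢 k M) {A : ExpAdversary (𝒢.q k) (𝒢.len k) n m Q} (hA : A.SizeLE sA)
    (r : Fin A.coins → Bool) {pp : Fin (𝒢.len k) → Bool} (hpp : pp ∈ (𝒢.gen k).support)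
    (ρ Θ : Fin n → ZMod (𝒢.q k)) (T : Fin n → Fin n → Fin 8 → ZMod (𝒢.q k))
    (U : Fin m → Matrix (Fin 8) (Fin 8) (ZMod (𝒢.q k)))
    {v : (Fin m → ZMod (𝒢.q k)) → Fin m → ZMod (𝒢.q k)} (hv : ∀ i, IsAffine fun x => v x i)
    (a a' : Fin Q → Fin m → ZMod (𝒢.q k)) :
    Computes (maskView (κ := κ)) (costMaskSim M (𝒢.len k) n m Q sA)
      fun (S : Fin Q → ZeroSum (𝒢.q k) n) (_ : Unit) =>
        run A (𝒢.group k pp) r pp ρ T Θ fun t x i =>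
          U i *ᵥ ![(S t).1 (Fin.castLE hmn i), a t i, a' t i, 0, 0, 0, v x i, 0] := by
  set G := 𝒢.group k pp
  let P := Fin Q → ZeroSum (𝒢.q k) n
  have hG := hM P (fun _ => pp) fun _ => hpp
  have hpp' : Computes (maskView (q := 𝒢.q k) (n := n) (κ := κ) (Q := Q)) 0 fun _ => pp := .const pp
  have hq := BilinearGroup.lt_two_pow G
  have h1 := hG.one₁ hpp' hq
  have hg : ComputesElt (fun _ : P => G.G₁) (fun _ => G.enc₁) (maskView (κ := κ))
      (costOne M (𝒢.len k)) fun _ => G.in₁ 1 := by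
    exact (Computes.const _).mono (Nat.zero_le _)
  let ν : P → Option (Fin Q × Fin n) → ZMod (𝒢.q k) := fun S o =>
    o.elim 1 fun o => (S o.1).1 o.2
  have hν : ∀ o, ComputesElt (fun _ : P => G.G₁) (fun _ => G.enc₁) (maskView (κ := κ))
      (costMask M (𝒢.len k)) fun S => G.in₁ (ν S o) := by
    rintro (_ | ⟨t, i⟩)
    · exact (Computes.const (G.enc₁ (G.in₁ 1))).mono (Nat.zero_le _)
    · have hform : LinForm (fun (_ : P) (_ : Unit) => (1 : ZMod (𝒢.q k)))
          fun _ (x : Unit → ZMod (𝒢.q k)) => x () := by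
        simpa using LinForm.coord (ν := fun (_ : P) (_ : Unit) => (1 : ZMod (𝒢.q k))) ()
          (IsAffine.coord (q := 𝒢.q k) ())
      have := computes_linForm (φ := fun _ : P => G.in₁) hG.mul₁ hpp' hq
        (fun p => (G.in₁_eq_one_iff 0).2 rfl) (fun p => G.in₁_add) h1 (fun _ => hg) hform
        (b := fun S o => bitsOf ((S t).1 i) o.2)
        (Computes.input (view := maskView (κ := κ)) fun o : Unit × Fin (𝒢.q k).size =>
          CPRFWire.ans t i o.2)
      simp only [Fintype.card_unit] at this
      refine this.congr fun S => ?_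
      simp only [ν, Option.elim]
      rw [show (fun l => bitsOf ((S t).1 i) l) = bitsOf ((S t).1 i) from rfl, ofBits_bitsOf]
  have hconst : ∀ {f : (Fin m → ZMod (𝒢.q k)) → ZMod (𝒢.q k)}, IsAffine f →
      LinForm ν fun _ x => f x := by
    intro f hf
    simpa [ν] using LinForm.coord (ν := ν) none hf
  have hmask : ∀ t (i : Fin m), LinForm ν fun S (_ : Fin m → ZMod (𝒢.q k)) =>
      (S t).1 (Fin.castLE hmn i) := by
    intro t i
    simpa [ν] using LinForm.coord (ν := ν) (some (t, Fin.castLE hmn i))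
      (IsAffine.const (J := Fin m) (1 : ZMod (𝒢.q k)))
  have := computes_run (ρ := fun _ => ρ) (T := fun _ => T) (s₂ := 0) hA hG hpp' hq r Θ
    (fun j => .const _) (fun i j s => .const _) hν
    (c := fun S t x i => U i *ᵥ ![(S t).1 (Fin.castLE hmn i), a t i, a' t i, 0, 0, 0, v x i, 0])
    fun t i s => LinForm.mulVec (fun s => .vec (hmask t i) (hconst (.const _)) (hconst (.const _))
      .zero .zero .zero (hconst (hv i)) .zero s) _ s
  simpa [costMaskSim] using this

end

section

/-! ### The experiments as averages -/

/-- The pairing of one token with one ciphertext is the inner product of their slots, namely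
$\rho_jK_i$ plus $\theta_i$ when $j=\sigma(i)$: the noise slots of either side meet zeros of the
other. Summation over $i$ removes the first term. -/
theorem route_eq {q L n : ℕ} [Fact q.Prime] (G : BilinearGroup q L)
    (R : Fin n → GL (Fin 8) (ZMod q)) (θ : Fin n → (ZMod q)ˣ) (ρ : Fin n → ZMod q)
    (β γ : Fin n → Fin n → ZMod q) (σ : Equiv.Perm (Fin n)) {K : Fin n → ZMod q}
    (hK : ∑ i, K i = 0) (α α' : Fin n → ZMod q) :
    route G (token G R θ ρ β γ σ) (fun i => ciphertext G (R i)⁻¹ (K i) (α i) (α' i) 1) =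
      fun j => G.gT ^ (θ (σ⁻¹ j) : ZMod q).val := by
  funext j
  unfold route token ciphertext
  simp only [BilinearGroup.pair_in, BilinearGroup.prod_gT_pow]
  congr 2
  have h : ∀ i, ∑ s, ((((R i)⁻¹ : GL (Fin 8) (ZMod q)) : Matrix (Fin 8) (Fin 8) (ZMod q)) *ᵥ
      ![K i, α i, α' i, 0, 0, 0, 1, 0]) s *
        (![ρ j, 0, 0, β i j, γ i j, 0, if j = σ i then (θ i : ZMod q) else 0, 0] ᵥ*
          (R i : Matrix (Fin 8) (Fin 8) (ZMod q))) s =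
        ρ j * K i + if j = σ i then (θ i : ZMod q) else 0 := by
    intro i
    have h1 : (![ρ j, 0, 0, β i j, γ i j, 0, if j = σ i then (θ i : ZMod q) else 0, 0] ᵥ*
          (R i : Matrix (Fin 8) (Fin 8) (ZMod q))) ⬝ᵥ
        ((((R i)⁻¹ : GL (Fin 8) (ZMod q)) : Matrix (Fin 8) (Fin 8) (ZMod q)) *ᵥ
          ![K i, α i, α' i, 0, 0, 0, 1, 0]) =
        ![ρ j, 0, 0, β i j, γ i j, 0, if j = σ i then (θ i : ZMod q) else 0, 0] ⬝ᵥ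
          ![K i, α i, α' i, 0, 0, 0, 1, 0] := by
      rw [← Matrix.dotProduct_mulVec, Matrix.mulVec_mulVec, ← Units.val_mul, mul_inv_cancel,
        Units.val_one, Matrix.one_mulVec]
    rw [dotProduct_comm] at h1
    refine h1.trans ?_
    simp [dotProduct, Fin.sum_univ_succ]
  simp only [h, Finset.sum_add_distrib, ← Finset.mul_sum, hK, mul_zero, zero_add]
  rw [Finset.sum_eq_single (σ⁻¹ j)]
  · simp
  · intro i _ hi
    rw [if_neg]
    rintro rfl
    simp at hi
  · simp

variable {𝒢 : GroupGenerator} {k n m Q : ℕ} {M sA : ℕ} (hmn : m ≤ n)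
  {A : ExpAdversary (𝒢.q k) (𝒢.len k) n m Q} (r : Fin A.coins → Bool)

/-- The adversary's output when the masks of the queries are `S` and their noise is `a`, `a'`. -/
def masked (pp : Fin (𝒢.len k) → Bool) (σ : Equiv.Perm (Fin n))
    (v : (Fin m → ZMod (𝒢.q k)) → Fin m → ZMod (𝒢.q k)) (Θ : Fin n → ZMod (𝒢.q k))
    (R : Fin n → GL (Fin 8) (ZMod (𝒢.q k))) (ρ : Fin n → ZMod (𝒢.q k))
    (β γ : Fin n → Fin n → ZMod (𝒢.q k)) (a a' : Fin Q → Fin m → ZMod (𝒢.q k))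
    (S : Fin Q → ZeroSum (𝒢.q k) n) : Bool :=
  run A (𝒢.group k pp) r pp ρ (fun i j => tokenSlots (fun _ j => ρ j) 0
      (fun i j => if j = σ i then Θ j else 0) 0 β γ i j ᵥ*
        (R i : Matrix (Fin 8) (Fin 8) (ZMod (𝒢.q k)))) Θ
    fun t x i => (((R (Fin.castLE hmn i))⁻¹ : GL (Fin 8) (ZMod (𝒢.q k))) :
      Matrix (Fin 8) (Fin 8) (ZMod (𝒢.q k))) *ᵥ
        ![(S t).1 (Fin.castLE hmn i), a t i, a' t i, 0, 0, 0, v x i, 0]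

/-- The routing permutation of `Exp⁽ᵇ⁾`. -/
def worldPerm (b : Bool) (π : Equiv.Perm (Fin m)) : Equiv.Perm (Fin n) :=
  if b then 1 else extendPerm hmn π

/-- The encrypted messages in `Exp⁽ᵇ⁾`. -/
def worldMessage {q : ℕ} (b : Bool) (π : Equiv.Perm (Fin m)) (x : Fin m → ZMod q) (i : Fin m) :
    ZMod q :=
  if b then x (π⁻¹ i) else x i

/-- Only the noise of honest senders in periods from 1 on reaches the adversary, so the other
coordinates can be averaged out. -/
theorem expect_restrict {q : ℕ} [Fact q.Prime] (f : (Fin Q → Fin m → ZMod q) → ℝ) :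
    𝔼 α : Fin n → Fin (Q + 1) → ZMod q, f (fun t i => α (Fin.castLE hmn i) t.succ) = 𝔼 a, f a := by
  let φ : (Fin n → Fin (Q + 1) → ZMod q) →+ (Fin Q → Fin m → ZMod q) :=
    { toFun := fun α t i => α (Fin.castLE hmn i) t.succ
      map_zero' := rfl
      map_add' := fun _ _ => rfl }
  refine expect_comp_surjective φ (fun a => ?_) f
  refine ⟨fun j t => if h : j.val < m ∧ t.val ≠ 0 then a (t.pred fun h' => h.2 (by simp [h']))
    ⟨j, h.1⟩ else 0, ?_⟩
  funext t i
  simp [φ]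

theorem prOne_protocolExp (F : FunFamily 𝒢.q) (b : Bool) :
    prOne (protocolExp 𝒢 F k hmn A b) = 𝔼 r, ∑ pp, (𝒢.gen k pp).toReal *
      𝔼 key : Fin n → Fin n → Fin (F.keyLen k) → Bool, 𝔼 θ : Fin n → (ZMod (𝒢.q k))ˣ, 𝔼 R, 𝔼 ρ,
        𝔼 β, 𝔼 γ, 𝔼 a, 𝔼 a', ind (masked hmn r pp (worldPerm hmn b (A.perm r))
          (worldMessage b (A.perm r)) (fun j => (θ j : ZMod (𝒢.q k))) R ρ β γ a a'
          (cprfMasks (F.eval k) key)) := by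
  unfold protocolExp
  rw [prOne_uniform_bind]
  refine Finset.expect_congr rfl fun r _ => ?_
  rw [prOne_bind]
  refine Finset.sum_congr rfl fun pp _ => congrArg _ ?_
  rw [prOne_uniform_bind]
  refine Finset.expect_congr rfl fun key _ => ?_
  rw [prOne_uniform_bind]
  -- Relabels $\theta$ by the routing permutation, so that from here on it is indexed by columns and
  -- the initial output is the same in both experiments.
  refine Eq.trans ?_ (expect_perm (Equiv.arrowCongr (worldPerm hmn b (A.perm r)) (Equiv.refl _)) _)
  refine Finset.expect_congr rfl fun θ _ => ?_
  simp only [prOne_uniform_bind, prOne_pure]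
  refine Finset.expect_congr rfl fun R _ => Finset.expect_congr rfl fun ρ _ =>
    Finset.expect_congr rfl fun β _ => Finset.expect_congr rfl fun γ _ => ?_
  refine Eq.trans ?_ (expect_restrict hmn _)
  refine Finset.expect_congr rfl fun α _ => ?_
  refine Eq.trans ?_ (expect_restrict hmn _)
  refine Finset.expect_congr rfl fun α' _ => ?_
  rw [route_eq _ _ _ _ _ _ _ (sum_cprf (F.eval k) key _)]
  have htk : token (𝒢.group k pp) R θ ρ β γ (worldPerm hmn b (A.perm r)) = fun i j s =>
      (𝒢.group k pp).in₂ ((tokenSlots (fun _ j => ρ j) 0 (fun i j =>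
        if j = worldPerm hmn b (A.perm r) i then ((Equiv.arrowCongr (worldPerm hmn b (A.perm r))
          (Equiv.refl (ZMod (𝒢.q k))ˣ) θ j : (ZMod (𝒢.q k))ˣ) : ZMod (𝒢.q k)) else 0) 0 β γ i j ᵥ*
        (R i : Matrix (Fin 8) (Fin 8) (ZMod (𝒢.q k)))) s) := by
    funext i j s
    unfold token
    congr 3
    funext s
    fin_cases s <;> simp
    split_ifs with hj
    · rw [hj, Equiv.symm_apply_apply]
    · rfl
  change ind (A.guess (expView (𝒢.group k pp) r pp ρ
    (token (𝒢.group k pp) R θ ρ β γ (worldPerm hmn b (A.perm r))) _ (interact _ (fun t z i =>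
      ofBits fun l => A.query t (expView (𝒢.group k pp) r pp ρ
        (token (𝒢.group k pp) R θ ρ β γ (worldPerm hmn b (A.perm r))) _ z) (i, l)) _))) = _
  rw [htk]
  rfl

/-- Moves the average over the keys inside the other draws one at a time, until the CPRF reduction
applies with everything else fixed. -/
theorem abs_expect_comm_sub_le {X Ω : Type} [Fintype X] [Fintype Ω] [Nonempty Ω]
    {f : X → Ω → ℝ} {g : Ω → ℝ} {c : ℝ} (h : ∀ ω, |𝔼 x, f x ω - g ω| ≤ c) :
    |𝔼 x, 𝔼 ω, f x ω - 𝔼 ω, g ω| ≤ c := by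
  rw [Finset.expect_comm]
  exact abs_expect_sub_le h

/-- With uniform masks the experiment becomes a game. -/
theorem expect_masked (pp : Fin (𝒢.len k) → Bool) (σ : Equiv.Perm (Fin n))
    (v : (Fin m → ZMod (𝒢.q k)) → Fin m → ZMod (𝒢.q k)) (Θ : Fin n → ZMod (𝒢.q k)) :
    𝔼 R, 𝔼 ρ, 𝔼 β, 𝔼 γ, 𝔼 a, 𝔼 a', 𝔼 S, ind (masked (Q := Q) hmn r pp σ v Θ R ρ β γ a a' S) =
      𝔼 ρ, game hmn A (𝒢.group k pp) r pp ρ Θ (tokenSlots (fun _ j => ρ j) 0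
        (fun i j => if j = σ i then Θ j else 0) 0) (ctSlots hmn 0 v 0) := by
  rw [Finset.expect_comm]
  refine Finset.expect_congr rfl fun ρ _ => ?_
  unfold game
  rw [Finset.expect_comm]
  refine Finset.expect_congr rfl fun β _ => ?_
  rw [Finset.expect_comm]
  refine Finset.expect_congr rfl fun γ _ => ?_
  rw [Finset.expect_comm (s := (Finset.univ : Finset (Fin Q → Coins (𝒢.q k) n m)))]
  refine Finset.expect_congr rfl fun R _ => ?_
  -- The coins of a game include a second vector of masks, which plays no role at this end and is
  -- projected away.
  let φ : (Fin Q → Coins (𝒢.q k) n m) →+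
      (Fin Q → Fin m → ZMod (𝒢.q k)) × (Fin Q → Fin m → ZMod (𝒢.q k)) ×
        (Fin Q → ZeroSum (𝒢.q k) n) :=
    { toFun := fun S => (fun t => (S t).2.2.1, fun t => (S t).2.2.2, fun t => (S t).1)
      map_zero' := rfl
      map_add' := fun _ _ => rfl }
  have hφ : Function.Surjective φ := fun y => ⟨fun t => (y.2.2 t, 0, y.1 t, y.2.1 t), rfl⟩
  have h := expect_comp_surjective φ hφ fun y =>
    ind (masked hmn r pp σ v Θ R ρ β γ y.1 y.2.1 y.2.2)
  refine Eq.trans ?_ (h.symm.trans ?_)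
  · refine Eq.symm ((expect_prod _).trans (Finset.expect_congr rfl fun a _ => ?_))
    exact expect_prod _
  · refine Finset.expect_congr rfl fun S _ => congrArg ind ?_
    unfold masked
    congr 1

/-- Replacing the CPRF by uniform masks. -/
theorem abs_prOne_protocolExp_sub_le {F : FunFamily 𝒢.q} {ε : ℝ} (hM : GroupSize 𝒢 k M)
    (hA : A.SizeLE sA) (hn : 2 ≤ n) (hQ : Q < 2 ^ k)
    (hε : CPRFBound F k n Q (costMaskSim M (𝒢.len k) n m Q sA) ε) (b : Bool) :
    |prOne (protocolExp 𝒢 F k hmn A b) - 𝔼 r, 𝔼 θ : Fin n → (ZMod (𝒢.q k))ˣ,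
      world hmn r (fun j => (θ j : ZMod (𝒢.q k))) (worldPerm hmn b (A.perm r))
        (worldMessage b (A.perm r))| ≤ ε := by
  rw [prOne_protocolExp]
  refine abs_expect_sub_le fun r => ?_
  have hworld : 𝔼 θ : Fin n → (ZMod (𝒢.q k))ˣ, world hmn r (fun j => (θ j : ZMod (𝒢.q k)))
      (worldPerm hmn b (A.perm r)) (worldMessage b (A.perm r)) =
      ∑ pp, (𝒢.gen k pp).toReal * 𝔼 θ : Fin n → (ZMod (𝒢.q k))ˣ, 𝔼 R, 𝔼 ρ, 𝔼 β, 𝔼 γ, 𝔼 a, 𝔼 a',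
        𝔼 S, ind (masked (Q := Q) hmn r pp (worldPerm hmn b (A.perm r))
          (worldMessage b (A.perm r)) (fun j => (θ j : ZMod (𝒢.q k))) R ρ β γ a a' S) := by
    simp only [expect_masked]
    unfold world value
    simp only [Finset.mul_expect]
    rw [← Finset.expect_sum_comm]
    refine Finset.expect_congr rfl fun θ _ => ?_
    rw [← Finset.expect_sum_comm]
  rw [hworld, ← Finset.sum_sub_distrib]
  simp only [← mul_sub]
  refine abs_weighted_le (𝒢.gen k) fun pp hpp => ?_
  refine abs_expect_comm_sub_le fun θ => abs_expect_comm_sub_le fun R =>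
    abs_expect_comm_sub_le fun ρ => abs_expect_comm_sub_le fun β => abs_expect_comm_sub_le fun γ =>
    abs_expect_comm_sub_le fun a => abs_expect_comm_sub_le fun a' => ?_
  refine cprf_bound hε hn hQ (computes_mask_sim hmn hM hA r hpp ρ _ _ _ (fun i => ?_) a a')
  unfold worldMessage
  split_ifs
  · exact IsAffine.coord _
  · exact IsAffine.coord i

end

section

/-! ### The security bound -/

/-- The numerical fact is $(6/7)^3=216/343>5/8$; with 6 in place of 7 it would fail. -/
theorem hopLoss_le {q : ℕ} (hq : 7 ≤ q) {ε : ℝ} (hε : 0 ≤ ε) : hopLoss q ε ≤ 8 / 5 * ε := by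
  have hq' : (7 : ℝ) ≤ q := by exact_mod_cast hq
  have h1 : 1 / (q : ℝ) ≤ 1 / 7 := one_div_le_one_div_of_le (by norm_num) hq'
  have h3 : ((6 : ℝ) / 7) ^ 3 ≤ (1 - 1 / (q : ℝ)) ^ 3 :=
    pow_le_pow_left₀ (by norm_num) (by linarith) 3
  have h4 : (5 : ℝ) / 8 ≤ (1 - 1 / (q : ℝ)) ^ 3 := le_trans (by norm_num) h3
  calc hopLoss q ε ≤ ε / (5 / 8) := div_le_div_of_nonneg_left hε (by norm_num) h4
    _ = 8 / 5 * ε := by ring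

section Bound

variable {𝒢 : GroupGenerator} {F : FunFamily 𝒢.q} {k n m Q : ℕ} {M sA : ℕ} {δ ε : ℝ} (hmn : m ≤ n)
  {A : ExpAdversary (𝒢.q k) (𝒢.len k) n m Q}

/-- The total loss in terms of the loss `w` between the two experiments with uniform masks. -/
theorem abs_protocolExp_sub_le {w : ℝ} (hM : GroupSize 𝒢 k M) (hA : A.SizeLE sA) (hn : 2 ≤ n)
    (hQ : Q < 2 ^ k) (hδ : CPRFBound F k n Q (costMaskSim M (𝒢.len k) n m Q sA) δ)
    (hw : ∀ (r : Fin A.coins → Bool) (Θ : Fin n → ZMod (𝒢.q k)),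
      |world hmn r Θ (worldPerm hmn false (A.perm r)) (worldMessage false (A.perm r)) -
        world hmn r Θ (worldPerm hmn true (A.perm r)) (worldMessage true (A.perm r))| ≤ w) :
    |prOne (protocolExp 𝒢 F k hmn A false) - prOne (protocolExp 𝒢 F k hmn A true)| ≤
      2 * δ + w := by
  have h0 := abs_prOne_protocolExp_sub_le hmn hM hA hn hQ hδ false
  have h1 := abs_prOne_protocolExp_sub_le hmn hM hA hn hQ hδ true
  have h2 := abs_expect_sub_le fun r => abs_expect_sub_le
    fun θ : Fin n → (ZMod (𝒢.q k))ˣ => hw r fun j => (θ j : ZMod (𝒢.q k))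
  rw [abs_le] at *
  constructor <;> linarith [h0.1, h0.2, h1.1, h1.2, h2.1, h2.2]

/-- The hops cost $2\delta+2m/q$ and, when there are queries, $4m+2$ hop losses. Each hop loss is at
most $\tfrac85\varepsilon$ once $q\ge7$; for $m\ge2$ and smaller $q$ the statistical term alone
exceeds the trivial bound. -/
theorem protocolExp_bound (hm : 1 ≤ m) (hn : 2 ≤ n) (hQ : Q < 2 ^ k) (hM : GroupSize 𝒢 k M)
    (hA : A.SizeLE sA) (hδ : CPRFBound F k n Q (costMaskSim M (𝒢.len k) n m Q sA) δ)
    (hε : XDLinBound 𝒢 k n m Q M sA ε) (hδ0 : 0 ≤ δ) (hε0 : 0 ≤ ε) :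
    |prOne (protocolExp 𝒢 F k hmn A false) - prOne (protocolExp 𝒢 F k hmn A true)| ≤
      2 * (((m : ℝ) * ((m : ℝ) + 1) + (Q : ℝ) * (m : ℝ)) / (𝒢.q k : ℝ) + δ +
        ((Q : ℝ) * ((m : ℝ) ^ 2 + (m : ℝ) - 2) + (m : ℝ) ^ 2) * ε) := by
  have hq0 : (0 : ℝ) < 𝒢.q k := by exact_mod_cast (𝒢.prime k).pos
  have hQ0 : (0 : ℝ) ≤ Q := Nat.cast_nonneg Q
  have hm1 : (1 : ℝ) ≤ m := by exact_mod_cast hm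
  have hdiv : (m : ℝ) / 𝒢.q k + (m : ℝ) ^ 2 / 𝒢.q k ≤
      ((m : ℝ) * ((m : ℝ) + 1) + (Q : ℝ) * (m : ℝ)) / (𝒢.q k : ℝ) := by
    rw [← add_div]
    refine div_le_div_of_nonneg_right ?_ hq0.le
    nlinarith
  have hdiv0 : 0 ≤ (m : ℝ) / 𝒢.q k := by positivity
  have hdiv1 : 0 ≤ (m : ℝ) ^ 2 / 𝒢.q k := by positivity
  have hcoef : 0 ≤ (Q : ℝ) * ((m : ℝ) ^ 2 + (m : ℝ) - 2) :=
    mul_nonneg hQ0 (by nlinarith)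
  -- For $m=1$ the only permutation is the identity, so the two worlds coincide and only the CPRF
  -- terms remain. This case is separate because the coefficient of $Q$ vanishes there.
  rcases Nat.eq_or_lt_of_le hm with rfl | hm2
  · have h := abs_protocolExp_sub_le hmn (w := 0) hM hA hn hQ hδ fun r Θ => by
      have hπ : A.perm r = 1 := Subsingleton.elim _ _
      have h1 : worldPerm hmn false (A.perm r) = worldPerm hmn true (A.perm r) := by
        ext j
        change (extendPerm hmn (A.perm r) j : ℕ) = j
        rw [hπ]
        by_cases hj : j.val < 1
        · exact congrArg Fin.val (extendPerm_castLE hmn 1 ⟨j.val, hj⟩)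
        · rw [extendPerm_of_le hmn 1 j (not_lt.1 hj)]
      have h2 : worldMessage (q := 𝒢.q k) false (A.perm r) = worldMessage true (A.perm r) := by
        funext x i
        simp [worldMessage, hπ]
      rw [h1, h2, sub_self, abs_zero]
    have : 0 ≤ ((Q : ℝ) * (((1 : ℕ) : ℝ) ^ 2 + ((1 : ℕ) : ℝ) - 2) + ((1 : ℕ) : ℝ) ^ 2) * ε :=
      mul_nonneg (add_nonneg hcoef (by positivity)) hε0
    linarith
  have hm2' : (2 : ℝ) ≤ m := by exact_mod_cast hm2
  have hbase : (m : ℝ) ^ 2 * ε ≤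
      ((Q : ℝ) * ((m : ℝ) ^ 2 + (m : ℝ) - 2) + (m : ℝ) ^ 2) * ε :=
    mul_le_mul_of_nonneg_right (by linarith) hε0
  -- For $m\ge2$ and $q\le6$ already $(m+m^2)/q\ge1$.
  rcases lt_or_ge (𝒢.q k) 7 with hq | hq
  · have hq6 : (𝒢.q k : ℝ) ≤ 6 := by exact_mod_cast Nat.lt_succ_iff.1 hq
    have h1 : 1 ≤ (m : ℝ) / 𝒢.q k + (m : ℝ) ^ 2 / 𝒢.q k := by
      rw [← add_div, le_div_iff₀ hq0]
      nlinarith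
    have h2 : 0 ≤ (m : ℝ) ^ 2 * ε := by positivity
    have h3 : |prOne (protocolExp 𝒢 F k hmn A false) - prOne (protocolExp 𝒢 F k hmn A true)| ≤ 1 :=
      abs_sub_le_of_nonneg_of_le (prOne_nonneg _) (prOne_le_one _) (prOne_nonneg _)
        (prOne_le_one _)
    linarith
  · have h := abs_protocolExp_sub_le hmn hM hA hn hQ hδ fun r Θ =>
      abs_world_sub_le hmn r Θ (A.perm r) hM hε hA
    have hhop := hopLoss_le hq hε0
    have hmε : 2 * ε ≤ m * ε := mul_le_mul_of_nonneg_right hm2' hε0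
    have hmhop : (m : ℝ) * hopLoss (𝒢.q k) ε ≤ m * (8 / 5 * ε) :=
      mul_le_mul_of_nonneg_left hhop (by linarith)
    unfold queryLoss at h
    split_ifs at h with hQz
    · have : (m : ℝ) * (8 / 5 * ε) ≤ (m : ℝ) ^ 2 * ε := by nlinarith
      linarith
    · have hQ1 : (1 : ℝ) ≤ Q := by exact_mod_cast Nat.one_le_iff_ne_zero.2 hQz
      have h1 : ((m : ℝ) ^ 2 + (m : ℝ) - 2) ≤ (Q : ℝ) * ((m : ℝ) ^ 2 + (m : ℝ) - 2) :=
        le_mul_of_one_le_left (by nlinarith) hQ1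
      have h2 : (2 * (m : ℝ) ^ 2 + m - 2) * ε ≤
          ((Q : ℝ) * ((m : ℝ) ^ 2 + (m : ℝ) - 2) + (m : ℝ) ^ 2) * ε :=
        mul_le_mul_of_nonneg_right (by linarith) hε0
      -- Half of the $4m+2$ hop losses, at $\tfrac85\varepsilon$ each. Equality holds for $m=2$, so
      -- the constant $8/5$ is the largest that fits when $Q=1$.
      have h3 : (8 / 5 + 16 / 5 * (m : ℝ)) * ε ≤ (2 * (m : ℝ) ^ 2 + m - 2) * ε :=
        mul_le_mul_of_nonneg_right (by nlinarith) hε0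
      linarith

end Bound

/-! ### Polynomial bounds -/

theorem PolyBounded.const (c : ℕ) : PolyBounded fun _ => c :=
  ⟨Polynomial.C c, fun k => by simp⟩

theorem PolyBounded.eval (p : Polynomial ℕ) : PolyBounded fun k => p.eval k := ⟨p, fun _ => le_rfl⟩

theorem PolyBounded.add {f g : ℕ → ℕ} (hf : PolyBounded f) (hg : PolyBounded g) :
    PolyBounded fun k => f k + g k := by
  obtain ⟨p, hp⟩ := hf
  obtain ⟨p', hp'⟩ := hg
  exact ⟨p + p', fun k => by simpa using add_le_add (hp k) (hp' k)⟩

theorem PolyBounded.mul {f g : ℕ → ℕ} (hf : PolyBounded f) (hg : PolyBounded g) :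
    PolyBounded fun k => f k * g k := by
  obtain ⟨p, hp⟩ := hf
  obtain ⟨p', hp'⟩ := hg
  exact ⟨p * p', fun k => by simpa using Nat.mul_le_mul (hp k) (hp' k)⟩

theorem PolyBounded.mono {f g : ℕ → ℕ} (hg : PolyBounded g) (h : ∀ k, f k ≤ g k) :
    PolyBounded f := by
  obtain ⟨p, hp⟩ := hg
  exact ⟨p, fun k => (h k).trans (hp k)⟩

section Costs

variable {M L n m Q sA I N s s₁ s₂ : ℕ → ℕ}

theorem PolyBounded.costOne (hM : PolyBounded M) (hL : PolyBounded L) :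
    PolyBounded fun k => costOne (M k) (L k) :=
  hM.add (((const 2).mul hM).mul (hL.add (const 1)))

theorem PolyBounded.costPow (hM : PolyBounded M) (hL : PolyBounded L) (hs : PolyBounded s) :
    PolyBounded fun k => costPow (M k) (L k) (s k) :=
  hs.add (((const 2).mul hM).mul (hL.add (const 1)))

theorem PolyBounded.costForm (hM : PolyBounded M) (hL : PolyBounded L) (hN : PolyBounded N)
    (hI : PolyBounded I) (hs : PolyBounded s) :
    PolyBounded fun k => costForm (M k) (L k) (N k) (I k) (s k) :=
  (hM.costOne hL).add (hI.mul ((((hM.costPow hL hs).add ((hM.costOne hL).add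
    ((hN.mul (hL.add (const 1))).mul ((((hM.costPow hL hs).add (hM.costOne hL)).add
      ((const 8).mul hL)).add hM)))).add hM).add hM))

theorem PolyBounded.costRun (hM : PolyBounded M) (hL : PolyBounded L) (hn : PolyBounded n)
    (hm : PolyBounded m) (hQ : PolyBounded Q) (hI : PolyBounded I) (h₁ : PolyBounded s₁)
    (h₂ : PolyBounded s₂) (hA : PolyBounded sA) :
    PolyBounded fun k => costRun (M k) (L k) (n k) (m k) (Q k) (I k) (s₁ k) (s₂ k) (sA k) :=
  (((((((hn.mul hn).mul (const 8)).mul h₂).add (hn.mul h₂)).add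
    (hn.mul (((hM.costPow hL hM).add hM).add hM))).add
      (hQ.mul (hA.add ((hm.mul (const 8)).mul (hM.costForm hL hm hI h₁)))))).add hA

theorem PolyBounded.costSim (hM : PolyBounded M) (hL : PolyBounded L) (hn : PolyBounded n)
    (hm : PolyBounded m) (hQ : PolyBounded Q) (hA : PolyBounded sA) :
    PolyBounded fun k => costSim (M k) (L k) (n k) (m k) (Q k) (sA k) :=
  hM.costRun hL hn hm hQ (const 6) (hM.costOne hL)
    (hM.costForm hL (const 0) (const 6) (hM.costOne hL)) hA

theorem PolyBounded.costGuard (hM : PolyBounded M) (hL : PolyBounded L) :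
    PolyBounded fun k => costGuard (M k) (L k) :=
  ((const 2).mul ((hM.costOne hL).add (hL.mul (const 20)))).add (const 4)

theorem PolyBounded.costMaskSim (hM : PolyBounded M) (hL : PolyBounded L) (hn : PolyBounded n)
    (hm : PolyBounded m) (hQ : PolyBounded Q) (hA : PolyBounded sA) :
    PolyBounded fun k => costMaskSim (M k) (L k) (n k) (m k) (Q k) (sA k) :=
  hM.costRun hL hn hm hQ ((hQ.mul hn).add (const 1))
    (hM.costForm hL (const 1) (const 1) (hM.costOne hL)) (const 0) hA

end Costs

theorem XDLinAdversary.SizeLE.mono {L : ℕ} {D : XDLinAdversary L} {s t : ℕ} (h : D.SizeLE s)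
    (hst : s ≤ t) : D.SizeLE t :=
  ⟨h.1.trans hst, fun x => (h.2 x).mono hst⟩

theorem CPRFAdversary.SizeLE.mono {q k n κ : ℕ} {B : CPRFAdversary q k n κ} {s t : ℕ}
    (h : B.SizeLE s) (hst : s ≤ t) : B.SizeLE t :=
  ⟨h.1.trans hst, h.2.1.trans hst, h.2.2.1.mono hst, fun i => (h.2.2.2.1 i).mono hst,
    h.2.2.2.2.mono hst⟩

end

end AnonRouter

end

theorem theorem1 (𝒢 : AnonRouter.GroupGenerator) (F : AnonRouter.FunFamily 𝒢.q)
    (hF : AnonRouter.PRFSecure 𝒢 F) (hX : AnonRouter.XDLinHolds 𝒢)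
    (n m Q : ℕ → ℕ) (hn : ∀ k, 2 ≤ n k) (hm : ∀ k, 1 ≤ m k) (hmn : ∀ k, m k ≤ n k)
    (hnp : AnonRouter.PolyBounded n) (hQp : AnonRouter.PolyBounded Q)
    (A : ∀ k, AnonRouter.ExpAdversary (𝒢.q k) (𝒢.len k) (n k) (m k) (Q k))
    (hA : AnonRouter.ExpPPT 𝒢 A) :
    ∃ (B : ∀ k, AnonRouter.CPRFAdversary (𝒢.q k) k (n k) (F.keyLen k))
      (D : ∀ k, AnonRouter.XDLinAdversary (𝒢.len k)),
      AnonRouter.CPRFPPT F n B ∧ AnonRouter.XDLinPPT 𝒢 D ∧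
      ∀ k, Q k < 2 ^ k →
        |AnonRouter.prOne (AnonRouter.protocolExp 𝒢 F k (hmn k) (A k) false) -
            AnonRouter.prOne (AnonRouter.protocolExp 𝒢 F k (hmn k) (A k) true)| ≤
          2 * (((m k : ℝ) * ((m k : ℝ) + 1) + (Q k : ℝ) * (m k : ℝ)) / (𝒢.q k : ℝ) +
            AnonRouter.cprfAdv F k (n k) (B k) +
            ((Q k : ℝ) * ((m k : ℝ) ^ 2 + (m k : ℝ) - 2) + (m k : ℝ) ^ 2) *
              AnonRouter.xdlinAdv 𝒢 k (D k)) := by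
  obtain ⟨M, hM⟩ := 𝒢.exists_efficient
  obtain ⟨sA, hsA⟩ := hA
  -- The adversaries depend only on the size bounds, so a single `B` covers both CPRF replacements
  -- and a single `D` covers every XDLin hop.
  choose B hB hBbest using fun k => AnonRouter.exists_best_cprf F k (n k) (Q k)
    (AnonRouter.costMaskSim (M.eval k) (𝒢.len k) (n k) (m k) (Q k) (sA.eval k)) (hn k)
  choose D hD hDbest using fun k => AnonRouter.exists_best_xdlin 𝒢 k
    (AnonRouter.costSim (M.eval k) (𝒢.len k) (n k) (m k) (Q k) (sA.eval k) +
      AnonRouter.costGuard (M.eval k) (𝒢.len k))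
  have hmp := hnp.mono hmn
  have hMp := AnonRouter.PolyBounded.eval M
  have hAp := AnonRouter.PolyBounded.eval sA
  obtain ⟨pB, hpB⟩ := hQp.add (hMp.costMaskSim 𝒢.len_poly hnp hmp hQp hAp)
  obtain ⟨pD, hpD⟩ := (hMp.costSim 𝒢.len_poly hnp hmp hQp hAp).add (hMp.costGuard 𝒢.len_poly)
  refine ⟨B, D, ⟨pB, fun k => (hB k).mono (hpB k)⟩, ⟨pD, fun k => (hD k).mono (hpD k)⟩,
    fun k hQ => ?_⟩
  exact AnonRouter.protocolExp_bound (hmn k) (hm k) (hn k) hQ (hM k) (hsA k)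
    (fun g hg _ => hBbest k g hg) (fun g hg => hDbest k g hg) (abs_nonneg _)
    ((abs_nonneg _).trans (le_max_left _ _))
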